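/- **Setting.** A dynamic graph on $V=\{0,\dots,n-1\}$, $n\ge 2$, is a sequence of simple graphs $G_0,G_1,\dots$, where $G_0$ has no edges and $G_{t+1}$ arises from $G_t$ by inserting a non-edge or deleting an edge; the sequence of updates is fixed in advance (oblivious adversary). $\delta_G$ is the minimum degree and $d_G(v)$, $N_G(v)$ are the degree and the neighborhood of $v$. For an integer $\tau\ge 1$, the *$\tau$-star contraction* of $G$ is the following random procedure: include each vertex independently in the set $R$ of centers with probability $p=\min\{1,800\log n/\tau\}$; then every $v\in V\setminus R$ with $d_G(v)\ge\tau$ independently picks a uniformly random $r\in N_G(v)\cap R$ (if there is one) and is contracted into $r$, keeping parallel edges as edge weights. A *(possibly incomplete) contraction* of $G$ with center set $R$ is a weighted graph $G'$ on $R$ together with a partial map $\varphi:V\to R$, with $\varphi(r)=r$ for $r\in R$ and $\varphi(v)\neq v$ for $v\notin R$, and a set $F\subseteq E(G)$ of mapped edges, such that $\varphi$ is defined on both endpoints of each edge in $F$ and the weight of $\{a,b\}$ in $G'$ is the number of edges in $F$ that $\varphi$ maps to $\{a,b\}$ (loops included). It is *complete* if every edge of $G$ is mapped, i.e. $F=E(G)$.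 **Statement.** There is a randomized fully dynamic algorithm (a fixed program for a word RAM with words of $O(\log (n+\tau))$ bits, unit-cost operations and unit-cost uniformly random words) that, given $n$, an integer $\tau\ge1$ and a dynamic graph $G$, maintains for every vertex $v$ a center $R_v$, and a contraction $G'$ of $G$ as a weighted graph, such that the following holds for all $n\ge2$, $\tau\ge 1$ and all update sequences. 1. On every outcome of the random words, at all times: $R_v=v$ if $v$ is a center, and otherwise $R_v$ is a neighbor of $v$ that is a center, or null if there is none; and $G'$ is a (possibly incomplete) contraction of the current graph $G$ whose vertices are the centers. 2. On every outcome of the random words, preprocessing takes time $\tilde O(n)$, the update leading to a graph $G$ takes worst-case time $\tilde O(n/\max\{1,\delta_G\})$, and the amortized update time is $\mathrm{polylog}(n)$, i.e. any first $T$ updates take total time $T\cdot\mathrm{polylog}(n)$. 3. At every time at which $\delta_G\ge\tau$, with probability $1-O(1/\log^2 n)$ the contraction $G'$ is complete and constitutes a $\tau$-star contraction of $G$: the algorithm's randomness can be coupled with the $\tau$-star contraction procedure on $G$ so that with this probability $G'$ is complete, and both its vertex map and the centers $R_v$ are those of the procedure's sample. 4. For every constant $c$ there is a constant $C$ such that,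 if at some time $t$ the minimum degree $\delta$ of $G$ satisfies $\delta>\log^4 n$, then during the next $N\le c\,\delta/\log^3 n$ updates the probability that $R_v$ changes for at least one vertex $v\in V$ is at most $C/\log^2 n$. The constants hidden in $\tilde O$, $\mathrm{polylog}$ and $O$ in 1.–3. are absolute. -/

import Mathlib

open MeasureTheory

namespace StarContraction

/-! ### Dynamic graphs -/

/-- An edge update `{(u,v), s}`: insertion (`ins = true`) or deletion (`ins = false`) of `uv`. -/
structure Update (n : ℕ) where
  u : Fin n
  v : Fin n
  ins : Bool

/-- The graph after an update. -/
def Update.apply {n : ℕ} (e : Update n) (G : SimpleGraph (Fin n)) : SimpleGraph (Fin n) :=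
  if e.ins then G ⊔ SimpleGraph.edge e.u e.v else G.deleteEdges {s(e.u, e.v)}

/-- A legal update inserts a non-edge between distinct vertices or deletes an existing edge. -/
def Update.Valid {n : ℕ} (e : Update n) (G : SimpleGraph (Fin n)) : Prop :=
  e.u ≠ e.v ∧ (G.Adj e.u e.v ↔ e.ins = false)

/-- The dynamic graph: `graphAt upd t` is the graph after the first `t` updates, starting from
the empty graph on `n` vertices. -/
def graphAt {n : ℕ} (upd : ℕ → Update n) : ℕ → SimpleGraph (Fin n)
  | 0 => ⊥
  | t + 1 => (upd t).apply (graphAt upd t)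

def ValidSeq {n : ℕ} (upd : ℕ → Update n) : Prop :=
  ∀ t, (upd t).Valid (graphAt upd t)

/-- The minimum degree `δ_G`. -/
noncomputable def minDeg {n : ℕ} (G : SimpleGraph (Fin n)) : ℕ := by
  classical exact G.minDegree

/-! ### The static star contraction procedure -/

/-- The vertex map of a star contraction: `c v = some v` says that `v` is a center,
`c v = some r` with `r ≠ v` that `v` is contracted into the center `r`, and `c v = none` that
`v` is a non-center that is not contracted. -/
def CenterMap (n : ℕ) : Type := Fin n → Option (Fin n)

instance (n : ℕ) : MeasurableSpace (CenterMap n) := ⊤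

/-- Independent product of finitely many probability mass functions. -/
noncomputable def pmfPi {ι α : Type} [Fintype ι] [DecidableEq ι] [Fintype α]
    (q : ι → PMF α) : PMF (ι → α) :=
  PMF.ofFintype (fun f => ∏ i, q i (f i)) (by
    have h := Finset.prod_univ_sum (fun _ : ι => (Finset.univ : Finset α)) (fun i a => q i a)
    rw [Fintype.piFinset_univ] at h
    rw [← h]
    refine Finset.prod_eq_one fun i _ => ?_
    exact (tsum_fintype (fun a => q i a)).symm.trans (q i).tsum_coe)

/-- The probability `p = 800 log n / τ` (capped at `1`) with which a vertex becomes a center. -/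
noncomputable def centerProb (n τ : ℕ) : NNReal := min 1 (800 * Real.log n / τ).toNNReal

/-- A coin that shows `true` with probability `centerProb n τ`. -/
noncomputable def centerCoin (n τ : ℕ) : PMF Bool :=
  PMF.ofFintype (fun b => if b then (centerProb n τ : ENNReal) else 1 - (centerProb n τ : ENNReal))
    (by
      have h : (centerProb n τ : ENNReal) ≤ 1 := by
        exact_mod_cast (min_le_left _ _ : centerProb n τ ≤ 1)
      simp [add_tsub_cancel_of_le h])

/-- `N_G(v) ∩ R`. -/
noncomputable def centerNbrs {n : ℕ} (G : SimpleGraph (Fin n)) (R : Fin n → Bool) (v : Fin n) :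
    Finset (Fin n) := by
  classical exact Finset.univ.filter fun r => G.Adj v r ∧ R r = true

/-- `d_G(v)`. -/
noncomputable def deg {n : ℕ} (G : SimpleGraph (Fin n)) (v : Fin n) : ℕ := by
  classical exact G.degree v

/-- The choice of a vertex, given the centers `R`: a center stays itself; a non-center of degree
at least `τ` picks a uniformly random neighbor in `R`, if there is one; any other vertex is not
contracted. -/
noncomputable def choiceLaw {n : ℕ} (G : SimpleGraph (Fin n)) (τ : ℕ) (R : Fin n → Bool)
    (v : Fin n) : PMF (Option (Fin n)) :=
  if R v = true then PMF.pure (some v)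
  else if h : τ ≤ deg G v ∧ (centerNbrs G R v).Nonempty then
    (PMF.uniformOfFinset (centerNbrs G R v) h.2).map some
  else PMF.pure none

/-- The law of the (random) vertex map of the `τ`-star contraction of `G`. -/
noncomputable def starLaw {n : ℕ} (G : SimpleGraph (Fin n)) (τ : ℕ) : PMF (CenterMap n) :=
  (pmfPi fun _ : Fin n => centerCoin n τ).bind fun R => pmfPi fun v => choiceLaw G τ R v

/-! ### Contractions as weighted graphs -/

/-- What the dynamic algorithm maintains: the center vertex `R_v` of every vertex `v`, and the
weighted graph `G'` given by the vertex map `image : V → V(G')` (`none` for vertices that are not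
represented in `G'`) and the edge weights. The vertices of `G'` are the centers. -/
structure Output (n : ℕ) where
  center : CenterMap n
  image : CenterMap n
  weight : Fin n → Fin n → ℕ

/-- `G'` is the weighted graph obtained by mapping exactly the edges in `F`: both endpoints of
each edge in `F` have an image, and the weight of `{a,b}` is the number of edges in `F` that are
mapped to `{a,b}` (`a = b` counts the edges that become loops). -/
def Output.MapsEdges {n : ℕ} (O : Output n) (F : Set (Sym2 (Fin n))) : Prop :=
  (∀ e ∈ F, ∀ x ∈ e, O.image x ≠ none) ∧
  ∀ a b, O.weight a b = {e ∈ F | Sym2.map O.image e = s(some a, some b)}.ncard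

/-- The vertices of `G'` are the centers, and every represented vertex is mapped to a center. -/
def Output.ImageOK {n : ℕ} (O : Output n) : Prop :=
  (∀ v, O.image v = some v ↔ O.center v = some v) ∧
  ∀ v r, O.image v = some r → O.center r = some r

/-- `G'` is a (possibly incomplete) contraction of `G`: some of the edges of `G` are mapped. -/
def Output.IsContraction {n : ℕ} (O : Output n) (G : SimpleGraph (Fin n)) : Prop :=
  O.ImageOK ∧ ∃ F ⊆ G.edgeSet, O.MapsEdges F

/-- `G'` is a complete contraction of `G`: every edge of `G` is mapped. -/
def Output.IsComplete {n : ℕ} (O : Output n) (G : SimpleGraph (Fin n)) : Prop :=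
  O.ImageOK ∧ O.MapsEdges G.edgeSet

/-- `c` assigns to every non-center an adjacent center, unless it has none. -/
def IsCenterAssignment {n : ℕ} (G : SimpleGraph (Fin n)) (c : CenterMap n) : Prop :=
  ∀ v, c v = some v ∨ (∃ r, c v = some r ∧ G.Adj v r ∧ c r = some r) ∨
    (c v = none ∧ ∀ r, G.Adj v r → c r ≠ some r)

/-! ### The machine model

A randomized word RAM with words of `w` bits, programmed in a small imperative language with
registers, arrays and counted loops. Arithmetic is modulo `2 ^ w`; every operation, memory access,
assignment, random word, test and loop iteration costs one unit of time. A program is a fixed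
finite piece of syntax that does not depend on the input. (All programs terminate; such a program
is in particular a word RAM program with the same running time up to a constant factor.) -/

inductive Op
  | add | sub | mul | div | mod | lt | eq

/-- `sub` truncates at `0`; `lt` and `eq` return `1` for true and `0` for false. -/
def Op.eval : Op → ℕ → ℕ → ℕ
  | .add, x, y => x + y
  | .sub, x, y => x - y
  | .mul, x, y => x * y
  | .div, x, y => x / y
  | .mod, x, y => x % y
  | .lt, x, y => if x < y then 1 else 0
  | .eq, x, y => if x = y then 1 else 0

/-- Expressions: constants, registers, array entries, operations. -/
inductive Expr
  | const (k : ℕ)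
  | reg (x : ℕ)
  | get (a : ℕ) (i : Expr)
  | bin (o : Op) (e f : Expr)

/-- Commands. `store a i e` sets entry `i` of array `a` to `e`; `rand x` puts a fresh uniformly
random word into register `x`; `ite e c d` runs `c` if `e ≠ 0` and `d` otherwise; `loop e c` runs
`c` as many times as the value that `e` has on entry. -/
inductive Cmd
  | skip
  | assign (x : ℕ) (e : Expr)
  | store (a : ℕ) (i e : Expr)
  | rand (x : ℕ)
  | seq (c d : Cmd)
  | ite (e : Expr) (c d : Cmd)
  | loop (e : Expr) (c : Cmd)

/-- A machine state: registers, arrays, number of random words used, elapsed time. -/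
structure State where
  reg : ℕ → ℕ
  mem : ℕ → ℕ → ℕ
  pos : ℕ
  time : ℕ

def Expr.eval (w : ℕ) (s : State) : Expr → ℕ
  | .const k => k % 2 ^ w
  | .reg x => s.reg x
  | .get a i => s.mem a (i.eval w s)
  | .bin o e f => o.eval (e.eval w s) (f.eval w s) % 2 ^ w

def Expr.cost : Expr → ℕ
  | .const _ => 1
  | .reg _ => 1
  | .get _ i => i.cost + 1
  | .bin _ e f => e.cost + f.cost + 1

def State.tick (s : State) (k : ℕ) : State := { s with time := s.time + k }

def State.setReg (s : State) (x y : ℕ) : State := { s with reg := Function.update s.reg x y }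

def State.setMem (s : State) (a i y : ℕ) : State :=
  { s with mem := Function.update s.mem a (Function.update (s.mem a) i y) }

def State.nextWord (s : State) : State := { s with pos := s.pos + 1 }

/-- An infinite tape of random words of `w` bits. -/
abbrev Tape (w : ℕ) : Type := ℕ → Fin (2 ^ w)

/-- Independent uniformly random words. -/
noncomputable def tapeLaw (w : ℕ) : Measure (Tape w) :=
  Measure.infinitePi fun _ => (PMF.uniformOfFintype (Fin (2 ^ w))).toMeasure

/-- Execution of a command with the random words `ω`. -/
def Cmd.exec (w : ℕ) (ω : Tape w) : Cmd → State → State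
  | .skip, s => s.tick 1
  | .assign x e, s => (s.setReg x (e.eval w s)).tick (e.cost + 1)
  | .store a i e, s => (s.setMem a (i.eval w s) (e.eval w s)).tick (i.cost + e.cost + 1)
  | .rand x, s => (s.setReg x (ω s.pos)).nextWord.tick 1
  | .seq c d, s => d.exec w ω (c.exec w ω s)
  | .ite e c d, s =>
      if e.eval w s ≠ 0 then c.exec w ω (s.tick (e.cost + 1))
      else d.exec w ω (s.tick (e.cost + 1))
  | .loop e c, s =>
      (fun s' => c.exec w ω (s'.tick 1))^[e.eval w s] (s.tick (e.cost + 1))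

/-! ### Dynamic algorithms -/

/-- A dynamic algorithm: a preprocessing program, a program that is run at each update, and the
constant `K` in the word length `K ⌈log₂ (n + τ + 2)⌉`. -/
structure DynAlg where
  K : ℕ
  init : Cmd
  update : Cmd

/-- The word length in bits, logarithmic in the input parameters. -/
def DynAlg.bits (A : DynAlg) (n τ : ℕ) : ℕ := A.K * Nat.clog 2 (n + τ + 2)

/-- Initially registers `0` and `1` hold `n` and `τ`, and everything else is zero. -/
def startState (n τ : ℕ) : State where
  reg x := if x = 0 then n else if x = 1 then τ else 0
  mem _ _ := 0
  pos := 0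
  time := 0

/-- An update is handed over in registers `2`, `3` (endpoints) and `4` (insertion or deletion). -/
def State.receive {n : ℕ} (s : State) (e : Update n) : State :=
  ((s.setReg 2 e.u).setReg 3 e.v).setReg 4 (if e.ins then 1 else 0)

/-- The state after preprocessing and the first `t` updates. -/
def DynAlg.stateAt (A : DynAlg) {n : ℕ} (τ : ℕ) (upd : ℕ → Update n)
    (ω : Tape (A.bits n τ)) : ℕ → State
  | 0 => A.init.exec (A.bits n τ) ω (startState n τ)
  | t + 1 => A.update.exec (A.bits n τ) ω ((A.stateAt τ upd ω t).receive (upd t))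

/-- The word `r + 1` encodes the vertex `r`; all words outside `1, …, n` encode `none`. -/
def decodeVertex (n x : ℕ) : Option (Fin n) :=
  if h : 0 < x ∧ x ≤ n then some ⟨x - 1, by omega⟩ else none

/-- The output stands in memory: centers in array `0`, the vertex map of `G'` in array `1`, and
the weight of `{a,b}` in array `2` at the positions `a n + b` and `b n + a`. -/
def State.output (n : ℕ) (s : State) : Output n where
  center v := decodeVertex n (s.mem 0 v)
  image v := decodeVertex n (s.mem 1 v)
  weight a b := s.mem 2 (a * n + b)

/-- The output of the algorithm after the first `t` updates. -/
def DynAlg.outputAt (A : DynAlg) {n : ℕ} (τ : ℕ) (upd : ℕ → Update n)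
    (ω : Tape (A.bits n τ)) (t : ℕ) : Output n :=
  (A.stateAt τ upd ω t).output n

/-- The running time of the preprocessing. -/
def DynAlg.initTime (A : DynAlg) {n : ℕ} (τ : ℕ) (upd : ℕ → Update n)
    (ω : Tape (A.bits n τ)) : ℕ :=
  (A.stateAt τ upd ω 0).time

/-- The running time of update number `t` (the one leading from `graphAt upd t` to
`graphAt upd (t + 1)`). -/
def DynAlg.updateTime (A : DynAlg) {n : ℕ} (τ : ℕ) (upd : ℕ → Update n)
    (ω : Tape (A.bits n τ)) (t : ℕ) : ℕ :=
  (A.stateAt τ upd ω (t + 1)).time - (A.stateAt τ upd ω t).time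

/-- After the first `t` updates, `G'` is complete and constitutes a `τ`-star contraction of `G`
with probability at least `q`: the randomness of the algorithm can be coupled with a sample `c`
of the `τ`-star contraction of the current graph so that, with probability at least `q`, the
center of every vertex is the one given by `c` and `G'` is the complete contraction of `G`
along `c`. -/
def DynAlg.StarWithProb (A : DynAlg) {n : ℕ} (τ : ℕ) (upd : ℕ → Update n) (t : ℕ) (q : ℝ) :
    Prop :=
  ∃ π : Measure (Tape (A.bits n τ) × CenterMap n),
    π.map Prod.fst = tapeLaw (A.bits n τ) ∧
    π.map Prod.snd = (starLaw (graphAt upd t) τ).toMeasure ∧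
    ENNReal.ofReal q ≤ π {x | (A.outputAt τ upd x.1 t).center = x.2 ∧
      (A.outputAt τ upd x.1 t).image = x.2 ∧
      (A.outputAt τ upd x.1 t).IsComplete (graphAt upd t)}

end StarContraction

open StarContraction

namespace StarContraction

/-! ### Reasoning about programs -/

-- The centers are sampled once, in the preprocessing, and never resampled. Whenever an edge is
-- inserted, each of its two ordered pairs receives a fresh random word as priority; the center of a
-- non-center `u` is its adjacent center of largest priority, which stands at the root of a
-- tournament tree. The updates are fixed in advance, so the words that matter at a given time stand
-- in fixed, distinct cells of the tape (`prioPos_inj`). They are therefore independent and uniform,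
-- and up to ties the choice of `u` is uniform among its adjacent centers.
--
-- Stability. An update of `uv` can change the center of `u` only if `v` is the center of `u` while
-- the edge is present (`centerAt_change`). All neighbors of `u` are exchangeable, so this has
-- probability at most `1 / deg`, doubled to allow for ties (`centerAt_eq_le`). A union bound over
-- the updates and their endpoints gives `starAlg_stable`.
--
-- Completeness. Moving a vertex to a new image costs time proportional to its degree, so this is
-- postponed: the vertex becomes dirty, and every update performs `l ^ 3 + 2` units of background
-- work, where `l = ⌈log₂ n⌉`. A change of center has probability `O(1 / deg)` and creates `O(deg)`
-- work, so the expected work created by an update is constant (`integral_arrivalAt_le`). The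
-- pending work behaves like a queue. If it is not empty, then for some `k` the last `k` updates
-- created at least `(l ^ 3 + 1) k` units (`exists_busy_interval`). Harmonic weights combine all
-- values of `k` into one random variable of expectation `O(log n)`, and Markov's inequality bounds
-- the failure probability by `O(log n / log ^ 3 n)` (`tapeLaw_busy_le`). Only expectations enter;
-- the amounts of work at different times may depend on each other.
--
-- Comparison with the static procedure. For every choice of centers and of contracted vertices, the
-- algorithm produces this outcome with at least `1 - ε` times its probability in the static
-- procedure, where `ε = O(1 / n)` absorbs ties and the rounding of the sampling probability
-- (`le_tapeLaw_coins_center`). Such a domination yields a coupling that agrees with probability at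
-- least `1 - ε` (`exists_coupling`). If in addition no vertex lacks a center
-- (`tapeLaw_no_center_le`) and the queue is empty, the maintained contraction is complete
-- (`RunAt.isComplete`); this is `starAlg_star`.
--
-- Running time. All loops of an update are counted by quantities polylogarithmic in `n`, so every
-- single update is fast, which implies both the worst-case and the amortized bound
-- (`starAlg_deterministic`). The link between programs and mathematics is `Rep`, which reads memory
-- as abstract `Data`, together with the invariant `Inv`; both are carried along by `init_spec` and
-- `update_spec`.

infixr:60 " ;; " => Cmd.seq

@[simp] lemma State.tick_reg (s : State) (k : ℕ) : (s.tick k).reg = s.reg := rfl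
@[simp] lemma State.tick_mem (s : State) (k : ℕ) : (s.tick k).mem = s.mem := rfl
@[simp] lemma State.tick_pos (s : State) (k : ℕ) : (s.tick k).pos = s.pos := rfl
@[simp] lemma State.tick_time (s : State) (k : ℕ) : (s.tick k).time = s.time + k := rfl
@[simp] lemma State.setReg_reg (s : State) (x y z : ℕ) :
    (s.setReg x y).reg z = if z = x then y else s.reg z := by
  simp [State.setReg, Function.update_apply]
@[simp] lemma State.setReg_mem (s : State) (x y : ℕ) : (s.setReg x y).mem = s.mem := rfl
@[simp] lemma State.setReg_pos (s : State) (x y : ℕ) : (s.setReg x y).pos = s.pos := rfl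
@[simp] lemma State.setReg_time (s : State) (x y : ℕ) : (s.setReg x y).time = s.time := rfl
@[simp] lemma State.setMem_reg (s : State) (a i y : ℕ) : (s.setMem a i y).reg = s.reg := rfl
@[simp] lemma State.setMem_mem (s : State) (a i y b : ℕ) :
    (s.setMem a i y).mem b = if b = a then Function.update (s.mem a) i y else s.mem b := by
  simp [State.setMem, Function.update_apply]
@[simp] lemma State.setMem_pos (s : State) (a i y : ℕ) : (s.setMem a i y).pos = s.pos := rfl
@[simp] lemma State.setMem_time (s : State) (a i y : ℕ) : (s.setMem a i y).time = s.time := rfl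
@[simp] lemma State.nextWord_reg (s : State) : s.nextWord.reg = s.reg := rfl
@[simp] lemma State.nextWord_mem (s : State) : s.nextWord.mem = s.mem := rfl
@[simp] lemma State.nextWord_pos (s : State) : s.nextWord.pos = s.pos + 1 := rfl
@[simp] lemma State.nextWord_time (s : State) : s.nextWord.time = s.time := rfl

/-! ### Evaluation without overflow. -/

/-- The value of an expression in exact arithmetic. -/
def Expr.val (s : State) : Expr → ℕ
  | .const k => k
  | .reg x => s.reg x
  | .get a i => s.mem a (i.val s)
  | .bin o e f => o.eval (e.val s) (f.val s)

/-- A sufficient condition for the result of an operation to be smaller than `W`. -/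
def Op.Fits (W : ℕ) : Op → ℕ → ℕ → Prop
  | .add, x, y => x + y < W
  | .sub, x, _ => x < W
  | .mul, x, y => x * y < W
  | .div, x, _ => x < W
  | .mod, x, _ => x < W
  | .lt, _, _ => 1 < W
  | .eq, _, _ => 1 < W

@[simp] lemma Op.eval_add (x y : ℕ) : Op.eval .add x y = x + y := rfl
@[simp] lemma Op.eval_sub (x y : ℕ) : Op.eval .sub x y = x - y := rfl
@[simp] lemma Op.eval_mul (x y : ℕ) : Op.eval .mul x y = x * y := rfl
@[simp] lemma Op.eval_div (x y : ℕ) : Op.eval .div x y = x / y := rfl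
@[simp] lemma Op.eval_mod (x y : ℕ) : Op.eval .mod x y = x % y := rfl
@[simp] lemma Op.eval_lt (x y : ℕ) : Op.eval .lt x y = if x < y then 1 else 0 := rfl
@[simp] lemma Op.eval_eq (x y : ℕ) : Op.eval .eq x y = if x = y then 1 else 0 := rfl

/-- No operation in the expression overflows. -/
def Expr.Fits (W : ℕ) (s : State) : Expr → Prop
  | .const k => k < W
  | .reg _ => True
  | .get _ i => i.Fits W s
  | .bin o e f => e.Fits W s ∧ f.Fits W s ∧ o.Fits W (e.val s) (f.val s)

lemma Op.Fits.eval_lt {W x y : ℕ} {o : Op} (h : o.Fits W x y) : o.eval x y < W := by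
  cases o <;> simp only [Op.Fits, Op.eval] at h ⊢
  · exact h
  · omega
  · exact h
  · exact (Nat.div_le_self _ _).trans_lt h
  · exact (Nat.mod_le _ _).trans_lt h
  · split_ifs <;> omega
  · split_ifs <;> omega

/-- If no intermediate result reaches `2 ^ w`, all reductions modulo `2 ^ w` are trivial. Program
proofs can thus compute in `ℕ` and only discharge `Fits`. -/
lemma Expr.eval_eq {w : ℕ} {s : State} {e : Expr} (h : e.Fits (2 ^ w) s) :
    e.eval w s = e.val s := by
  induction e with
  | const k => exact Nat.mod_eq_of_lt h
  | reg x => rfl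
  | get a i ih => simp only [Expr.eval, Expr.val, ih h]
  | bin o e f ihe ihf =>
    obtain ⟨he, hf, ho⟩ := h
    simp only [Expr.eval, Expr.val, ihe he, ihf hf]
    exact Nat.mod_eq_of_lt ho.eval_lt

section exec

variable {w : ℕ} {ω : Tape w} {s : State}

lemma exec_skip : Cmd.skip.exec w ω s = s.tick 1 := rfl

lemma exec_seq {c d : Cmd} : (c ;; d).exec w ω s = d.exec w ω (c.exec w ω s) := rfl

lemma exec_rand {x : ℕ} : (Cmd.rand x).exec w ω s = (s.setReg x (ω s.pos)).nextWord.tick 1 := rfl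

lemma exec_assign {x : ℕ} {e : Expr} (h : e.Fits (2 ^ w) s) :
    (Cmd.assign x e).exec w ω s = (s.setReg x (e.val s)).tick (e.cost + 1) := by
  simp only [Cmd.exec, Expr.eval_eq h]

lemma exec_store {a : ℕ} {i e : Expr} (hi : i.Fits (2 ^ w) s) (h : e.Fits (2 ^ w) s) :
    (Cmd.store a i e).exec w ω s =
      (s.setMem a (i.val s) (e.val s)).tick (i.cost + e.cost + 1) := by
  simp only [Cmd.exec, Expr.eval_eq h, Expr.eval_eq hi]

lemma exec_ite {e : Expr} {c d : Cmd} (h : e.Fits (2 ^ w) s) :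
    (Cmd.ite e c d).exec w ω s =
      if e.val s ≠ 0 then c.exec w ω (s.tick (e.cost + 1))
      else d.exec w ω (s.tick (e.cost + 1)) := by
  simp only [Cmd.exec, Expr.eval_eq h]

/-- The invariant rule for counted loops. -/
lemma exec_loop_induct {x k : ℕ} {c : Cmd} (P : ℕ → State → Prop) (hk : s.reg x = k)
    (h0 : P 0 (s.tick 2))
    (hs : ∀ i < k, ∀ s, P i s → P (i + 1) (c.exec w ω (s.tick 1))) :
    P k ((Cmd.loop (.reg x) c).exec w ω s) := by
  have : ∀ j ≤ k, P j ((fun s' => c.exec w ω (s'.tick 1))^[j] (s.tick 2)) := by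
    intro j hj
    induction j with
    | zero => exact h0
    | succ j ih =>
      rw [Function.iterate_succ_apply']
      exact hs j (by omega) _ (ih (by omega))
  have h := this k le_rfl
  simpa only [Cmd.exec, Expr.eval, hk, Expr.cost] using h

end exec

/-! ### Frame conditions and running times read off the syntax. -/

/-- The registers that a command may change. -/
def Cmd.regs : Cmd → List ℕ
  | .skip => []
  | .assign x _ => [x]
  | .store _ _ _ => []
  | .rand x => [x]
  | .seq c d => c.regs ++ d.regs
  | .ite _ c d => c.regs ++ d.regs
  | .loop _ c => c.regs

/-- The arrays that a command may change. -/
def Cmd.arrs : Cmd → List ℕ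
  | .skip => []
  | .assign _ _ => []
  | .store a _ _ => [a]
  | .rand _ => []
  | .seq c d => c.arrs ++ d.arrs
  | .ite _ c d => c.arrs ++ d.arrs
  | .loop _ c => c.arrs

/-- The command does not use random words. -/
def Cmd.randFree : Cmd → Bool
  | .rand _ => false
  | .seq c d => c.randFree && d.randFree
  | .ite _ c d => c.randFree && d.randFree
  | .loop _ c => c.randFree
  | _ => true

/-- All loops are counted by registers in the list `L`. -/
def Cmd.loopsOver (L : List ℕ) : Cmd → Bool
  | .seq c d => c.loopsOver L && d.loopsOver L
  | .ite _ c d => c.loopsOver L && d.loopsOver L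
  | .loop (.reg x) c => L.contains x && c.loopsOver L
  | .loop _ _ => false
  | _ => true

/-- A bound on the running time, given the values `ρ` of the registers that count loops. -/
def Cmd.timeBound (ρ : ℕ → ℕ) : Cmd → ℕ
  | .skip => 1
  | .assign _ e => e.cost + 1
  | .store _ i e => i.cost + e.cost + 1
  | .rand _ => 1
  | .seq c d => c.timeBound ρ + d.timeBound ρ
  | .ite e c d => e.cost + 1 + (c.timeBound ρ + d.timeBound ρ)
  | .loop (.reg x) c => 2 + ρ x * (c.timeBound ρ + 1)
  | .loop _ _ => 0

section frame

variable {w : ℕ} {ω : Tape w}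

lemma iterate_preserves {α β : Type*} {f : α → α} {g : α → β} (h : ∀ a, g (f a) = g a) (k : ℕ)
    (a : α) : g (f^[k] a) = g a := by
  induction k with
  | zero => rfl
  | succ k ih => rw [Function.iterate_succ_apply', h, ih]

lemma exec_reg_of_notMem {c : Cmd} {x : ℕ} (h : x ∉ c.regs) (s : State) :
    (c.exec w ω s).reg x = s.reg x := by
  induction c generalizing s with
  | skip => rfl
  | assign y e =>
    simp only [Cmd.regs, List.mem_singleton] at h
    simp [Cmd.exec, h]
  | store a i e => rfl
  | rand y =>
    simp only [Cmd.regs, List.mem_singleton] at h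
    simp [Cmd.exec, h]
  | seq c d ihc ihd =>
    simp only [Cmd.regs, List.mem_append, not_or] at h
    rw [exec_seq, ihd h.2, ihc h.1]
  | ite e c d ihc ihd =>
    simp only [Cmd.regs, List.mem_append, not_or] at h
    simp only [Cmd.exec]
    split_ifs
    · rw [ihc h.1]; rfl
    · rw [ihd h.2]; rfl
  | loop e c ih =>
    simp only [Cmd.exec]
    rw [iterate_preserves (g := fun s : State => s.reg x) (fun s => ih h (s.tick 1))]
    rfl

lemma exec_mem_of_notMem {c : Cmd} {a : ℕ} (h : a ∉ c.arrs) (s : State) :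
    (c.exec w ω s).mem a = s.mem a := by
  induction c generalizing s with
  | skip => rfl
  | assign y e => rfl
  | store b i e =>
    simp only [Cmd.arrs, List.mem_singleton] at h
    simp [Cmd.exec, h]
  | rand y => rfl
  | seq c d ihc ihd =>
    simp only [Cmd.arrs, List.mem_append, not_or] at h
    rw [exec_seq, ihd h.2, ihc h.1]
  | ite e c d ihc ihd =>
    simp only [Cmd.arrs, List.mem_append, not_or] at h
    simp only [Cmd.exec]
    split_ifs
    · rw [ihc h.1]; rfl
    · rw [ihd h.2]; rfl
  | loop e c ih =>
    simp only [Cmd.exec]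
    rw [iterate_preserves (g := fun s : State => s.mem a) (fun s => ih h (s.tick 1))]
    rfl

lemma exec_pos_of_randFree {c : Cmd} (h : c.randFree = true) (s : State) :
    (c.exec w ω s).pos = s.pos := by
  induction c generalizing s with
  | skip => rfl
  | assign y e => rfl
  | store b i e => rfl
  | rand y => simp [Cmd.randFree] at h
  | seq c d ihc ihd =>
    simp only [Cmd.randFree, Bool.and_eq_true] at h
    rw [exec_seq, ihd h.2, ihc h.1]
  | ite e c d ihc ihd =>
    simp only [Cmd.randFree, Bool.and_eq_true] at h
    simp only [Cmd.exec]
    split_ifs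
    · rw [ihc h.1]; rfl
    · rw [ihd h.2]; rfl
  | loop e c ih =>
    simp only [Cmd.exec]
    rw [iterate_preserves (g := fun s : State => s.pos) (fun s => ih h (s.tick 1))]
    rfl

/-- The counters in `L` are never written, so each loop runs as often as the initial values `ρ` say,
however deeply it is nested. Both branches of a conditional are charged. -/
lemma exec_time_le {L : List ℕ} {ρ : ℕ → ℕ} {c : Cmd} (hL : ∀ x ∈ L, x ∉ c.regs)
    (hc : c.loopsOver L = true) {s : State} (hs : ∀ x ∈ L, s.reg x = ρ x) :
    (c.exec w ω s).time ≤ s.time + c.timeBound ρ := by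
  induction c generalizing s with
  | skip => simp [Cmd.exec, Cmd.timeBound]
  | assign y e => simp [Cmd.exec, Cmd.timeBound]
  | store b i e => simp [Cmd.exec, Cmd.timeBound]
  | rand y => simp [Cmd.exec, Cmd.timeBound]
  | seq c d ihc ihd =>
    simp only [Cmd.regs, List.mem_append, not_or] at hL
    simp only [Cmd.loopsOver, Bool.and_eq_true] at hc
    have h1 := ihc (fun x hx => (hL x hx).1) hc.1 hs
    have h2 := ihd (s := c.exec w ω s) (fun x hx => (hL x hx).2) hc.2
      (fun x hx => (exec_reg_of_notMem (hL x hx).1 s).trans (hs x hx))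
    simp only [exec_seq, Cmd.timeBound]
    omega
  | ite e c d ihc ihd =>
    simp only [Cmd.regs, List.mem_append, not_or] at hL
    simp only [Cmd.loopsOver, Bool.and_eq_true] at hc
    simp only [Cmd.exec, Cmd.timeBound]
    split_ifs
    · have := ihc (s := s.tick (e.cost + 1)) (fun x hx => (hL x hx).1) hc.1 hs
      simp only [State.tick_time] at this
      omega
    · have := ihd (s := s.tick (e.cost + 1)) (fun x hx => (hL x hx).2) hc.2 hs
      simp only [State.tick_time] at this
      omega
  | loop e c ih =>
    cases e with
    | const k => simp [Cmd.loopsOver] at hc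
    | get a i => simp [Cmd.loopsOver] at hc
    | bin o e f => simp [Cmd.loopsOver] at hc
    | reg x =>
      simp only [Cmd.loopsOver, Bool.and_eq_true, List.contains_iff_mem] at hc
      have := exec_loop_induct (w := w) (ω := ω) (s := s) (x := x) (k := ρ x) (c := c)
        (fun j s' => (∀ y ∈ L, s'.reg y = ρ y) ∧
          s'.time ≤ s.time + 2 + j * (c.timeBound ρ + 1)) (hs x hc.1)
        ⟨hs, by simp⟩ (by
          rintro i - s' ⟨h1, h2⟩
          refine ⟨fun y hy =>
            (exec_reg_of_notMem (c := c) (hL y hy) _).trans (h1 y hy), ?_⟩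
          have := ih (s := s'.tick 1) hL hc.2 h1
          simp only [State.tick_time] at this
          have e : (i + 1) * (c.timeBound ρ + 1) =
            i * (c.timeBound ρ + 1) + (c.timeBound ρ + 1) := by ring
          rw [e]
          omega)
      have := this.2
      simp only [Cmd.timeBound]
      omega

end frame

/-- The nesting depth of loops. -/
def Cmd.depth : Cmd → ℕ
  | .seq c d => c.depth + d.depth
  | .ite _ c d => c.depth + d.depth
  | .loop _ c => c.depth + 1
  | _ => 0

/-- Each level of nesting multiplies the bound by `m`. Adding the depths of consecutive commands
overestimates the degree, but any degree that depends on the syntax alone serves for a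
polylogarithmic bound. -/
lemma exists_timeBound_le (c : Cmd) :
    ∃ C : ℕ, ∀ (m : ℕ) (ρ : ℕ → ℕ), 1 ≤ m → (∀ x, ρ x ≤ m) →
      c.timeBound ρ ≤ C * m ^ c.depth := by
  have key : ∀ {a b m : ℕ}, 1 ≤ m → m ^ a ≤ m ^ (a + b) := fun h =>
    Nat.pow_le_pow_right h (Nat.le_add_right _ _)
  have key2 : ∀ {a b m : ℕ}, 1 ≤ m → m ^ b ≤ m ^ (a + b) := fun h =>
    Nat.pow_le_pow_right h (Nat.le_add_left _ _)
  induction c with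
  | skip => exact ⟨1, fun m ρ _ _ => by simp [Cmd.timeBound, Cmd.depth]⟩
  | assign y e => exact ⟨e.cost + 1, fun m ρ _ _ => by simp [Cmd.timeBound, Cmd.depth]⟩
  | store b i e => exact ⟨i.cost + e.cost + 1, fun m ρ _ _ => by simp [Cmd.timeBound, Cmd.depth]⟩
  | rand y => exact ⟨1, fun m ρ _ _ => by simp [Cmd.timeBound, Cmd.depth]⟩
  | seq c d ihc ihd =>
    obtain ⟨C, hC⟩ := ihc
    obtain ⟨D, hD⟩ := ihd
    refine ⟨C + D, fun m ρ hm hρ => ?_⟩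
    simp only [Cmd.timeBound, Cmd.depth, add_mul]
    exact Nat.add_le_add ((hC m ρ hm hρ).trans (Nat.mul_le_mul_left _ (key hm)))
      ((hD m ρ hm hρ).trans (Nat.mul_le_mul_left _ (key2 hm)))
  | ite e c d ihc ihd =>
    obtain ⟨C, hC⟩ := ihc
    obtain ⟨D, hD⟩ := ihd
    refine ⟨e.cost + 1 + (C + D), fun m ρ hm hρ => ?_⟩
    simp only [Cmd.timeBound, Cmd.depth]
    rw [add_mul _ (C + D), add_mul C D]
    exact Nat.add_le_add (Nat.le_mul_of_pos_right _ (Nat.pow_pos hm)) (Nat.add_le_add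
      ((hC m ρ hm hρ).trans (Nat.mul_le_mul_left _ (key hm)))
      ((hD m ρ hm hρ).trans (Nat.mul_le_mul_left _ (key2 hm))))
  | loop e c ih =>
    obtain ⟨C, hC⟩ := ih
    refine ⟨C + 3, fun m ρ hm hρ => ?_⟩
    cases e with
    | reg x =>
      simp only [Cmd.timeBound, Cmd.depth]
      have h1 : 1 ≤ m ^ c.depth := Nat.pow_pos hm
      calc 2 + ρ x * (c.timeBound ρ + 1) ≤ 2 * (m ^ c.depth * m) + m * (C * m ^ c.depth + m ^ c.depth) := by
            have := Nat.mul_le_mul (hρ x) (Nat.add_le_add (hC m ρ hm hρ) h1)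
            have h2 : 1 ≤ m ^ c.depth * m := Nat.mul_pos h1 hm
            omega
        _ = (C + 3) * m ^ (c.depth + 1) := by ring
    | const k => simp [Cmd.timeBound]
    | get a i => simp [Cmd.timeBound]
    | bin o e f => simp [Cmd.timeBound]

end StarContraction

namespace StarContraction

/-! ### Tournament trees

A tree with `2 ^ l` leaves `f 0, f 1, …` occupies the cells `1, …, 2 ^ (l + 1) - 1` behind the
address `b`; node `q` has the children `2 q` and `2 q + 1`, and every inner node holds the maximum
of its children. -/

structure IsTree (m : ℕ → ℕ) (b l : ℕ) (f : ℕ → ℕ) : Prop where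
  leaf : ∀ i < 2 ^ l, m (b + (2 ^ l + i)) = f i
  node : ∀ q, 1 ≤ q → q < 2 ^ l → m (b + q) = max (m (b + 2 * q)) (m (b + (2 * q + 1)))

lemma IsTree.congr {m m' f f' : ℕ → ℕ} {b l : ℕ} (h : IsTree m b l f)
    (hm : ∀ q < 2 * 2 ^ l, m' (b + q) = m (b + q)) (hf : ∀ i < 2 ^ l, f i = f' i) :
    IsTree m' b l f' where
  leaf i hi := by rw [hm _ (by omega), h.leaf i hi, hf i hi]
  node q h1 h2 := by rw [hm _ (by omega), hm _ (by omega), hm _ (by omega), h.node q h1 h2]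

/-- The values along the ancestors `(2 ^ l + i) / 2 ^ j` of the leaf never decrease. -/
lemma IsTree.le_root {m f : ℕ → ℕ} {b l : ℕ} (h : IsTree m b l f) {i : ℕ} (hi : i < 2 ^ l) :
    f i ≤ m (b + 1) := by
  have key : ∀ j ≤ l, f i ≤ m (b + (2 ^ l + i) / 2 ^ j) := by
    intro j hj
    induction j with
    | zero => simp [h.leaf i hi]
    | succ j ih =>
      have h0 := ih (by omega)
      rw [pow_succ, ← Nat.div_div_eq_div_mul]
      set q := (2 ^ l + i) / 2 ^ j with hq
      have hlt : q / 2 < 2 ^ l := by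
        have : q ≤ 2 ^ l + i := Nat.div_le_self _ _
        omega
      have hge : 2 ≤ q := by
        rw [hq, Nat.le_div_iff_mul_le (by positivity)]
        have : 2 * 2 ^ j ≤ 2 ^ l := by
          rw [← pow_succ']; exact Nat.pow_le_pow_right (by norm_num) hj
        omega
      rw [h.node _ (by omega) hlt]
      rcases Nat.mod_two_eq_zero_or_one q with h2 | h2
      · have : 2 * (q / 2) = q := by omega
        rw [this]; exact h0.trans (le_max_left _ _)
      · have : 2 * (q / 2) + 1 = q := by omega
        rw [this]; exact h0.trans (le_max_right _ _)
  have := key l le_rfl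
  rwa [show (2 ^ l + i) / 2 ^ l = 1 by
    rw [Nat.add_div_left _ (by positivity), Nat.div_eq_of_lt hi]] at this

/-- Descend from the root, always to a child that attains the maximum. -/
lemma IsTree.exists_root {m f : ℕ → ℕ} {b l : ℕ} (h : IsTree m b l f) :
    ∃ i < 2 ^ l, f i = m (b + 1) := by
  have key : ∀ k q, 2 * 2 ^ l - q = k → 1 ≤ q → q < 2 * 2 ^ l → ∃ i < 2 ^ l, f i = m (b + q) := by
    intro k
    induction k using Nat.strong_induction_on with
    | _ k ih =>
      intro q hk h1 h2
      by_cases hq : q < 2 ^ l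
      · rw [h.node q h1 hq]
        rcases max_choice (m (b + 2 * q)) (m (b + (2 * q + 1))) with h3 | h3
        · rw [h3]; exact ih _ (by omega) (2 * q) rfl (by omega) (by omega)
        · rw [h3]; exact ih _ (by omega) (2 * q + 1) rfl (by omega) (by omega)
      · refine ⟨q - 2 ^ l, by omega, ?_⟩
        rw [← h.leaf _ (by omega)]
        congr 2; omega
  have := Nat.one_le_two_pow (n := l)
  exact key _ 1 rfl le_rfl (by omega)

/-- Sets leaf number `reg 21` of the tree at address `reg 20` in array `a` to `reg 22`. The
registers `sz` and `dp` hold the number of leaves and its logarithm. -/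
def treeSet (a sz dp : ℕ) : Cmd :=
  .assign 25 (.bin .add (.reg sz) (.reg 21)) ;;
  .store a (.bin .add (.reg 20) (.reg 25)) (.reg 22) ;;
  .loop (.reg dp)
    (.assign 25 (.bin .div (.reg 25) (.const 2)) ;;
     .assign 26 (.get a (.bin .add (.reg 20) (.bin .mul (.const 2) (.reg 25)))) ;;
     .assign 27 (.get a (.bin .add (.reg 20) (.bin .add (.bin .mul (.const 2) (.reg 25))
      (.const 1)))) ;;
     .ite (.bin .lt (.reg 26) (.reg 27))
      (.store a (.bin .add (.reg 20) (.reg 25)) (.reg 27))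
      (.store a (.bin .add (.reg 20) (.reg 25)) (.reg 26)))

/-- Invariant: after `j` rounds the maximum rule can fail only at ancestors of the leaf above height
`j`, so after `l` rounds it holds everywhere. That cells outside the tree are untouched allows many
trees to share an array. -/
theorem treeSet_spec {w : ℕ} {ω : Tape w} {s : State} {a sz dp b l i x : ℕ} {f : ℕ → ℕ}
    (hsz : s.reg sz = 2 ^ l) (hdp : s.reg dp = l)
    (hdp' : dp ≠ 25) (hb : s.reg 20 = b) (hi : s.reg 21 = i)
    (hx : s.reg 22 = x) (hil : i < 2 ^ l) (hW : b + 2 * 2 ^ l < 2 ^ w)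
    (ht : IsTree (s.mem a) b l f) :
    IsTree (((treeSet a sz dp).exec w ω s).mem a) b l (Function.update f i x) ∧
    ∀ j, (j < b ∨ b + 2 * 2 ^ l ≤ j) → ((treeSet a sz dp).exec w ω s).mem a j = s.mem a j := by
  have hl1 := Nat.one_le_two_pow (n := l)
  have key := exec_loop_induct (w := w) (ω := ω) (k := l) (x := dp)
    (c := .assign 25 (.bin .div (.reg 25) (.const 2)) ;;
     .assign 26 (.get a (.bin .add (.reg 20) (.bin .mul (.const 2) (.reg 25)))) ;;
     .assign 27 (.get a (.bin .add (.reg 20) (.bin .add (.bin .mul (.const 2) (.reg 25))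
      (.const 1)))) ;;
     .ite (.bin .lt (.reg 26) (.reg 27))
      (.store a (.bin .add (.reg 20) (.reg 25)) (.reg 27))
      (.store a (.bin .add (.reg 20) (.reg 25)) (.reg 26)))
    (s := (Cmd.store a (.bin .add (.reg 20) (.reg 25)) (.reg 22)).exec w ω
      ((Cmd.assign 25 (.bin .add (.reg sz) (.reg 21))).exec w ω s))
    (fun j s' => s'.reg 20 = b ∧ s'.reg 25 = (2 ^ l + i) / 2 ^ j ∧
      (∀ k < 2 ^ l, s'.mem a (b + (2 ^ l + k)) = Function.update f i x k) ∧
      (∀ q, 1 ≤ q → q < 2 ^ l → (∀ j', j < j' → j' ≤ l → q ≠ (2 ^ l + i) / 2 ^ j') →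
        s'.mem a (b + q) = max (s'.mem a (b + 2 * q)) (s'.mem a (b + (2 * q + 1)))) ∧
      ∀ j, (j < b ∨ b + 2 * 2 ^ l ≤ j) → s'.mem a j = s.mem a j)
    ?_ ?_ ?_
  · obtain ⟨-, -, h1, h2, h3⟩ := key
    exact ⟨⟨h1, fun q hq hq' => h2 q hq hq' fun j' hj hj' => absurd hj' (by omega)⟩, h3⟩
  · rw [exec_assign (by simp [Expr.Fits, Expr.val, Op.Fits, hsz, hi]; omega),
      exec_store (by simp [Expr.Fits, Expr.val, Op.Fits, hsz, hi, hb, Op.eval]; omega)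
        (by simp [Expr.Fits])]
    simp [hdp', hdp]
  · rw [exec_assign (by simp [Expr.Fits, Expr.val, Op.Fits, hsz, hi]; omega),
      exec_store (by simp [Expr.Fits, Expr.val, Op.Fits, hsz, hi, hb, Op.eval]; omega)
        (by simp [Expr.Fits])]
    simp only [Expr.val, Op.eval, hsz, hi, State.tick_reg, State.setReg_reg, State.tick_mem,
      State.setMem_reg, State.setMem_mem, State.setReg_mem, hb, hx, if_true, if_false,
      show (20 : ℕ) ≠ 25 by decide, show (22 : ℕ) ≠ 25 by decide, pow_zero, Nat.div_one, true_and]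
    refine ⟨fun k hk => ?_, fun q hq1 hq2 hq => ?_, fun j hj => ?_⟩
    · simp only [Function.update_apply]
      by_cases h : k = i
      · simp [h]
      · rw [if_neg (by omega), if_neg h, ht.leaf k hk]
    -- The new leaf value enters only the equation of its parent, which is still exempt.
    · have e1 : 2 * q ≠ 2 ^ l + i ∧ 2 * q + 1 ≠ 2 ^ l + i := by
        have hl : 0 < l := by
          by_contra h
          have : l = 0 := by omega
          subst this
          simp at hq2; omega
        have := hq 1 (by omega) (by omega)
        constructor <;> intro h <;> apply this <;> omega
      simp only [Function.update_apply]
      rw [if_neg (by omega), if_neg (by omega), if_neg (by omega)]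
      exact ht.node q hq1 hq2
    · simp only [Function.update_apply]
      rw [if_neg (by omega)]
  · rintro j hj s' ⟨h20, h25, hleaf, hnode, hout⟩
    have hp1 : 2 ≤ (2 ^ l + i) / 2 ^ j := by
      rw [Nat.le_div_iff_mul_le (by positivity)]
      have : 2 * 2 ^ j ≤ 2 ^ l := by
        rw [← pow_succ']; exact Nat.pow_le_pow_right (by norm_num) hj
      omega
    have hp2 : (2 ^ l + i) / 2 ^ j ≤ 2 ^ l + i := Nat.div_le_self _ _
    have hanc : ∀ j', (2 ^ l + i) / 2 ^ (j' + 1) = (2 ^ l + i) / 2 ^ j' / 2 := fun j' => by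
      rw [pow_succ, Nat.div_div_eq_div_mul]
    set p := (2 ^ l + i) / 2 ^ j with hp
    have hW2 : 2 < 2 ^ w := by omega
    have hw : w ≠ 0 := by rintro rfl; simp at hW2
    rw [exec_seq, exec_assign (by simp [Expr.Fits, Expr.val, Op.Fits, h25]; omega),
      exec_seq, exec_assign (by simp [Expr.Fits, Expr.val, Op.Fits, Op.eval, h25, h20]; omega),
      exec_seq, exec_assign (by simp [Expr.Fits, Expr.val, Op.Fits, Op.eval, h25, h20]; omega),
      exec_ite (by simp [Expr.Fits, Op.Fits, hw]),
      exec_store (by simp [Expr.Fits, Expr.val, Op.Fits, h25, h20, Op.eval]; omega)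
        (by simp [Expr.Fits]),
      exec_store (by simp [Expr.Fits, Expr.val, Op.Fits, h25, h20, Op.eval]; omega)
        (by simp [Expr.Fits])]
    have hfin : ∀ s'' : State, s''.reg 20 = b → s''.reg 25 = p / 2 →
        s''.mem a = Function.update (s'.mem a) (b + p / 2)
          (max (s'.mem a (b + 2 * (p / 2))) (s'.mem a (b + (2 * (p / 2) + 1)))) →
        (s''.reg 20 = b ∧ s''.reg 25 = (2 ^ l + i) / 2 ^ (j + 1) ∧
        (∀ k < 2 ^ l, s''.mem a (b + (2 ^ l + k)) = Function.update f i x k) ∧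
        (∀ q, 1 ≤ q → q < 2 ^ l → (∀ j', j + 1 < j' → j' ≤ l → q ≠ (2 ^ l + i) / 2 ^ j') →
        s''.mem a (b + q) = max (s''.mem a (b + 2 * q)) (s''.mem a (b + (2 * q + 1)))) ∧
        ∀ j, (j < b ∨ b + 2 * 2 ^ l ≤ j) → s''.mem a j = s.mem a j) := by
      intro s'' g20 g25 gm
      refine ⟨g20, by rw [g25, hanc], ?_, ?_, ?_⟩
      · intro k hk
        rw [gm, Function.update_apply, if_neg (by omega), hleaf k hk]
      · intro q hq1 hq2 hq
        rw [gm]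
        simp only [Function.update_apply]
        by_cases hqp : q = p / 2
        · subst hqp
          rw [if_pos rfl, if_neg (by omega), if_neg (by omega)]
        · rw [if_neg (by omega)]
          -- Overwriting `p / 2` can spoil only the equation of its parent; that is the next
          -- ancestor and stays exempt until the next round. If `p / 2` is the root, it has no
          -- parent.
          by_cases hpar : 2 * q = p / 2 ∨ 2 * q + 1 = p / 2
          · exfalso
            have hjl : j + 2 ≤ l := by
              by_contra hcon
              have : j + 1 = l := by omega
              have h1 : p / 2 = 1 := by
                rw [hp, ← hanc, this, Nat.add_div_left _ (by positivity), Nat.div_eq_of_lt hil]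
              omega
            refine hq (j + 2) (by omega) hjl ?_
            rw [hanc (j + 1), hanc j]
            omega
          · rw [if_neg (by omega), if_neg (by omega)]
            refine hnode q hq1 hq2 fun j' hj' hj'' => ?_
            rcases Nat.lt_or_ge (j + 1) j' with h | h
            · exact hq j' h hj''
            · have : j' = j + 1 := by omega
              rw [this, hanc]; exact hqp
      · intro j hj
        rw [gm, Function.update_apply, if_neg (by omega), hout j hj]
    split_ifs with hc
    · refine hfin _ (by simp [h20]) (by simp [Expr.val, Op.eval, h25]) ?_
      simp [Expr.val, Op.eval, h25, h20] at hc ⊢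
      simp [max_eq_right hc.le]
    · refine hfin _ (by simp [h20]) (by simp [Expr.val, Op.eval, h25]) ?_
      simp [Expr.val, Op.eval, h25, h20] at hc ⊢
      simp [max_eq_left hc]

end StarContraction

namespace StarContraction

/-! ### The data structure -/

/-- The abstract contents of the memory. `isC` marks the centers; `key u v` is the priority of the
center `v` among the neighbors of `u`; `cen` and `img` are the words in the output arrays; `mp`
and `un` are the edges that are mapped and those that are still to be mapped; `dirty` marks the
vertices whose image differs from their center. -/
structure Data (n : ℕ) where
  isC : Fin n → Bool
  key : Fin n → Fin n → ℕ
  cen : Fin n → ℕ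
  img : Fin n → ℕ
  mp : Fin n → Fin n → Bool
  un : Fin n → Fin n → Bool
  dirty : Fin n → Bool
  wt : Fin n → Fin n → ℕ

variable {n : ℕ}

/-- `b` at the pairs `(x, y)` and `(y, x)`, and `g` elsewhere. -/
def setSym {α : Type*} (g : Fin n → Fin n → α) (x y : Fin n) (b : α) : Fin n → Fin n → α :=
  fun p q => if (p = x ∧ q = y) ∨ (p = y ∧ q = x) then b else g p q

/-- `b` at the pair `(x, y)`, and `g` elsewhere. -/
def setPair {α : Type*} (g : Fin n → Fin n → α) (x y : Fin n) (b : α) : Fin n → Fin n → α :=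
  fun p q => if p = x ∧ q = y then b else g p q

lemma setPair_setPair {α : Type*} (g : Fin n → Fin n → α) (x y : Fin n) (b : α) :
    setPair (setPair g x y b) y x b = setSym g x y b := by
  funext p q
  simp only [setPair, setSym]
  split_ifs <;> first | rfl | tauto

/-- Extension by zero of a function on vertices to leaves. -/
def extend (g : Fin n → ℕ) (i : ℕ) : ℕ := if h : i < n then g ⟨i, h⟩ else 0

/-- The leaves of a tree that represents a set of vertices. -/
def setLeaves (p : Fin n → Bool) : Fin n → ℕ := fun v => if p v then v + 1 else 0

/-- The leaves of the tree that represents a set of pairs of vertices. -/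
def pairLeaves (l : ℕ) (p : Fin n → Fin n → Bool) (i : ℕ) : ℕ :=
  if h : i / 2 ^ l < n ∧ i % 2 ^ l < n then
    (if p ⟨i / 2 ^ l, h.1⟩ ⟨i % 2 ^ l, h.2⟩ then i + 1 else 0) else 0

lemma extend_coe (g : Fin n → ℕ) (v : Fin n) : extend g v = g v := by simp [extend]

lemma update_extend (g : Fin n → ℕ) (v : Fin n) (k : ℕ) :
    Function.update (extend g) v k = extend (Function.update g v k) := by
  funext i
  simp only [extend, Function.update_apply]
  by_cases h : i < n
  · by_cases hv : i = v
    · subst hv; simp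
    · have : (⟨i, h⟩ : Fin n) ≠ v := fun e => hv (by rw [← e])
      simp [h, hv, this]
  · have : i ≠ v := fun e => h (e ▸ v.2)
    simp [h, this]

lemma pairLeaves_coe {l : ℕ} (hn : n ≤ 2 ^ l) (p : Fin n → Fin n → Bool) (x y : Fin n) :
    pairLeaves l p (x * 2 ^ l + y) = if p x y then ((x : ℕ) * 2 ^ l + y) + 1 else 0 := by
  have hy : (y : ℕ) < 2 ^ l := y.2.trans_le hn
  have h1 : ((x : ℕ) * 2 ^ l + y) / 2 ^ l = x := by
    rw [mul_comm, Nat.mul_add_div (by positivity), Nat.div_eq_of_lt hy, add_zero]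
  have h2 : ((x : ℕ) * 2 ^ l + y) % 2 ^ l = y := by
    rw [mul_comm, Nat.mul_add_mod, Nat.mod_eq_of_lt hy]
  simp only [pairLeaves, h1, h2]
  simp

lemma update_pairLeaves {l : ℕ} (hn : n ≤ 2 ^ l) (p : Fin n → Fin n → Bool) (x y : Fin n)
    (b : Bool) :
    Function.update (pairLeaves l p) (x * 2 ^ l + y)
      (if b then ((x : ℕ) * 2 ^ l + y) + 1 else 0) =
      pairLeaves l (setPair p x y b) := by
  funext i
  rw [Function.update_apply]
  split_ifs with h h2
  · rw [h, pairLeaves_coe hn]; simp [setPair, h2]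
  · rw [h, pairLeaves_coe hn]; simp [setPair, h2]
  · simp only [pairLeaves, setPair]
    by_cases h3 : i / 2 ^ l < n ∧ i % 2 ^ l < n
    · have : ¬ ((⟨i / 2 ^ l, h3.1⟩ : Fin n) = x ∧ (⟨i % 2 ^ l, h3.2⟩ : Fin n) = y) := by
        rintro ⟨e1, e2⟩
        apply h
        rw [← e1, ← e2]
        exact (Nat.div_add_mod' i (2 ^ l)).symm
      simp [h3, this]
    · simp [h3]

/-- The parameters are consistent, and words are long enough. -/
structure Sizes (w n l : ℕ) : Prop where
  two_le : 2 ≤ n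
  pos : 1 ≤ l
  le : n ≤ 2 ^ l
  word : (2 ^ l) ^ 40 ≤ 2 ^ w

namespace Sizes

variable {w l : ℕ} (h : Sizes w n l)
include h

lemma two_le_pow : 2 ≤ 2 ^ l := by
  calc 2 = 2 ^ 1 := rfl
    _ ≤ 2 ^ l := Nat.pow_le_pow_right (by norm_num) h.pos

lemma pow_lt {k : ℕ} (hk : k < 40) : (2 ^ l) ^ k < 2 ^ w :=
  (Nat.pow_lt_pow_right h.two_le_pow hk).trans_le h.word

lemma small {k : ℕ} (hk : k ≤ 1024) : k < 2 ^ w := by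
  have : 2 ^ 19 ≤ (2 ^ l) ^ 19 := Nat.pow_le_pow_left h.two_le_pow 19
  have := h.pow_lt (k := 19) (by norm_num)
  omega

lemma row {x : ℕ} (hx : x < n) : x * (2 * 2 ^ l) + 2 * 2 ^ l < 2 ^ w := by
  refine lt_of_le_of_lt ?_ (h.pow_lt (k := 3) (by norm_num))
  have h1 := h.two_le_pow
  have h2 := h.le
  calc x * (2 * 2 ^ l) + 2 * 2 ^ l = (x + 1) * (2 * 2 ^ l) := by ring
    _ ≤ 2 ^ l * (2 ^ l * 2 ^ l) := Nat.mul_le_mul (by omega) (Nat.mul_le_mul_right _ h1)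
    _ = (2 ^ l) ^ 3 := by ring

lemma pair {x y : ℕ} (hx : x < n) (hy : y < n) : x * 2 ^ l + y < 2 ^ (2 * l) := by
  have h2 := h.le
  calc x * 2 ^ l + y < (x + 1) * 2 ^ l := by rw [add_mul, one_mul]; omega
    _ ≤ 2 ^ l * 2 ^ l := Nat.mul_le_mul_right _ (by omega)
    _ = 2 ^ (2 * l) := by ring

lemma pairs : 2 * 2 ^ (2 * l) < 2 ^ w := by
  refine lt_of_le_of_lt ?_ (h.pow_lt (k := 3) (by norm_num))
  calc 2 * 2 ^ (2 * l) ≤ 2 ^ l * 2 ^ (2 * l) := Nat.mul_le_mul_right _ h.two_le_pow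
    _ = (2 ^ l) ^ 3 := by rw [← pow_mul, ← pow_add]; congr 1; ring

lemma cell {x y : ℕ} (hx : x < n) (hy : y < n) : x * n + y < 2 ^ w := by
  have h2 := h.le
  have := h.pairs
  have := h.pair hx hy
  have : x * n ≤ x * 2 ^ l := Nat.mul_le_mul_left _ h2
  omega

lemma sq : n * n + 1 < 2 ^ w := by
  have h2 := h.le
  have h1 := h.pairs
  have h3 : n * n ≤ 2 ^ l * 2 ^ l := Nat.mul_le_mul h2 h2
  rw [← pow_add, ← two_mul] at h3
  have : 1 ≤ 2 ^ (2 * l) := Nat.one_le_two_pow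
  omega

end Sizes

/-! ### The correspondence between memory and abstract data. -/

/-- The registers that keep their values after the preprocessing. -/
def constRegs : List ℕ := [0, 5, 6, 7, 8, 9, 10, 11, 12]

/-- The state `s` represents the data `d`. -/
structure Rep (l : ℕ) (d : Data n) (s : State) : Prop where
  r0 : s.reg 0 = n
  r5 : s.reg 5 = l
  r6 : s.reg 6 = 2 ^ l
  r7 : s.reg 7 = 2 * 2 ^ l
  r8 : s.reg 8 = (2 ^ l) ^ 5
  r9 : s.reg 9 = l ^ 3 + 2
  r10 : s.reg 10 = 2 * l
  r11 : s.reg 11 = 2 ^ (2 * l)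
  r12 : s.reg 12 ≠ 0 ↔ ∃ v, d.isC v = true
  cen : ∀ v : Fin n, s.mem 0 v = d.cen v
  img : ∀ v : Fin n, s.mem 1 v = d.img v
  wt : ∀ a b : Fin n, s.mem 2 (a * n + b) = d.wt a b
  key : ∀ u : Fin n, IsTree (s.mem 3) (u * (2 * 2 ^ l)) l (extend (d.key u))
  mp : ∀ u : Fin n, IsTree (s.mem 4) (u * (2 * 2 ^ l)) l (extend (setLeaves (d.mp u)))
  dirty : IsTree (s.mem 5) 0 l (extend (setLeaves d.dirty))
  un : IsTree (s.mem 6) 0 (2 * l) (pairLeaves l d.un)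
  isC : ∀ v : Fin n, s.mem 7 v = if d.isC v then 1 else 0

variable {w l : ℕ} {ω : Tape w} {s s' : State} {d d' : Data n}

lemma Rep.of_eq (h : Rep l d s) (hr : ∀ x ∈ constRegs, s'.reg x = s.reg x)
    (hm : s'.mem = s.mem) : Rep l d s' where
  r0 := by rw [hr 0 (by decide), h.r0]
  r5 := by rw [hr 5 (by decide), h.r5]
  r6 := by rw [hr 6 (by decide), h.r6]
  r7 := by rw [hr 7 (by decide), h.r7]
  r8 := by rw [hr 8 (by decide), h.r8]
  r9 := by rw [hr 9 (by decide), h.r9]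
  r10 := by rw [hr 10 (by decide), h.r10]
  r11 := by rw [hr 11 (by decide), h.r11]
  r12 := by rw [hr 12 (by decide), h.r12]
  cen := by rw [hm]; exact h.cen
  img := by rw [hm]; exact h.img
  wt := by rw [hm]; exact h.wt
  key := by rw [hm]; exact h.key
  mp := by rw [hm]; exact h.mp
  dirty := by rw [hm]; exact h.dirty
  un := by rw [hm]; exact h.un
  isC := by rw [hm]; exact h.isC

lemma Rep.tick (h : Rep l d s) (k : ℕ) : Rep l d (s.tick k) := h.of_eq (fun _ _ => rfl) rfl

lemma Rep.setReg (h : Rep l d s) {x : ℕ} (hx : x ∉ constRegs) (y : ℕ) :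
    Rep l d (s.setReg x y) :=
  h.of_eq (fun z hz => by
    rw [State.setReg_reg, if_neg]; rintro rfl; exact hx hz) rfl

/-- Frame rule: array `a` and the matching part of the data change. -/
lemma Rep.update {a : ℕ} (h : Rep l d s) (hr : ∀ x ∈ constRegs, s'.reg x = s.reg x)
    (hm : ∀ b, b ≠ a → s'.mem b = s.mem b) (hC : d'.isC = d.isC) (h7 : a ≠ 7)
    (cen : if a = 0 then ∀ v : Fin n, s'.mem 0 v = d'.cen v else d'.cen = d.cen)
    (img : if a = 1 then ∀ v : Fin n, s'.mem 1 v = d'.img v else d'.img = d.img)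
    (wt : if a = 2 then ∀ p q : Fin n, s'.mem 2 (p * n + q) = d'.wt p q else d'.wt = d.wt)
    (key : if a = 3 then ∀ u : Fin n,
      IsTree (s'.mem 3) (u * (2 * 2 ^ l)) l (extend (d'.key u)) else d'.key = d.key)
    (mp : if a = 4 then ∀ u : Fin n,
      IsTree (s'.mem 4) (u * (2 * 2 ^ l)) l (extend (setLeaves (d'.mp u))) else d'.mp = d.mp)
    (dirty : if a = 5 then IsTree (s'.mem 5) 0 l (extend (setLeaves d'.dirty))
      else d'.dirty = d.dirty)
    (un : if a = 6 then IsTree (s'.mem 6) 0 (2 * l) (pairLeaves l d'.un) else d'.un = d.un) :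
    Rep l d' s' where
  r0 := by rw [hr 0 (by decide), h.r0]
  r5 := by rw [hr 5 (by decide), h.r5]
  r6 := by rw [hr 6 (by decide), h.r6]
  r7 := by rw [hr 7 (by decide), h.r7]
  r8 := by rw [hr 8 (by decide), h.r8]
  r9 := by rw [hr 9 (by decide), h.r9]
  r10 := by rw [hr 10 (by decide), h.r10]
  r11 := by rw [hr 11 (by decide), h.r11]
  r12 := by rw [hr 12 (by decide), h.r12, hC]
  cen := by
    split_ifs at cen with e
    · exact cen
    · rw [hm 0 (Ne.symm e), cen]; exact h.cen
  img := by
    split_ifs at img with e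
    · exact img
    · rw [hm 1 (Ne.symm e), img]; exact h.img
  wt := by
    split_ifs at wt with e
    · exact wt
    · rw [hm 2 (Ne.symm e), wt]; exact h.wt
  key := by
    split_ifs at key with e
    · exact key
    · rw [hm 3 (Ne.symm e), key]; exact h.key
  mp := by
    split_ifs at mp with e
    · exact mp
    · rw [hm 4 (Ne.symm e), mp]; exact h.mp
  dirty := by
    split_ifs at dirty with e
    · exact dirty
    · rw [hm 5 (Ne.symm e), dirty]; exact h.dirty
  un := by
    split_ifs at un with e
    · exact un
    · rw [hm 6 (Ne.symm e), un]; exact h.un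
  isC := by rw [hm 7 h7.symm, hC]; exact h.isC

/-! ### Writing single leaves. -/

/-- Sets leaf `reg y` of the tree of vertex `reg x` in array `a`. -/
def setRow (a x y : ℕ) (val : Expr) : Cmd :=
  .assign 22 val ;; .assign 20 (.bin .mul (.reg x) (.reg 7)) ;; .assign 21 (.reg y) ;;
  treeSet a 6 5

/-- Sets leaf `reg x` of the tree of dirty vertices. -/
def setDirty (x : ℕ) (val : Expr) : Cmd :=
  .assign 22 val ;; .assign 20 (.const 0) ;; .assign 21 (.reg x) ;; treeSet 5 6 5

/-- Sets the leaf of the pair `(reg x, reg y)` in the tree of unmapped edges. -/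
def setUn (x y : ℕ) (b : Bool) : Cmd :=
  .assign 21 (.bin .add (.bin .mul (.reg x) (.reg 6)) (.reg y)) ;;
  .assign 22 (if b then .bin .add (.reg 21) (.const 1) else .const 0) ;;
  .assign 20 (.const 0) ;; treeSet 6 11 10

lemma setRow_regs {a x y : ℕ} {e : Expr} {z : ℕ} (hz : z < 20) (s : State) :
    ((setRow a x y e).exec w ω s).reg z = s.reg z :=
  exec_reg_of_notMem (by simp [setRow, treeSet, Cmd.regs]; omega) s

lemma setDirty_regs {x : ℕ} {e : Expr} {z : ℕ} (hz : z < 20) (s : State) :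
    ((setDirty x e).exec w ω s).reg z = s.reg z :=
  exec_reg_of_notMem (by simp [setDirty, treeSet, Cmd.regs]; omega) s

lemma setUn_regs {x y : ℕ} {b : Bool} {z : ℕ} (hz : z < 20) (s : State) :
    ((setUn x y b).exec w ω s).reg z = s.reg z :=
  exec_reg_of_notMem (by simp [setUn, treeSet, Cmd.regs]; omega) s

lemma lt_of_mem_constRegs {x : ℕ} (h : x ∈ constRegs) : x < 13 := by
  simp [constRegs] at h; omega

lemma setRow_mem {a x y : ℕ} {e : Expr} {b : ℕ} (hb : b ≠ a) (s : State) :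
    ((setRow a x y e).exec w ω s).mem b = s.mem b :=
  exec_mem_of_notMem (by simp [setRow, treeSet, Cmd.arrs]; omega) s

lemma setDirty_mem {x : ℕ} {e : Expr} {b : ℕ} (hb : b ≠ 5) (s : State) :
    ((setDirty x e).exec w ω s).mem b = s.mem b :=
  exec_mem_of_notMem (by simp [setDirty, treeSet, Cmd.arrs]; omega) s

lemma setUn_mem {x y : ℕ} {c : Bool} {b : ℕ} (hb : b ≠ 6) (s : State) :
    ((setUn x y c).exec w ω s).mem b = s.mem b :=
  exec_mem_of_notMem (by simp [setUn, treeSet, Cmd.arrs]; omega) s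

/-- The trees of different vertices occupy disjoint blocks of `2 * 2 ^ l` cells, so a write in one
of them leaves the others intact. -/
lemma setRow_spec (hS : Sizes w n l) (h : Rep l d s) {a x y : ℕ} {e : Expr} {u v : Fin n} {k : ℕ}
    (hx : x < 20) (hy : y < 20) (hu : s.reg x = u) (hv : s.reg y = v)
    (he : e.Fits (2 ^ w) s) (hk : e.val s = k) {g : Fin n → Fin n → ℕ}
    (hg : ∀ u : Fin n, IsTree (s.mem a) (u * (2 * 2 ^ l)) l (extend (g u))) (u' : Fin n) :
    IsTree (((setRow a x y e).exec w ω s).mem a) (u' * (2 * 2 ^ l)) l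
      (extend (setPair g u v k u')) := by
  have hrow := hS.row u.2
  have hvl : (v : ℕ) < 2 ^ l := v.2.trans_le hS.le
  have h1 : ∀ z, z < 20 → z ≠ 22 ∧ z ≠ 20 ∧ z ≠ 21 := by omega
  rw [setRow, exec_seq, exec_assign he, exec_seq, exec_assign (by
    simp [Expr.Fits, Expr.val, Op.Fits, (h1 x hx), hu, h.r7]; omega), exec_seq, exec_assign
    (by simp [Expr.Fits])]
  have key := treeSet_spec (w := w) (ω := ω) (a := a) (sz := 6) (dp := 5) (l := l)
    (b := u * (2 * 2 ^ l)) (i := v) (x := k) (f := extend (g u))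
    (s := ((((((s.setReg 22 (Expr.val s e)).tick (e.cost + 1)).setReg 20 (Expr.val ((s.setReg 22
        (Expr.val s e)).tick (e.cost + 1)) (Expr.bin Op.mul (Expr.reg x) (Expr.reg 7)))).tick
        ((Expr.bin Op.mul (Expr.reg x) (Expr.reg 7)).cost + 1)).setReg 21 (Expr.val
        ((((s.setReg 22 (Expr.val s e)).tick (e.cost + 1)).setReg 20 (Expr.val
        ((s.setReg 22 (Expr.val s e)).tick (e.cost + 1)) (Expr.bin Op.mul (Expr.reg x)
        (Expr.reg 7)))).tick ((Expr.bin Op.mul (Expr.reg x) (Expr.reg 7)).cost + 1))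
        (Expr.reg y))).tick ((Expr.reg y).cost + 1)))
    (by simp [h.r6]) (by simp [h.r5]) (by norm_num)
    (by simp [Expr.val, h1 x hx, Op.eval, hu, h.r7])
    (by simp [Expr.val, h1 y hy, hv]) (by simp [hk]) hvl hrow (by simpa using hg u)
  by_cases huu : u' = u
  · subst huu
    have e1 : setPair g u' v k u' = Function.update (g u') v k := by
      funext q; simp [setPair, Function.update_apply]
    rw [e1, ← update_extend]
    exact key.1
  · have e1 : setPair g u v k u' = g u' := by
      funext q; simp [setPair, huu]
    rw [e1]
    refine (hg u').congr (fun q hq => ?_) fun _ _ => rfl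
    rw [key.2]
    · simp
    · have : (u' : ℕ) ≠ u := fun e => huu (Fin.ext e)
      rcases Nat.lt_or_gt_of_ne this with h3 | h3
      · left
        have : ((u' : ℕ) + 1) * (2 * 2 ^ l) ≤ u * (2 * 2 ^ l) := Nat.mul_le_mul_right _ h3
        rw [add_mul, one_mul] at this
        omega
      · right
        have : ((u : ℕ) + 1) * (2 * 2 ^ l) ≤ u' * (2 * 2 ^ l) := Nat.mul_le_mul_right _ h3
        rw [add_mul, one_mul] at this
        omega

lemma Rep.setKey (hS : Sizes w n l) (h : Rep l d s) {x y : ℕ} {e : Expr} {u v : Fin n} {k : ℕ}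
    (hx : x < 20) (hy : y < 20) (hu : s.reg x = u) (hv : s.reg y = v)
    (he : e.Fits (2 ^ w) s) (hk : e.val s = k) :
    Rep l { d with key := setPair d.key u v k } ((setRow 3 x y e).exec w ω s) :=
  h.update (a := 3) (fun z hz => setRow_regs (by have := lt_of_mem_constRegs hz; omega) s)
    (fun _ hb => setRow_mem hb s) rfl (by norm_num) rfl rfl rfl
    (setRow_spec hS h hx hy hu hv he hk h.key) rfl rfl rfl

lemma Rep.setMpRow (hS : Sizes w n l) (h : Rep l d s) {x y : ℕ} {u v : Fin n} (b : Bool)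
    (hx : x < 20) (hy : y < 20) (hu : s.reg x = u) (hv : s.reg y = v) :
    Rep l { d with mp := setPair d.mp u v b } ((setRow 4 x y
      (if b then .bin .add (.reg y) (.const 1) else .const 0)).exec w ω s) := by
  have hvl : (v : ℕ) < 2 ^ l := v.2.trans_le hS.le
  have hW := hS.pow_lt (k := 2) (by norm_num)
  have h2 := hS.two_le_pow
  have h3 : 2 ^ l + 2 ^ l ≤ (2 ^ l) ^ 2 := by nlinarith
  have key := setRow_spec (w := w) (ω := ω) hS h
    (e := if b then .bin .add (.reg y) (.const 1) else .const 0)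
    (k := if b then (v : ℕ) + 1 else 0) hx hy hu hv
    (by
      have := hS.small (k := 1) (by norm_num)
      cases b <;> simp only [Expr.Fits, Op.Fits, Expr.val, hv, if_true, if_false, Bool.false_eq_true]
      · omega
      · refine ⟨trivial, this, by omega⟩)
    (by cases b <;> simp [Expr.val, Op.eval, hv]) h.mp
  refine h.update (a := 4) (fun z hz => setRow_regs (by have := lt_of_mem_constRegs hz; omega) s)
    (fun _ hb => setRow_mem hb s) rfl (by norm_num) rfl rfl rfl rfl ?_ rfl rfl
  simp only [if_true]
  intro u'
  refine (key u').congr (fun _ _ => rfl) fun i _ => congrFun (congrArg extend ?_) i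
  funext q
  by_cases hh : u' = u ∧ q = v
  · simp [setPair, setLeaves, hh]
  · simp [setPair, setLeaves, hh]

lemma Rep.setDirty (hS : Sizes w n l) (h : Rep l d s) {x : ℕ} {e : Expr} {v : Fin n} {b : Bool}
    (hx : x < 20) (hv : s.reg x = v)
    (he : e.Fits (2 ^ w) s) (hk : e.val s = if b then (v : ℕ) + 1 else 0) :
    Rep l { d with dirty := Function.update d.dirty v b } ((setDirty x e).exec w ω s) := by
  have hvl : (v : ℕ) < 2 ^ l := v.2.trans_le hS.le
  have h1 : ∀ z, z < 20 → z ≠ 22 ∧ z ≠ 20 ∧ z ≠ 21 := by omega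
  have h0 := hS.small (k := 0) (by norm_num)
  refine h.update (a := 5) (fun z hz => setDirty_regs (by have := lt_of_mem_constRegs hz; omega) s)
    (fun _ hb => setDirty_mem hb s) rfl (by norm_num) rfl rfl rfl rfl rfl ?_ rfl
  simp only [if_true]
  have hrow := hS.row (x := 0) (by have := hS.two_le; omega)
  rw [StarContraction.setDirty, exec_seq, exec_assign he, exec_seq, exec_assign (by exact h0),
    exec_seq, exec_assign (by simp [Expr.Fits])]
  have key := treeSet_spec (w := w) (ω := ω) (a := 5) (sz := 6) (dp := 5) (l := l)
    (b := 0) (i := v) (x := if b then (v : ℕ) + 1 else 0) (f := extend (setLeaves d.dirty))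
    (s := ((((((s.setReg 22 (Expr.val s e)).tick (e.cost + 1)).setReg 20 (Expr.val ((s.setReg 22
        (Expr.val s e)).tick (e.cost + 1)) (Expr.const 0))).tick
        ((Expr.const 0).cost + 1)).setReg 21 (Expr.val
        ((((s.setReg 22 (Expr.val s e)).tick (e.cost + 1)).setReg 20 (Expr.val
        ((s.setReg 22 (Expr.val s e)).tick (e.cost + 1)) (Expr.const 0))).tick
        ((Expr.const 0).cost + 1))
        (Expr.reg x))).tick ((Expr.reg x).cost + 1)))
    (by simp [h.r6]) (by simp [h.r5]) (by norm_num)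
    (by simp [Expr.val])
    (by simp [Expr.val, h1 x hx, hv]) (by simp [hk]) hvl (by simpa using hrow)
    (by simpa using h.dirty)
  rw [update_extend] at key
  refine key.1.congr (fun _ _ => rfl) fun i _ => congrFun (congrArg extend ?_) i
  funext q
  by_cases hh : q = v
  · subst hh; simp [setLeaves]
  · simp [setLeaves, hh]

lemma Rep.setUn (hS : Sizes w n l) (h : Rep l d s) {x y : ℕ} {u v : Fin n} (b : Bool)
    (hu : s.reg x = u) (hv : s.reg y = v) :
    Rep l { d with un := setPair d.un u v b } ((setUn x y b).exec w ω s) := by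
  have h0 := hS.small (k := 0) (by norm_num)
  have h01 := hS.small (k := 1) (by norm_num)
  have hp := hS.pair u.2 v.2
  have hps := hS.pairs
  refine h.update (a := 6) (fun z hz => setUn_regs (by have := lt_of_mem_constRegs hz; omega) s)
    (fun _ hb => setUn_mem hb s) rfl (by norm_num) rfl rfl rfl rfl rfl rfl ?_
  simp only [if_true]
  have hf : (Expr.bin .add (.bin .mul (.reg x) (.reg 6)) (.reg y)).Fits (2 ^ w) s := by
    simp only [Expr.Fits, Op.Fits, Expr.val, Op.eval, hu, hv, h.r6, true_and]
    omega
  rw [StarContraction.setUn, exec_seq, exec_assign hf]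
  set s1 := (s.setReg 21 ((Expr.bin .add (.bin .mul (.reg x) (.reg 6)) (.reg y)).val s)).tick
    ((Expr.bin .add (.bin .mul (.reg x) (.reg 6)) (.reg y)).cost + 1) with hs1
  have h21 : s1.reg 21 = u * 2 ^ l + v := by
    simp [hs1, Expr.val, Op.eval, hu, hv, h.r6]
  have hval : Expr.val s1 (if b then .bin .add (.reg 21) (.const 1) else .const 0) =
      if b then ((u : ℕ) * 2 ^ l + v) + 1 else 0 := by
    cases b <;> simp [Expr.val, Op.eval, h21]
  rw [exec_seq, exec_assign (by
    cases b <;> simp only [Expr.Fits, Op.Fits, Expr.val, h21, if_true, if_false, Bool.false_eq_true]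
    · omega
    · refine ⟨trivial, h01, by omega⟩), hval, exec_seq, exec_assign (by exact h0)]
  have key := treeSet_spec (w := w) (ω := ω) (a := 6) (sz := 11) (dp := 10) (l := 2 * l)
    (b := 0) (i := u * 2 ^ l + v) (x := if b then ((u : ℕ) * 2 ^ l + v) + 1 else 0)
    (f := pairLeaves l d.un)
    (s := (((s1.setReg 22 (if b then ((u : ℕ) * 2 ^ l + v) + 1 else 0)).tick
      ((if b then Expr.bin .add (.reg 21) (.const 1) else Expr.const 0).cost + 1)).setReg 20
      (Expr.val ((s1.setReg 22 (if b then ((u : ℕ) * 2 ^ l + v) + 1 else 0)).tick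
      ((if b then Expr.bin .add (.reg 21) (.const 1) else Expr.const 0).cost + 1))
      (.const 0))).tick ((Expr.const 0).cost + 1))
    (by simp [hs1, h.r11]) (by simp [hs1, h.r10]) (by norm_num)
    (by simp [Expr.val]) (by simp [h21]) (by simp) hp (by simpa using hps)
    (by simpa [hs1] using h.un)
  rw [update_pairLeaves hS.le] at key
  exact key.1

end StarContraction

/-! ### Reading the roots, and the elementary steps on edges. -/

namespace StarContraction

variable {n w l : ℕ} {ω : Tape w} {s s' : State} {d d' : Data n}

/-- The padding leaves hold `0`, the bottom element of `ℕ`, and do not affect the supremum. -/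
lemma root_eq_sup {m : ℕ → ℕ} {b : ℕ} {g : Fin n → ℕ} (hn : n ≤ 2 ^ l)
    (h : IsTree m b l (extend g)) : m (b + 1) = Finset.univ.sup g := by
  apply le_antisymm
  · obtain ⟨i, -, hi⟩ := h.exists_root
    rw [← hi, extend]
    split_ifs with hlt
    · exact Finset.le_sup (f := g) (Finset.mem_univ _)
    · exact Nat.zero_le _
  · refine Finset.sup_le fun v _ => ?_
    have := h.le_root (i := v) (v.2.trans_le hn)
    rwa [extend_coe] at this

/-- Members are stored with an offset of one, so `0` at the root can only mean that the set is
empty, and any other value names a member. Emptiness test and search thus cost a single memory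
access. -/
lemma root_setLeaves {m : ℕ → ℕ} {b : ℕ} {p : Fin n → Bool} (hn : n ≤ 2 ^ l)
    (h : IsTree m b l (extend (setLeaves p))) :
    (m (b + 1) = 0 ∧ ∀ v, p v = false) ∨ ∃ v, p v = true ∧ m (b + 1) = v + 1 := by
  obtain ⟨i, -, hi⟩ := h.exists_root
  rw [extend] at hi
  by_cases h0 : m (b + 1) = 0
  · left
    refine ⟨h0, fun v => ?_⟩
    have := h.le_root (i := v) (v.2.trans_le hn)
    rw [extend_coe, h0, setLeaves] at this
    by_contra hv
    simp [hv] at this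
  · right
    split_ifs at hi with hlt
    · refine ⟨⟨i, hlt⟩, ?_, ?_⟩ <;> simp only [setLeaves] at hi <;> split_ifs at hi with hp
      · exact hp
      · omega
      · exact hi.symm
      · omega
    · omega

lemma root_pairLeaves {m : ℕ → ℕ} {b : ℕ} {p : Fin n → Fin n → Bool} (hS : Sizes w n l)
    (h : IsTree m b (2 * l) (pairLeaves l p)) :
    (m (b + 1) = 0 ∧ ∀ u v, p u v = false) ∨
      ∃ u v : Fin n, p u v = true ∧ m (b + 1) = (u * 2 ^ l + v) + 1 := by
  obtain ⟨i, -, hi⟩ := h.exists_root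
  rw [pairLeaves] at hi
  by_cases h0 : m (b + 1) = 0
  · left
    refine ⟨h0, fun u v => ?_⟩
    have := h.le_root (hS.pair u.2 v.2)
    rw [pairLeaves_coe hS.le, h0] at this
    by_contra hv
    simp [hv] at this
  · right
    split_ifs at hi with hlt hp
    · refine ⟨_, _, hp, ?_⟩
      rw [← hi]
      simp only [Nat.div_add_mod']
    · omega
    · omega

/-! ### Mapping and unmapping edges -/

/-- Adds the pair `{reg x, reg y}` to the mapped edges, or removes it. -/
def setMpCmd (x y : ℕ) (b : Bool) : Cmd :=
  setRow 4 x y (if b then .bin .add (.reg y) (.const 1) else .const 0) ;;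
  setRow 4 y x (if b then .bin .add (.reg x) (.const 1) else .const 0)

/-- Adds the pair `{reg x, reg y}` to the unmapped edges, or removes it. -/
def setUnCmd (x y : ℕ) (b : Bool) : Cmd := setUn x y b ;; setUn y x b

/-- Changes the weight of the image of the edge `{reg x, reg y}` by one. -/
def changeWt (x y : ℕ) (o : Op) : Cmd :=
  .assign 28 (.bin .sub (.get 1 (.reg x)) (.const 1)) ;;
  .assign 29 (.bin .sub (.get 1 (.reg y)) (.const 1)) ;;
  .assign 30 (.bin o (.get 2 (.bin .add (.bin .mul (.reg 28) (.reg 0)) (.reg 29))) (.const 1)) ;;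
  .store 2 (.bin .add (.bin .mul (.reg 28) (.reg 0)) (.reg 29)) (.reg 30) ;;
  .store 2 (.bin .add (.bin .mul (.reg 29) (.reg 0)) (.reg 28)) (.reg 30)

/-- Maps the edge `{reg x, reg y}`. -/
def mapEdge (x y : ℕ) : Cmd :=
  setUnCmd x y false ;; setMpCmd x y true ;; changeWt x y .add

/-- Unmaps the edge `{reg x, reg y}`. -/
def unmapEdge (x y : ℕ) : Cmd :=
  setUnCmd x y true ;; setMpCmd x y false ;; changeWt x y .sub

lemma setMpCmd_regs {x y : ℕ} {b : Bool} {z : ℕ} (hz : z < 20) (s : State) :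
    ((setMpCmd x y b).exec w ω s).reg z = s.reg z := by
  rw [setMpCmd, exec_seq, setRow_regs hz, setRow_regs hz]

lemma setUnCmd_regs {x y : ℕ} {b : Bool} {z : ℕ} (hz : z < 20) (s : State) :
    ((setUnCmd x y b).exec w ω s).reg z = s.reg z := by
  rw [setUnCmd, exec_seq, setUn_regs hz, setUn_regs hz]

lemma changeWt_regs {x y : ℕ} {o : Op} {z : ℕ} (hz : z < 20) (s : State) :
    ((changeWt x y o).exec w ω s).reg z = s.reg z :=
  exec_reg_of_notMem (by simp [changeWt, Cmd.regs]; omega) s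

lemma unmapEdge_regs {x y z : ℕ} (hz : z < 20) (s : State) :
    ((unmapEdge x y).exec w ω s).reg z = s.reg z := by
  rw [unmapEdge, exec_seq, exec_seq, changeWt_regs hz, setMpCmd_regs hz, setUnCmd_regs hz]

lemma Rep.setMpCmd (hS : Sizes w n l) (h : Rep l d s) {x y : ℕ} {u v : Fin n} (b : Bool)
    (hx : x < 20) (hy : y < 20) (hu : s.reg x = u) (hv : s.reg y = v) :
    Rep l { d with mp := setSym d.mp u v b } ((setMpCmd x y b).exec w ω s) := by
  have h1 := h.setMpRow (ω := ω) hS b hx hy hu hv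
  have h2 := h1.setMpRow (ω := ω) hS (x := y) (y := x) (u := v) (v := u) b hy hx
    (by rw [setRow_regs hy, hv]) (by rw [setRow_regs hx, hu])
  rw [← setPair_setPair]
  exact h2

lemma Rep.setUnCmd (hS : Sizes w n l) (h : Rep l d s) {x y : ℕ} {u v : Fin n} (b : Bool)
    (hx : x < 20) (hy : y < 20) (hu : s.reg x = u) (hv : s.reg y = v) :
    Rep l { d with un := setSym d.un u v b } ((setUnCmd x y b).exec w ω s) := by
  have h1 := h.setUn (ω := ω) hS b hu hv
  have h2 := h1.setUn (ω := ω) hS (x := y) (y := x) (u := v) (v := u) b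
    (by rw [setUn_regs hy, hv]) (by rw [setUn_regs hx, hu])
  rw [← setPair_setPair]
  exact h2

lemma cell_inj {p q a b : Fin n} : (p : ℕ) * n + q = a * n + b ↔ p = a ∧ q = b := by
  constructor
  · intro e
    have h1 := congrArg (· % n) e
    simp only [Nat.mul_add_mod_self_right, Nat.mod_eq_of_lt q.2, Nat.mod_eq_of_lt b.2] at h1
    have h2 : (p : ℕ) * n = a * n := by omega
    have h3 := Nat.eq_of_mul_eq_mul_right (by have := p.2; omega) h2
    exact ⟨Fin.ext h3, Fin.ext h1⟩
  · rintro ⟨rfl, rfl⟩; rfl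

/-- The new weight is computed once and stored in both cells. For a loop the two cells coincide, and
the weight still changes by only one. -/
lemma Rep.changeWt (hS : Sizes w n l) (h : Rep l d s) {x y : ℕ} {u v a b : Fin n} {o : Op}
    (hy : y < 20) (hu : s.reg x = u) (hv : s.reg y = v)
    (ha : d.img u = a + 1) (hb : d.img v = b + 1) (ho : o.Fits (2 ^ w) (d.wt a b) 1) :
    Rep l { d with wt := setSym d.wt a b (o.eval (d.wt a b) 1) }
      ((changeWt x y o).exec w ω s) := by
  have h1 : y ≠ 28 := by omega
  have hab := hS.cell a.2 b.2
  have hba := hS.cell b.2 a.2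
  have hs1 := hS.small (k := 1) (by norm_num)
  have hw : w ≠ 0 := by rintro rfl; simp at hs1
  have hn := hS.cell a.2 (y := 0) (by have := hS.two_le; omega)
  have hn' := hS.cell b.2 (y := 0) (by have := hS.two_le; omega)
  have ha' : (a : ℕ) + 1 < 2 ^ w := by have := hS.sq; have := a.2; nlinarith
  have hb' : (b : ℕ) + 1 < 2 ^ w := by have := hS.sq; have := b.2; nlinarith
  refine h.update (a := 2) (fun z hz => changeWt_regs (by have := lt_of_mem_constRegs hz; omega) s)
    (fun c hc => exec_mem_of_notMem (by simp [StarContraction.changeWt, Cmd.arrs, hc]) s) rfl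
    (by norm_num) rfl rfl ?_ rfl rfl rfl rfl
  simp only [if_true]
  rw [StarContraction.changeWt, exec_seq, exec_assign (by
      simp [Expr.Fits, Expr.val, Op.Fits, hu, h.img, ha, hw, ha']),
    exec_seq, exec_assign (by
      simp [Expr.Fits, Expr.val, Op.Fits, hv, h.img, hb, hw, h1, hb']),
    exec_seq, exec_assign (by
      refine ⟨?_, hs1, ?_⟩
      · simp [Expr.Fits, Expr.val, Op.Fits, hu, hv, h.img, ha, hb, h1, h.r0, hab]
        omega
      · simpa [Expr.val, hu, hv, h.img, ha, hb, h1, h.r0, h.wt] using ho)]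
  have key : ∀ s3 : State, s3.mem 2 = s.mem 2 → s3.reg 28 = a → s3.reg 29 = b →
      s3.reg 30 = o.eval (d.wt a b) 1 → s3.reg 0 = n → ∀ p q : Fin n,
      ((Cmd.store 2 (.bin .add (.bin .mul (.reg 28) (.reg 0)) (.reg 29)) (.reg 30) ;;
        Cmd.store 2 (.bin .add (.bin .mul (.reg 29) (.reg 0)) (.reg 28)) (.reg 30)).exec
        w ω s3).mem 2 (p * n + q) = setSym d.wt a b (o.eval (d.wt a b) 1) p q := by
    intro s3 hm r28 r29 r30 r0 p q
    have hs : (Cmd.store 2 (.bin .add (.bin .mul (.reg 28) (.reg 0)) (.reg 29)) (.reg 30)).exec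
        w ω s3 = _ := exec_store (by
          simp [Expr.Fits, Expr.val, Op.Fits, r28, r29, r0, hab]; omega) (by simp [Expr.Fits])
    rw [exec_seq, hs, exec_store (by
      simp [Expr.Fits, Expr.val, Op.Fits, r28, r29, r0, hba]; omega) (by simp [Expr.Fits])]
    simp [Expr.val, r28, r29, r30, r0, hm, h.wt, Function.update_apply, cell_inj, setSym]
    by_cases hc1 : p = a ∧ q = b <;> by_cases hc2 : p = b ∧ q = a <;> simp [hc1, hc2]
  refine key _ ?_ ?_ ?_ ?_ ?_ <;>
    simp [Expr.val, hu, hv, h.img, ha, hb, h1, h.r0, h.wt]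

/-- The data after mapping the edge `uv` to the edge `ab`. -/
def Data.map (d : Data n) (u v a b : Fin n) : Data n :=
  { d with un := setSym d.un u v false, mp := setSym d.mp u v true,
           wt := setSym d.wt a b (d.wt a b + 1) }

/-- The data after unmapping the edge `uv`, which was mapped to the edge `ab`. -/
def Data.unmap (d : Data n) (u v a b : Fin n) : Data n :=
  { d with un := setSym d.un u v true, mp := setSym d.mp u v false,
           wt := setSym d.wt a b (d.wt a b - 1) }

lemma Rep.mapEdge (hS : Sizes w n l) (h : Rep l d s) {x y : ℕ} {u v a b : Fin n}
    (hx : x < 20) (hy : y < 20) (hu : s.reg x = u) (hv : s.reg y = v)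
    (ha : d.img u = a + 1) (hb : d.img v = b + 1) (ho : d.wt a b ≤ n * n) :
    Rep l (d.map u v a b) ((mapEdge x y).exec w ω s) := by
  have hsq := hS.sq
  have h1 := h.setUnCmd (ω := ω) hS false hx hy hu hv
  have h2 := h1.setMpCmd (ω := ω) hS true hx hy
    (by rw [setUnCmd_regs hx, hu]) (by rw [setUnCmd_regs hy, hv])
  exact h2.changeWt (ω := ω) hS hy
    (by rw [setMpCmd_regs hx, setUnCmd_regs hx, hu])
    (by rw [setMpCmd_regs hy, setUnCmd_regs hy, hv]) ha hb (o := .add)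
    (by simp only [Op.Fits]; omega)

lemma Rep.unmapEdge (hS : Sizes w n l) (h : Rep l d s) {x y : ℕ} {u v a b : Fin n}
    (hx : x < 20) (hy : y < 20) (hu : s.reg x = u) (hv : s.reg y = v)
    (ha : d.img u = a + 1) (hb : d.img v = b + 1) (ho : d.wt a b ≤ n * n) :
    Rep l (d.unmap u v a b) ((unmapEdge x y).exec w ω s) := by
  have hsq := hS.sq
  have h1 := h.setUnCmd (ω := ω) hS true hx hy hu hv
  have h2 := h1.setMpCmd (ω := ω) hS false hx hy
    (by rw [setUnCmd_regs hx, hu]) (by rw [setUnCmd_regs hy, hv])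
  exact h2.changeWt (ω := ω) hS hy
    (by rw [setMpCmd_regs hx, setUnCmd_regs hx, hu])
    (by rw [setMpCmd_regs hy, setUnCmd_regs hy, hv]) ha hb (o := .sub)
    (by simp only [Op.Fits]; omega)

/-! ### The background work -/

/-- One unit of background work: if there is a dirty vertex, unmap one of its edges or, if no edge
is left, give it its new image; otherwise map an unmapped edge. -/
def workStep : Cmd :=
  .assign 15 (.get 5 (.const 1)) ;;
  .ite (.reg 15)
    (.assign 16 (.bin .sub (.reg 15) (.const 1)) ;;
     .assign 17 (.get 4 (.bin .add (.bin .mul (.reg 16) (.reg 7)) (.const 1))) ;;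
     .ite (.reg 17)
      (.assign 18 (.bin .sub (.reg 17) (.const 1)) ;; unmapEdge 16 18)
      (.store 1 (.reg 16) (.get 0 (.reg 16)) ;; setDirty 16 (.const 0)))
    (.assign 15 (.get 6 (.const 1)) ;;
     .ite (.reg 15)
      (.assign 16 (.bin .div (.bin .sub (.reg 15) (.const 1)) (.reg 6)) ;;
       .assign 18 (.bin .mod (.bin .sub (.reg 15) (.const 1)) (.reg 6)) ;;
       mapEdge 16 18)
      .skip)

/-- The effect of one unit of background work. -/
inductive Work (d : Data n) : Data n → Prop
  | unmap (u v a b : Fin n) : d.dirty u = true → d.mp u v = true → d.img u = a + 1 →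
      d.img v = b + 1 → Work d (d.unmap u v a b)
  | clean (u : Fin n) : d.dirty u = true → (∀ v, d.mp u v = false) →
      Work d { d with img := Function.update d.img u (d.cen u),
                      dirty := Function.update d.dirty u false }
  | map (u v a b : Fin n) : (∀ u, d.dirty u = false) → d.un u v = true → d.img u = a + 1 →
      d.img v = b + 1 → Work d (d.map u v a b)
  | done : (∀ u, d.dirty u = false) → (∀ u v, d.un u v = false) → Work d d

/-- The roots of the trees decide which case applies and name the vertex or the edge to treat. The
bound on the weights excludes overflow, and `himg` makes the addressed weight cell meaningful. -/
lemma workStep_spec (hS : Sizes w n l) (h : Rep l d s) (hwt : ∀ a b, d.wt a b ≤ n * n)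
    (himg : ∀ u v, d.mp u v = true ∨ d.un u v = true →
      (∃ a : Fin n, d.img u = a + 1) ∧ ∃ b : Fin n, d.img v = b + 1) :
    ∃ d', Work d d' ∧ Rep l d' (workStep.exec w ω s) := by
  have hs1 := hS.small (k := 1) (by norm_num)
  have hw : w ≠ 0 := by rintro rfl; simp at hs1
  have hsq := hS.sq
  rw [workStep, exec_seq, exec_assign (by simp [Expr.Fits, hw]), exec_ite (by simp [Expr.Fits])]
  have hd := root_setLeaves hS.le h.dirty
  rw [zero_add] at hd
  set s1 := ((s.setReg 15 (Expr.val s (.get 5 (.const 1)))).tick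
    ((Expr.get 5 (.const 1)).cost + 1)) with hs1'
  have hR1 : Rep l d s1 := (h.setReg (by decide) _).tick _
  have e15 : s1.reg 15 = s.mem 5 1 := by simp [hs1', Expr.val]
  split_ifs with h15
  · simp only [Expr.val, e15] at h15
    obtain ⟨h0, -⟩ | ⟨u, hu, hroot⟩ := hd
    · exact absurd h0 h15
    have hrow := hS.row u.2
    have hu' : (u : ℕ) + 1 < 2 ^ w := by have := u.2; nlinarith
    have h2l := hS.two_le_pow
    rw [exec_seq, exec_assign (by simp [Expr.Fits, Expr.val, Op.Fits, e15, hroot, hw, hu']),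
      exec_seq, exec_assign (by
        simp [Expr.Fits, Expr.val, Op.Fits, Op.eval, e15, hroot, hw, hR1.r7]; omega),
      exec_ite (by simp [Expr.Fits])]
    simp only [Expr.val, Op.eval, State.tick_reg, State.setReg_reg, State.tick_mem,
      State.setReg_mem, e15, hroot, hR1.r7, if_true, if_false, show (7 : ℕ) ≠ 16 by decide,
      Nat.add_sub_cancel]
    have hm := root_setLeaves hS.le (hR1.mp u)
    set s2 := (((s1.tick ((Expr.reg 15).cost + 1)).setReg 16 u).tick
      ((Expr.bin Op.sub (Expr.reg 15) (Expr.const 1)).cost + 1)).setReg 17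
        (s1.mem 4 (u * (2 * 2 ^ l) + 1)) with hs2
    have hR2 : Rep l d s2 :=
      (((hR1.tick _).setReg (by decide) _).tick _).setReg (by decide) _
    have e16 : s2.reg 16 = u := by simp [hs2]
    have e17 : s2.reg 17 = s1.mem 4 (u * (2 * 2 ^ l) + 1) := by simp [hs2]
    split_ifs with h17
    · obtain ⟨h0, -⟩ | ⟨v, hv, hroot2⟩ := hm
      · exact absurd h0 h17
      obtain ⟨⟨a, ha⟩, b, hb⟩ := himg u v (.inl hv)
      refine ⟨_, .unmap u v a b hu hv ha hb, ?_⟩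
      have hv' : (v : ℕ) + 1 < 2 ^ w := by have := v.2; nlinarith
      rw [exec_seq, exec_assign (by
        simp [Expr.Fits, Expr.val, Op.Fits, e17, hroot2, hw, hv'])]
      refine Rep.unmapEdge hS ((((hR2.tick _).tick _).setReg (by decide) _).tick _)
        (by norm_num) (by norm_num) ?_ ?_ ha hb (hwt a b)
      · simp [e16]
      · simp [Expr.val, Op.eval, e17, hroot2]
    · obtain ⟨-, hnone⟩ | ⟨v, hv, hroot2⟩ := hm
      swap
      · omega
      refine ⟨_, .clean u hu hnone, ?_⟩
      rw [exec_seq, exec_store (by simp [Expr.Fits]) (by simp [Expr.Fits])]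
      simp only [Expr.val, State.tick_reg, State.tick_mem, e16, hR2.cen]
      have hs0 := hS.small (k := 0) (by norm_num)
      refine Rep.setDirty (d := { d with img := Function.update d.img u (d.cen u) }) (b := false)
        (v := u) hS (Rep.tick ?_ _) (by norm_num) (by simp [e16]) hs0 (by simp [Expr.val])
      refine hR2.update (a := 1) (fun _ _ => rfl) (fun b hb => by simp [hb]) rfl (by norm_num)
        rfl ?_ rfl rfl rfl rfl rfl
      simp only [if_true]
      intro v
      by_cases hvu : v = u
      · subst hvu; simp
      · have : (v : ℕ) ≠ u := fun e => hvu (Fin.ext e)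
        simp [hvu, this, hR2.img]
  · simp only [Expr.val, e15, not_not] at h15
    obtain ⟨-, hclean⟩ | ⟨u, hu, hroot⟩ := hd
    swap
    · omega
    have hm := root_pairLeaves hS h.un
    rw [zero_add] at hm
    rw [exec_seq, exec_assign (by simp [Expr.Fits, hw]), exec_ite (by simp [Expr.Fits])]
    set s2 := ((s1.tick ((Expr.reg 15).cost + 1)).setReg 15
      (Expr.val (s1.tick ((Expr.reg 15).cost + 1)) (Expr.get 6 (Expr.const 1)))).tick
        ((Expr.get 6 (Expr.const 1)).cost + 1) with hs2
    have hR2 : Rep l d s2 := ((hR1.tick _).setReg (by decide) _).tick _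
    have e15' : s2.reg 15 = s.mem 6 1 := by simp [hs2, Expr.val, hs1']
    split_ifs with h17
    · obtain ⟨h0, -⟩ | ⟨u, v, hv, hroot2⟩ := hm
      · simp only [Expr.val, e15'] at h17
        exact absurd h0 h17
      obtain ⟨⟨a, ha⟩, b, hb⟩ := himg u v (.inr hv)
      refine ⟨_, .map u v a b hclean hv ha hb, ?_⟩
      have hp := hS.pair u.2 v.2
      have hps := hS.pairs
      have hvl : (v : ℕ) < 2 ^ l := v.2.trans_le hS.le
      have hlt : (u : ℕ) * 2 ^ l + v < 2 ^ w := by omega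
      have hlt' : (u : ℕ) * 2 ^ l + v + 1 < 2 ^ w := by omega
      have hdiv : ((u : ℕ) * 2 ^ l + v) / 2 ^ l = u := by
        rw [mul_comm, Nat.mul_add_div (by positivity), Nat.div_eq_of_lt hvl, add_zero]
      have hmod : ((u : ℕ) * 2 ^ l + v) % 2 ^ l = v := by
        rw [mul_comm, Nat.mul_add_mod, Nat.mod_eq_of_lt hvl]
      rw [exec_seq, exec_assign (by
          simp [Expr.Fits, Expr.val, Op.Fits, Op.eval, e15', hroot2, hw, hlt, hlt']),
        exec_seq, exec_assign (by
          simp [Expr.Fits, Expr.val, Op.Fits, Op.eval, e15', hroot2, hw, hlt, hlt'])]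
      refine Rep.mapEdge hS (((((hR2.tick _).setReg (by decide) _).tick _).setReg
        (by decide) _).tick _) (by norm_num) (by norm_num) ?_ ?_ ha hb (hwt a b)
      · simp [Expr.val, Op.eval, e15', hroot2, hR2.r6, hdiv]
      · simp [Expr.val, Op.eval, e15', hroot2, hR2.r6, hmod]
    · obtain ⟨-, hnone⟩ | ⟨u, v, hv, hroot2⟩ := hm
      swap
      · simp only [Expr.val, e15', not_not] at h17
        omega
      exact ⟨d, .done hclean hnone, (hR2.tick _).tick _⟩

end StarContraction

namespace StarContraction

variable {n w l : ℕ} {ω : Tape w} {s s' : State} {d d' : Data n}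

/-! ### The update program -/

/-- The word that encodes the center of `u`: `u` itself if `u` is a center, and otherwise the
vertex with the largest key. -/
def cenWord (c : Bool) (f : Fin n → ℕ) (u : Fin n) : ℕ :=
  if c then u + 1 else if Finset.univ.sup f = 0 then 0 else (Finset.univ.sup f - 1) % n + 1

/-- Updates the key of the center `reg y` at the vertex `reg x`, and then the center of `reg x`.
The register `z` holds a random word. -/
def refreshKey (x y z : ℕ) : Cmd :=
  .ite (.get 7 (.reg y))
    (setRow 3 x y (.bin .mul (.reg 4) (.bin .add (.bin .mul (.bin .mod (.reg z) (.reg 8)) (.reg 0))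
      (.bin .add (.reg y) (.const 1)))))
    .skip

/-- Recomputes the center of the vertex `reg x`. -/
def refreshCen (x : ℕ) : Cmd :=
  .ite (.get 7 (.reg x)) .skip
    (.assign 15 (.get 3 (.bin .add (.bin .mul (.reg x) (.reg 7)) (.const 1))) ;;
     .ite (.reg 15)
      (.store 0 (.reg x) (.bin .add (.bin .mod (.bin .sub (.reg 15) (.const 1)) (.reg 0))
        (.const 1)))
      (.store 0 (.reg x) (.const 0)) ;;
     setDirty x (.bin .mul (.bin .mul (.bin .add (.reg x) (.const 1))
      (.bin .lt (.const 0) (.get 0 (.reg x))))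
      (.bin .eq (.bin .eq (.get 0 (.reg x)) (.get 1 (.reg x))) (.const 0))))

/-- Records the insertion or deletion of the edge `{reg 2, reg 3}`. -/
def edgeStep : Cmd :=
  .ite (.reg 12)
    (.ite (.reg 4) (setUnCmd 2 3 true)
      (.ite (.get 4 (.bin .add (.bin .mul (.reg 2) (.reg 7)) (.bin .add (.reg 6) (.reg 3))))
        (unmapEdge 2 3) .skip ;;
       setUnCmd 2 3 false))
    .skip

/-- The update program without the background work. -/
def structStep : Cmd :=
  .rand 13 ;; .rand 14 ;; refreshKey 2 3 13 ;; refreshCen 2 ;; refreshKey 3 2 14 ;;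
  refreshCen 3 ;; edgeStep

/-- The program that is run at each update. -/
def updateCmd : Cmd := structStep ;; .loop (.reg 9) workStep

/-- The data after a new key of `v` at `u`. -/
def Data.setKey (d : Data n) (u v : Fin n) (k : ℕ) : Data n :=
  { d with key := if d.isC v then setPair d.key u v k else d.key }

/-- The data after recomputing the center of `u`. -/
def Data.recenter (d : Data n) (u : Fin n) : Data n :=
  { d with
    cen := Function.update d.cen u (cenWord (d.isC u) (d.key u) u)
    dirty := Function.update d.dirty u (decide (cenWord (d.isC u) (d.key u) u ≠ 0 ∧
      cenWord (d.isC u) (d.key u) u ≠ d.img u)) }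

/-- The new key of `v`, made from the random word `z`. -/
def newKey (n l : ℕ) (ins : Bool) (z v : ℕ) : ℕ :=
  if ins then (z % (2 ^ l) ^ 5) * n + (v + 1) else 0

lemma newKey_lt (hS : Sizes w n l) (ins : Bool) (z : ℕ) {v : ℕ} (hv : v < n) :
    newKey n l ins z v < 2 ^ w := by
  have h1 : z % (2 ^ l) ^ 5 < (2 ^ l) ^ 5 := Nat.mod_lt _ (by positivity)
  have h2 := hS.le
  have h3 := hS.pow_lt (k := 6) (by norm_num)
  have h4 : (z % (2 ^ l) ^ 5 + 1) * n ≤ (2 ^ l) ^ 5 * 2 ^ l := Nat.mul_le_mul h1 h2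
  rw [← pow_succ, add_mul, one_mul] at h4
  have h5 := hS.small (k := 0) (by norm_num)
  rw [newKey]
  split_ifs
  · norm_num at h4
    omega
  · exact h5

lemma Rep.refreshKey (hS : Sizes w n l) (h : Rep l d s) {x y z : ℕ} {u v : Fin n} {ins : Bool}
    (hx : x < 20) (hy : y < 20) (hu : s.reg x = u) (hv : s.reg y = v) (hz : s.reg z < 2 ^ w)
    (h4 : s.reg 4 = if ins then 1 else 0) :
    Rep l (d.setKey u v (newKey n l ins (s.reg z) v)) ((refreshKey x y z).exec w ω s) := by
  have hs1 := hS.small (k := 1) (by norm_num)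
  have hw : w ≠ 0 := by rintro rfl; simp at hs1
  rw [StarContraction.refreshKey, exec_ite (by simp [Expr.Fits])]
  have e7 : Expr.val s (.get 7 (.reg y)) = if d.isC v then 1 else 0 := by
    simp [Expr.val, hv, h.isC]
  rw [e7]
  have hlt := newKey_lt hS true (s.reg z) v.2
  have hlt' : (s.reg z % (2 ^ l) ^ 5) * n < 2 ^ w := by
    simp only [newKey, if_true] at hlt; omega
  have hvw : (v : ℕ) + 1 < 2 ^ w := by have := hS.sq; have := v.2; nlinarith
  cases hc : d.isC v
  · simp only [Data.setKey, hc]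
    exact (h.tick _).tick _
  · simp only [Data.setKey, hc]
    refine Rep.setKey (u := u) (v := v) hS (h.tick _) hx hy hu hv ?_ ?_
    · simp only [Expr.Fits, Op.Fits, Expr.val, State.tick_reg, h4, h.r8, h.r0, hv, Op.eval_mod,
        Op.eval_mul, Op.eval_add, true_and]
      simp only [newKey, if_true] at hlt
      refine ⟨⟨⟨hz, hlt'⟩, ⟨hs1, hvw⟩, hlt⟩, ?_⟩
      cases ins
      · simp
      · simpa using hlt
    · simp only [Expr.val, State.tick_reg, h4, h.r8, h.r0, hv, Op.eval_mod,
        Op.eval_mul, Op.eval_add, newKey]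
      cases ins <;> simp

lemma refreshKey_regs {x y z r : ℕ} (hz : r < 15) (s : State) :
    ((refreshKey x y z).exec w ω s).reg r = s.reg r :=
  exec_reg_of_notMem (by simp [refreshKey, setRow, treeSet, Cmd.regs]; omega) s

lemma refreshCen_regs {x r : ℕ} (hz : r < 15) (s : State) :
    ((refreshCen x).exec w ω s).reg r = s.reg r :=
  exec_reg_of_notMem (by simp [refreshCen, setDirty, treeSet, Cmd.regs]; omega) s

/-- At a center the program does nothing, and `hC` makes `recenter` the identity as well. Elsewhere
the vertex is recovered from the largest key modulo `n`, and the dirty flag is a product of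
comparisons. -/
lemma Rep.refreshCen (hS : Sizes w n l) (h : Rep l d s) {x : ℕ} {u : Fin n}
    (hx : x < 15) (hu : s.reg x = u) (hkey : ∀ v, d.key u v < 2 ^ w)
    (hC : d.isC u = true → d.cen u = u + 1 ∧ d.img u = u + 1 ∧ d.dirty u = false) :
    Rep l (d.recenter u) ((refreshCen x).exec w ω s) := by
  have hs1 := hS.small (k := 1) (by norm_num)
  have hs0 := hS.small (k := 0) (by norm_num)
  have hw : w ≠ 0 := by rintro rfl; simp at hs1
  have hrow := hS.row u.2
  have h2l := hS.two_le_pow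
  have huw : (u : ℕ) + 1 < 2 ^ w := by have := hS.sq; have := u.2; nlinarith
  have e7 : Expr.val s (.get 7 (.reg x)) = if d.isC u then 1 else 0 := by
    simp [Expr.val, hu, h.isC]
  rw [StarContraction.refreshCen, exec_ite (by simp [Expr.Fits]), e7]
  cases hc : d.isC u
  swap
  · obtain ⟨h1, h2, h3⟩ := hC hc
    have : d.recenter u = d := by
      simp only [Data.recenter, cenWord, hc, if_true]
      have e1 : Function.update d.cen u (u + 1 : ℕ) = d.cen := by rw [← h1]; simp
      have e2 : Function.update d.dirty u (decide ((u + 1 : ℕ) ≠ 0 ∧ (u + 1 : ℕ) ≠ d.img u))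
          = d.dirty := by
        rw [h2]; simp [← h3]
      rw [e1, e2]
    rw [this]
    exact (h.tick _).tick _
  · simp only [Bool.false_eq_true, if_false, ne_eq, not_true]
    set c := cenWord (d.isC u) (d.key u) u with hcdef
    have hroot := root_eq_sup hS.le (h.key u)
    have hsup : Finset.univ.sup (d.key u) < 2 ^ w := (Finset.sup_lt_iff (by simp)).2
      fun v _ => hkey v
    rw [exec_seq, exec_assign (by
      simp [Expr.Fits, Expr.val, Op.Fits, hu, h.r7, hw]; omega), exec_seq,
      exec_ite (by simp [Expr.Fits])]
    have hn := hS.two_le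
    have hmod : (Finset.univ.sup (d.key u) - 1) % n < n := Nat.mod_lt _ (by omega)
    have hnw : n < 2 ^ w := by have := hS.sq; nlinarith
    rw [exec_store (by simp [Expr.Fits]) (by
        simp [Expr.Fits, Expr.val, Op.Fits, hu, h.r7, h.r0, hroot, hw]
        exact ⟨⟨hkey, by omega⟩, by omega⟩),
      exec_store (by simp [Expr.Fits]) (by simp [Expr.Fits])]
    have hfin : ∀ s1 : State, Rep l { d with cen := Function.update d.cen u c } s1 →
        s1.reg x = u → Rep l (d.recenter u) ((StarContraction.setDirty x
          (.bin .mul (.bin .mul (.bin .add (.reg x) (.const 1))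
          (.bin .lt (.const 0) (.get 0 (.reg x))))
          (.bin .eq (.bin .eq (.get 0 (.reg x)) (.get 1 (.reg x))) (.const 0)))).exec w ω s1) := by
      intro s1 h1 hu1
      refine Rep.setDirty (d := { d with cen := Function.update d.cen u c }) (v := u) hS h1
        (by omega) hu1 ?_ ?_
      · simp only [Expr.Fits, Op.Fits, Expr.val, hu1, h1.cen, h1.img, Function.update_self,
          Op.eval_add, Op.eval_lt, Op.eval_mul, true_and]
        refine ⟨⟨⟨hs1, huw⟩, ⟨hs0, hs1⟩, ?_⟩, ⟨hs1, hs0, hs1⟩, ?_⟩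
        · split_ifs <;> omega
        · simp only [Op.eval_eq]; split_ifs <;> omega
      · simp only [Expr.val, hu1, h1.cen, h1.img, Function.update_self,
          Op.eval_add, Op.eval_lt, Op.eval_mul, Op.eval_eq, hcdef]
        by_cases h1 : cenWord (d.isC u) (d.key u) u = 0
        · simp [h1]
        · by_cases h2 : cenWord (d.isC u) (d.key u) u = d.img u
          · rw [h2]; simp
          · simp [h1, h2, Nat.pos_of_ne_zero h1]
    have hst : ∀ s1 : State, Rep l d s1 → s1.reg x = u → ∀ k, k = c →
        Rep l { d with cen := Function.update d.cen u c } (s1.setMem 0 u k) := by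
      rintro s1 h1 hu1 k rfl
      refine h1.update (a := 0) (fun _ _ => rfl) (fun b hb => by simp [hb]) rfl (by norm_num)
        ?_ rfl rfl rfl rfl rfl rfl
      simp only [if_true]
      intro v
      by_cases hvu : v = u
      · subst hvu; simp
      · have : (v : ℕ) ≠ u := fun e => hvu (Fin.ext e)
        simp [hvu, this, h1.cen]
    have hx15 : x ≠ 15 := by omega
    split_ifs with h15
    · apply hfin
      · apply Rep.tick
        simp only [Expr.val, State.tick_reg, State.setReg_reg, hx15, if_false, hu]
        refine hst _ ((((h.tick _).setReg (by decide) _).tick _).tick _)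
          (by simp [hx15, hu]) _ ?_
        simp [Expr.val, hu, h.r7, h.r0, hroot] at h15 ⊢
        simp only [hcdef, cenWord, hc, Bool.false_eq_true, if_false]
        rw [if_neg]
        intro h0
        obtain ⟨v, hv⟩ := h15
        have := Finset.le_sup (f := d.key u) (Finset.mem_univ v)
        omega
      · simp [hx15, hu]
    · apply hfin
      · apply Rep.tick
        simp only [Expr.val, State.tick_reg, State.setReg_reg, hx15, if_false, hu]
        refine hst _ ((((h.tick _).setReg (by decide) _).tick _).tick _)
          (by simp [hx15, hu]) _ ?_
        simp only [Expr.val, State.tick_reg, State.tick_mem, State.setReg_reg, if_true, hu, h.r7,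
          Op.eval_add, Op.eval_mul, hroot, not_not] at h15
        simp only [hcdef, cenWord, hc, Bool.false_eq_true, if_false]
        rw [if_pos h15]
      · simp [hx15, hu]

/-- The data after recording the update of the edge `uv`; the images of its endpoints are `a`
and `b`. -/
def Data.edge (d : Data n) (u v a b : Fin n) (ins : Bool) : Data n :=
  if ∃ c, d.isC c = true then
    if ins then { d with un := setSym d.un u v true }
    else if d.mp u v then
      { d.unmap u v a b with un := setSym (d.unmap u v a b).un u v false }
    else { d with un := setSym d.un u v false }
  else d

/-- Without any center there are no images, so edges are not recorded at all. Otherwise a deletion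
looks up leaf `v` in the tree of `u` to learn whether the edge is currently mapped. -/
lemma Rep.edgeStep (hS : Sizes w n l) (h : Rep l d s) {u v a b : Fin n} {ins : Bool}
    (hu : s.reg 2 = u) (hv : s.reg 3 = v) (h4 : s.reg 4 = if ins then 1 else 0)
    (ha : (∃ c, d.isC c = true) → d.img u = a + 1)
    (hb : (∃ c, d.isC c = true) → d.img v = b + 1) (hwt : ∀ a b, d.wt a b ≤ n * n) :
    Rep l (d.edge u v a b ins) (edgeStep.exec w ω s) := by
  rw [StarContraction.edgeStep, exec_ite (by simp [Expr.Fits])]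
  by_cases hc : ∃ c, d.isC c = true
  · rw [if_pos (show Expr.val s (.reg 12) ≠ 0 from h.r12.2 hc), exec_ite (by simp [Expr.Fits])]
    simp only [Data.edge, if_pos hc, Expr.val, State.tick_reg, h4]
    cases ins
    · simp only [Bool.false_eq_true, if_false, ne_eq, not_true]
      have hrow := hS.row u.2
      have hvl : (v : ℕ) < 2 ^ l := v.2.trans_le hS.le
      rw [exec_seq, exec_ite (by
        simp [Expr.Fits, Expr.val, Op.Fits, hu, hv, h.r7, h.r6]; omega)]
      have e4 : Expr.val ((s.tick ((Expr.reg 12).cost + 1)).tick ((Expr.reg 4).cost + 1))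
        (.get 4 (.bin .add (.bin .mul (.reg 2) (.reg 7)) (.bin .add (.reg 6) (.reg 3)))) =
          if d.mp u v then (v : ℕ) + 1 else 0 := by
        simp only [Expr.val, State.tick_reg, State.tick_mem, hu, hv, h.r7, h.r6, Op.eval_add,
          Op.eval_mul]
        rw [(h.mp u).leaf v hvl, extend_coe, setLeaves]
      rw [e4]
      cases hm : d.mp u v
      · simp only [Bool.false_eq_true, if_false, ne_eq, not_true]
        exact Rep.setUnCmd (u := u) (v := v) hS ((((h.tick _).tick _).tick _).tick _) false
          (by norm_num) (by norm_num) hu hv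
      · simp only [if_true, ne_eq, Nat.add_one_ne_zero, not_false_eq_true]
        refine Rep.setUnCmd (u := u) (v := v) hS ?_ false
          (by norm_num) (by norm_num) ?_ ?_
        · exact Rep.unmapEdge hS (((h.tick _).tick _).tick _) (by norm_num) (by norm_num)
            hu hv (ha hc) (hb hc) (hwt a b)
        · rw [unmapEdge_regs (by norm_num)]; exact hu
        · rw [unmapEdge_regs (by norm_num)]; exact hv
    · simp only [if_true, ne_eq, one_ne_zero, not_false_eq_true]
      exact Rep.setUnCmd (u := u) (v := v) hS ((h.tick _).tick _) true
          (by norm_num) (by norm_num) hu hv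
  · rw [if_neg (show ¬ Expr.val s (.reg 12) ≠ 0 from fun h' => hc (h.r12.1 h'))]
    simp only [Data.edge, if_neg hc]
    exact (h.tick _).tick _

/-- The data after an update, before the background work; `z` and `z'` are the random words. -/
def Data.struct (d : Data n) (l : ℕ) (u v a b : Fin n) (ins : Bool) (z z' : ℕ) : Data n :=
  ((((d.setKey u v (newKey n l ins z v)).recenter u).setKey v u
    (newKey n l ins z' u)).recenter v).edge u v a b ins

/-- Two words are drawn in every update, even at a deletion, where they are discarded. The position
on the tape is therefore a function of time alone. -/
lemma structStep_pos (s : State) : (structStep.exec w ω s).pos = s.pos + 2 := by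
  simp only [structStep, exec_seq]
  have h1 : ∀ x y z, (StarContraction.refreshKey x y z).randFree = true := fun _ _ _ => rfl
  have h2 : ∀ x, (StarContraction.refreshCen x).randFree = true := fun _ => rfl
  have h3 : StarContraction.edgeStep.randFree = true := rfl
  rw [exec_pos_of_randFree h3, exec_pos_of_randFree (h2 _), exec_pos_of_randFree (h1 _ _ _),
    exec_pos_of_randFree (h2 _), exec_pos_of_randFree (h1 _ _ _)]
  simp [exec_rand]

lemma Rep.structStep (hS : Sizes w n l) (h : Rep l d s) {u v a b : Fin n} {ins : Bool}
    (huv : u ≠ v)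
    (hu : s.reg 2 = u) (hv : s.reg 3 = v) (h4 : s.reg 4 = if ins then 1 else 0)
    (hkey : ∀ u v, d.key u v < 2 ^ w)
    (hC : ∀ u, d.isC u = true → d.cen u = u + 1 ∧ d.img u = u + 1 ∧ d.dirty u = false)
    (ha : (∃ c, d.isC c = true) → d.img u = a + 1)
    (hb : (∃ c, d.isC c = true) → d.img v = b + 1) (hwt : ∀ a b, d.wt a b ≤ n * n) :
    Rep l (d.struct l u v a b ins (ω s.pos) (ω (s.pos + 1))) (structStep.exec w ω s) := by
  simp only [StarContraction.structStep, exec_seq]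
  have hkey' : ∀ (d : Data n) (x y : Fin n) (z : ℕ), (∀ u v, d.key u v < 2 ^ w) →
      ∀ u v, (d.setKey x y (newKey n l ins z y)).key u v < 2 ^ w := by
    intro d x y z hd p q
    simp only [Data.setKey]
    split_ifs
    · simp only [setPair]
      split_ifs
      · exact newKey_lt hS ins z y.2
      · exact hd p q
    · exact hd p q
  set s1 := (Cmd.rand 14).exec w ω ((Cmd.rand 13).exec w ω s) with hs1
  have hR1 : Rep l d s1 := by
    simp only [hs1, exec_rand]
    exact h.of_eq (fun z hz => by
      have := lt_of_mem_constRegs hz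
      simp only [State.tick_reg, State.nextWord_reg, State.setReg_reg]
      rw [if_neg (by omega), if_neg (by omega)]) rfl
  have r13 : s1.reg 13 = ω s.pos := by simp [hs1, exec_rand]
  have r14 : s1.reg 14 = ω (s.pos + 1) := by simp [hs1, exec_rand]
  have r2 : s1.reg 2 = u := by simp [hs1, exec_rand, hu]
  have r3 : s1.reg 3 = v := by simp [hs1, exec_rand, hv]
  have r4 : s1.reg 4 = if ins then 1 else 0 := by simp [hs1, exec_rand, h4]
  have hR2 := hR1.refreshKey (ω := ω) hS (x := 2) (y := 3) (z := 13) (by norm_num) (by norm_num)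
    r2 r3 (by rw [r13]; exact (ω s.pos).2) r4
  rw [r13] at hR2
  have hR3 := hR2.refreshCen (ω := ω) hS (x := 2) (u := u) (by norm_num)
    (by rw [refreshKey_regs (by norm_num), r2]) (hkey' _ _ _ _ hkey u) (hC u)
  have hR4 := hR3.refreshKey (ω := ω) hS (x := 3) (y := 2) (z := 14) (u := v) (v := u)
    (by norm_num) (by norm_num)
    (by rw [refreshCen_regs (by norm_num), refreshKey_regs (by norm_num), r3])
    (by rw [refreshCen_regs (by norm_num), refreshKey_regs (by norm_num), r2])
    (by rw [refreshCen_regs (by norm_num), refreshKey_regs (by norm_num), r14]; exact (ω _).2)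
    (by rw [refreshCen_regs (by norm_num), refreshKey_regs (by norm_num), r4])
  rw [refreshCen_regs (by norm_num), refreshKey_regs (by norm_num), r14] at hR4
  have hR5 := hR4.refreshCen (ω := ω) hS (x := 3) (u := v) (by norm_num)
    (by rw [refreshKey_regs (by norm_num), refreshCen_regs (by norm_num),
      refreshKey_regs (by norm_num), r3])
    (hkey' _ _ _ _ (hkey' _ _ _ _ hkey) v) (by
      intro hv
      simpa [Data.setKey, Data.recenter, huv.symm] using hC v hv)
  refine hR5.edgeStep (ω := ω) hS ?_ ?_ ?_ ha hb hwt
  · rw [refreshCen_regs (by norm_num), refreshKey_regs (by norm_num),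
      refreshCen_regs (by norm_num), refreshKey_regs (by norm_num), r2]
  · rw [refreshCen_regs (by norm_num), refreshKey_regs (by norm_num),
      refreshCen_regs (by norm_num), refreshKey_regs (by norm_num), r3]
  · rw [refreshCen_regs (by norm_num), refreshKey_regs (by norm_num),
      refreshCen_regs (by norm_num), refreshKey_regs (by norm_num), r4]

end StarContraction

namespace StarContraction

variable {n w l : ℕ} {d d' : Data n} {G : SimpleGraph (Fin n)}

/-! ### Invariants of the data -/

/-- The set of mapped edges. -/
def edgesOf (mp : Fin n → Fin n → Bool) : Set (Sym2 (Fin n)) :=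
  {e | ∃ u v, e = s(u, v) ∧ mp u v = true}

/-- The mapped edges whose image is the edge `ab` of the contraction. -/
def fiber (img : Fin n → ℕ) (mp : Fin n → Fin n → Bool) (a b : Fin n) : Set (Sym2 (Fin n)) :=
  {e ∈ edgesOf mp | Sym2.map img e = s((a : ℕ) + 1, (b : ℕ) + 1)}

/-- The mapped and unmapped edges, the images and the weights fit together. -/
structure EdgeInv (G : SimpleGraph (Fin n)) (d : Data n) : Prop where
  img_center : ∀ v, d.isC v = true → d.img v = v + 1
  img_other : (∃ c, d.isC c = true) → ∀ v, ∃ r : Fin n, d.isC r = true ∧ d.img v = r + 1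
  img_none : (¬ ∃ c, d.isC c = true) → ∀ v, d.img v = 0
  mp_symm : ∀ u v, d.mp u v = d.mp v u
  un_symm : ∀ u v, d.un u v = d.un v u
  mp_adj : ∀ u v, d.mp u v = true → G.Adj u v
  un_adj : ∀ u v, d.un u v = true → G.Adj u v
  disj : ∀ u v, d.mp u v = true → d.un u v = false
  cover : (∃ c, d.isC c = true) → ∀ u v, G.Adj u v → d.mp u v = true ∨ d.un u v = true
  empty : (¬ ∃ c, d.isC c = true) → ∀ u v, d.mp u v = false ∧ d.un u v = false
  wt : ∀ a b, d.wt a b = (fiber d.img d.mp a b).ncard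

/-- There are `n (n + 1) / 2` unordered pairs, loops included. This keeps the weights within a word.
-/
lemma ncard_le_sq (hn : 2 ≤ n) (F : Set (Sym2 (Fin n))) : F.ncard ≤ n * n := by
  calc F.ncard ≤ Nat.card (Sym2 (Fin n)) := Set.ncard_le_card F
    _ = (n + 1).choose 2 := by rw [Nat.card_eq_fintype_card, Sym2.card, Fintype.card_fin]
    _ = n * (n + 1) / 2 := by rw [Nat.choose_two_right]; simp [mul_comm]
    _ ≤ n * n := by
      apply Nat.div_le_of_le_mul
      nlinarith

lemma EdgeInv.wt_le (h : EdgeInv G d) (hn : 2 ≤ n) (a b : Fin n) : d.wt a b ≤ n * n := by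
  rw [h.wt]; exact ncard_le_sq hn _

lemma EdgeInv.exists_center (h : EdgeInv G d) {u v : Fin n}
    (huv : d.mp u v = true ∨ d.un u v = true) : ∃ c, d.isC c = true := by
  by_contra hc
  obtain ⟨h1, h2⟩ := h.empty hc u v
  simp [h1, h2] at huv

/-! ### Edge weights as cardinalities of fibers. -/

lemma fiber_comm (img : Fin n → ℕ) (mp : Fin n → Fin n → Bool) (a b : Fin n) :
    fiber img mp a b = fiber img mp b a := by
  simp only [fiber, Sym2.eq_swap (a := (a : ℕ) + 1)]

lemma mem_edgesOf {mp : Fin n → Fin n → Bool} (hs : ∀ u v, mp u v = mp v u) {u v : Fin n} :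
    s(u, v) ∈ edgesOf mp ↔ mp u v = true := by
  constructor
  · rintro ⟨x, y, e, h⟩
    rcases Sym2.eq_iff.1 e with ⟨rfl, rfl⟩ | ⟨rfl, rfl⟩
    · exact h
    · rw [hs, h]
  · exact fun h => ⟨u, v, rfl, h⟩

lemma setSym_symm {α : Type*} {g : Fin n → Fin n → α} (hs : ∀ u v, g u v = g v u) (x y : Fin n)
    (b : α) (u v : Fin n) : setSym g x y b u v = setSym g x y b v u := by
  simp only [setSym]
  by_cases h : (u = x ∧ v = y) ∨ (u = y ∧ v = x)
  · rw [if_pos h, if_pos (by tauto)]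
  · rw [if_neg h, if_neg (by tauto), hs]

lemma setSym_eq_iff {x y u v : Fin n} :
    ((u = x ∧ v = y) ∨ (u = y ∧ v = x)) ↔ s(u, v) = s(x, y) := Sym2.eq_iff.symm

lemma edgesOf_setSym_true {mp : Fin n → Fin n → Bool} (hs : ∀ u v, mp u v = mp v u) (x y : Fin n) :
    edgesOf (setSym mp x y true) = insert s(x, y) (edgesOf mp) := by
  ext e
  induction e using Sym2.ind with
  | _ u v =>
    rw [mem_edgesOf (setSym_symm hs x y true), Set.mem_insert_iff, mem_edgesOf hs]
    simp only [setSym, setSym_eq_iff]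
    split_ifs with h <;> simp [h]

lemma edgesOf_setSym_false {mp : Fin n → Fin n → Bool} (hs : ∀ u v, mp u v = mp v u)
    (x y : Fin n) : edgesOf (setSym mp x y false) = edgesOf mp \ {s(x, y)} := by
  ext e
  induction e using Sym2.ind with
  | _ u v =>
    rw [mem_edgesOf (setSym_symm hs x y false), Set.mem_sdiff, mem_edgesOf hs,
      Set.mem_singleton_iff]
    simp only [setSym, setSym_eq_iff]
    split_ifs with h <;> simp [h]

lemma succ_pair_eq_iff {a b p q : Fin n} :
    s((a : ℕ) + 1, (b : ℕ) + 1) = s((p : ℕ) + 1, (q : ℕ) + 1) ↔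
      ((p = a ∧ q = b) ∨ (p = b ∧ q = a)) := by
  simp only [Sym2.eq_iff, Fin.ext_iff]
  omega

/-- The edge `uv` joins the fiber over `{a, b}` and no other one; it was not mapped before, so that
fiber really grows. -/
lemma wt_map {img : Fin n → ℕ} {mp : Fin n → Fin n → Bool} (hs : ∀ u v, mp u v = mp v u)
    {u v a b : Fin n} (hmp : mp u v = false) (ha : img u = a + 1) (hb : img v = b + 1)
    {wt : Fin n → Fin n → ℕ} (hwt : ∀ a b, wt a b = (fiber img mp a b).ncard) (p q : Fin n) :
    setSym wt a b (wt a b + 1) p q = (fiber img (setSym mp u v true) p q).ncard := by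
  have hmem : s(u, v) ∉ edgesOf mp := by rw [mem_edgesOf hs]; simp [hmp]
  simp only [setSym]
  split_ifs with h
  · have h1 : fiber img (setSym mp u v true) p q = insert s(u, v) (fiber img mp p q) := by
      ext e
      simp only [fiber, edgesOf_setSym_true hs, Set.mem_insert_iff, Set.mem_ofPred_eq]
      constructor
      · rintro ⟨rfl | h1, h2⟩
        · exact .inl rfl
        · exact .inr ⟨h1, h2⟩
      · rintro (rfl | ⟨h1, h2⟩)
        · refine ⟨.inl rfl, ?_⟩
          rw [Sym2.map_mk, ha, hb, succ_pair_eq_iff]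
          exact h
        · exact ⟨.inr h1, h2⟩
    have h2 : wt a b = (fiber img mp p q).ncard := by
      rcases h with ⟨rfl, rfl⟩ | ⟨rfl, rfl⟩
      · exact hwt _ _
      · rw [hwt, fiber_comm]
    rw [h1, Set.ncard_insert_of_notMem (fun h => hmem h.1), h2]
  · rw [hwt]
    congr 1
    ext e
    simp only [fiber, edgesOf_setSym_true hs, Set.mem_insert_iff, Set.mem_ofPred_eq]
    constructor
    · exact fun ⟨h1, h2⟩ => ⟨.inr h1, h2⟩
    · rintro ⟨rfl | h1, h2⟩
      · rw [Sym2.map_mk, ha, hb, succ_pair_eq_iff] at h2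
        exact absurd h2 h
      · exact ⟨h1, h2⟩

/-- The fiber over `{a, b}` contains `uv`, so it is nonempty and the truncated subtraction is exact.
-/
lemma wt_unmap {img : Fin n → ℕ} {mp : Fin n → Fin n → Bool} (hs : ∀ u v, mp u v = mp v u)
    {u v a b : Fin n} (hmp : mp u v = true) (ha : img u = a + 1) (hb : img v = b + 1)
    {wt : Fin n → Fin n → ℕ} (hwt : ∀ a b, wt a b = (fiber img mp a b).ncard) (p q : Fin n) :
    setSym wt a b (wt a b - 1) p q = (fiber img (setSym mp u v false) p q).ncard := by
  have hmem : s(u, v) ∈ edgesOf mp := by rwa [mem_edgesOf hs]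
  simp only [setSym]
  split_ifs with h
  · have h1 : fiber img (setSym mp u v false) p q = fiber img mp p q \ {s(u, v)} := by
      ext e
      simp only [fiber, edgesOf_setSym_false hs, Set.mem_sdiff, Set.mem_ofPred_eq]
      tauto
    have h2 : wt a b = (fiber img mp p q).ncard := by
      rcases h with ⟨rfl, rfl⟩ | ⟨rfl, rfl⟩
      · exact hwt _ _
      · rw [hwt, fiber_comm]
    rw [h1, Set.ncard_sdiff_singleton_of_mem, h2]
    refine ⟨hmem, ?_⟩
    rw [Sym2.map_mk, ha, hb, succ_pair_eq_iff]
    exact h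
  · rw [hwt]
    congr 1
    ext e
    simp only [fiber, edgesOf_setSym_false hs, Set.mem_sdiff, Set.mem_ofPred_eq,
      Set.mem_singleton_iff]
    constructor
    · rintro ⟨h1, h2⟩
      refine ⟨⟨h1, ?_⟩, h2⟩
      rintro rfl
      rw [Sym2.map_mk, ha, hb, succ_pair_eq_iff] at h2
      exact h h2
    · exact fun ⟨h1, h2⟩ => ⟨h1.1, h2⟩

lemma setSym_bool {α : Type*} {g : Fin n → Fin n → α} {x y u v : Fin n} {b : α} :
    (s(u, v) = s(x, y) ∧ setSym g x y b u v = b) ∨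
      (s(u, v) ≠ s(x, y) ∧ setSym g x y b u v = g u v) := by
  simp only [setSym, setSym_eq_iff]
  by_cases h : s(u, v) = s(x, y)
  · exact .inl ⟨h, if_pos h⟩
  · exact .inr ⟨h, if_neg h⟩

lemma adj_of_sym2_eq {u v x y : Fin n} (h : s(u, v) = s(x, y)) (hG : G.Adj x y) : G.Adj u v := by
  rwa [← SimpleGraph.mem_edgeSet, h, SimpleGraph.mem_edgeSet]

lemma EdgeInv.map (h : EdgeInv G d) {u v a b : Fin n} (hun : d.un u v = true)
    (ha : d.img u = a + 1) (hb : d.img v = b + 1) : EdgeInv G (d.map u v a b) where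
  img_center := h.img_center
  img_other := h.img_other
  img_none := h.img_none
  mp_symm := setSym_symm h.mp_symm u v true
  un_symm := setSym_symm h.un_symm u v false
  mp_adj p q hpq := by
    simp only [Data.map] at hpq
    rcases setSym_bool (g := d.mp) (x := u) (y := v) (u := p) (v := q) (b := true) with
      ⟨h1, -⟩ | ⟨-, h2⟩
    · exact adj_of_sym2_eq h1 (h.un_adj u v hun)
    · exact h.mp_adj p q (h2 ▸ hpq)
  un_adj p q hpq := by
    simp only [Data.map] at hpq
    rcases setSym_bool (g := d.un) (x := u) (y := v) (u := p) (v := q) (b := false) with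
      ⟨h1, h2⟩ | ⟨-, h2⟩
    · rw [h2] at hpq; cases hpq
    · exact h.un_adj p q (h2 ▸ hpq)
  disj p q hpq := by
    simp only [Data.map, setSym] at hpq ⊢
    split_ifs with h1
    · rfl
    · rw [if_neg h1] at hpq; exact h.disj p q hpq
  cover hc p q hpq := by
    simp only [Data.map, setSym]
    split_ifs with h1
    · exact .inl rfl
    · exact h.cover hc p q hpq
  empty hc := absurd (h.exists_center (.inr hun)) hc
  wt p q := by
    refine wt_map h.mp_symm ?_ ha hb h.wt p q
    by_contra hc
    have := h.disj u v (by simpa using hc)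
    rw [hun] at this; cases this

lemma EdgeInv.unmap (h : EdgeInv G d) {u v a b : Fin n} (hmp : d.mp u v = true)
    (ha : d.img u = a + 1) (hb : d.img v = b + 1) : EdgeInv G (d.unmap u v a b) where
  img_center := h.img_center
  img_other := h.img_other
  img_none := h.img_none
  mp_symm := setSym_symm h.mp_symm u v false
  un_symm := setSym_symm h.un_symm u v true
  mp_adj p q hpq := by
    simp only [Data.unmap] at hpq
    rcases setSym_bool (g := d.mp) (x := u) (y := v) (u := p) (v := q) (b := false) with
      ⟨h1, h2⟩ | ⟨-, h2⟩
    · rw [h2] at hpq; cases hpq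
    · exact h.mp_adj p q (h2 ▸ hpq)
  un_adj p q hpq := by
    simp only [Data.unmap] at hpq
    rcases setSym_bool (g := d.un) (x := u) (y := v) (u := p) (v := q) (b := true) with
      ⟨h1, h2⟩ | ⟨-, h2⟩
    · exact adj_of_sym2_eq h1 (h.mp_adj u v hmp)
    · exact h.un_adj p q (h2 ▸ hpq)
  disj p q hpq := by
    simp only [Data.unmap, setSym] at hpq ⊢
    split_ifs with h1
    · rw [if_pos h1] at hpq; cases hpq
    · rw [if_neg h1] at hpq; exact h.disj p q hpq
  cover hc p q hpq := by
    simp only [Data.unmap, setSym]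
    split_ifs with h1
    · exact .inr rfl
    · exact h.cover hc p q hpq
  empty hc := absurd (h.exists_center (.inl hmp)) hc
  wt p q := wt_unmap h.mp_symm hmp ha hb h.wt p q

/-- No mapped edge meets `u`, so no fiber notices the new image. This is why all edges at a dirty
vertex are unmapped before its image is changed. -/
lemma EdgeInv.setImg (h : EdgeInv G d) {u r : Fin n} {dy : Fin n → Bool} (hu : d.isC u = false)
    (hmp : ∀ v, d.mp u v = false) (hr : d.isC r = true) :
    EdgeInv G { d with img := Function.update d.img u (r + 1), dirty := dy } where
  img_center v hv := by
    have : v ≠ u := by rintro rfl; simp [hu] at hv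
    simpa [this] using h.img_center v hv
  img_other hc v := by
    by_cases hv : v = u
    · subst hv; exact ⟨r, hr, by simp⟩
    · simpa [hv] using h.img_other hc v
  img_none hc := absurd ⟨r, hr⟩ hc
  mp_symm := h.mp_symm
  un_symm := h.un_symm
  mp_adj := h.mp_adj
  un_adj := h.un_adj
  disj := h.disj
  cover := h.cover
  empty := h.empty
  wt a b := by
    change d.wt a b = _
    rw [h.wt]
    congr 1
    ext e
    simp only [fiber, Set.mem_ofPred_eq]
    refine and_congr_right ?_
    rintro ⟨x, y, rfl, hxy⟩
    have hx : x ≠ u := by rintro rfl; simp [hmp] at hxy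
    have hy : y ≠ u := by rintro rfl; rw [h.mp_symm] at hxy; simp [hmp] at hxy
    simp [Sym2.map_mk, hx, hy]

lemma EdgeInv.congr (h : EdgeInv G d) (h1 : d'.isC = d.isC) (h2 : d'.img = d.img)
    (h3 : d'.mp = d.mp) (h4 : d'.un = d.un) (h5 : d'.wt = d.wt) : EdgeInv G d' := by
  obtain ⟨_, _, _, _, _, _, _, _⟩ := d
  obtain ⟨_, _, _, _, _, _, _, _⟩ := d'
  simp only at h1 h2 h3 h4 h5
  subst h1 h2 h3 h4 h5
  exact ⟨h.1, h.2, h.3, h.4, h.5, h.6, h.7, h.8, h.9, h.10, h.11⟩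

/-- The centers are valid, and exactly the vertices with a wrong image are dirty. -/
structure CenInv (d : Data n) : Prop where
  cen_center : ∀ v, d.isC v = true → d.cen v = v + 1
  cen_other : ∀ v, d.cen v = 0 ∨ ∃ r : Fin n, d.isC r = true ∧ d.cen v = r + 1
  dirty : ∀ v, d.dirty v = decide (d.cen v ≠ 0 ∧ d.cen v ≠ d.img v)

/-! ### The pending work -/

/-- A bound on the number of units of background work that are pending. -/
def Data.pending (d : Data n) : ℕ :=
  ∑ p : Fin n × Fin n, ((d.un p.1 p.2).toNat +
    2 * (d.mp p.1 p.2 && (d.dirty p.1 || d.dirty p.2)).toNat) +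
  ∑ v, (d.dirty v).toNat

/-- An ordered pair contributes at most `3` and a vertex at most `1`. The bound limits how far back
in time the cause of a nonempty queue has to be sought. -/
lemma Data.pending_le (hn : 2 ≤ n) (d : Data n) : d.pending ≤ 4 * (n * n) := by
  have h1 : ∑ p : Fin n × Fin n, ((d.un p.1 p.2).toNat +
      2 * (d.mp p.1 p.2 && (d.dirty p.1 || d.dirty p.2)).toNat) ≤
      ∑ p : Fin n × Fin n, 3 := Finset.sum_le_sum fun p _ => by
        have h1 := Bool.toNat_le (d.un p.1 p.2)
        have h2 := Bool.toNat_le (d.mp p.1 p.2 && (d.dirty p.1 || d.dirty p.2))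
        omega
  have h2 : ∑ v, (d.dirty v).toNat ≤ ∑ v : Fin n, 1 :=
    Finset.sum_le_sum fun p _ => Bool.toNat_le _
  simp only [Finset.sum_const, Finset.card_univ, Fintype.card_prod, Fintype.card_fin,
    smul_eq_mul] at h1 h2
  rw [Data.pending]
  nlinarith

/-- Nothing is dirty and no edge waits. A vertex that is not dirty has its center as image unless it
has no center, which `hcen` excludes; an edge that does not wait is mapped. -/
lemma Data.eq_of_pending_eq_zero (hE : EdgeInv G d) (hC : CenInv d) (h : d.pending = 0)
    (hcen : ∀ v, d.cen v ≠ 0) : d.img = d.cen ∧ ∀ u v, d.mp u v = true ↔ G.Adj u v := by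
  rw [Data.pending, Nat.add_eq_zero_iff, Finset.sum_eq_zero_iff, Finset.sum_eq_zero_iff] at h
  obtain ⟨h1, h2⟩ := h
  refine ⟨?_, fun u v => ⟨hE.mp_adj u v, fun huv => ?_⟩⟩
  · funext v
    have := h2 v (Finset.mem_univ _)
    by_contra hne
    have hd : d.dirty v = true := by
      rw [hC.dirty]; simp [hcen v, Ne.symm hne]
    simp [hd] at this
  · have hc : ∃ c, d.isC c = true := by
      obtain h0 | ⟨r, hr, -⟩ := hC.cen_other u
      · exact absurd h0 (hcen u)
      · exact ⟨r, hr⟩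
    rcases hE.cover hc u v huv with h | h
    · exact h
    · have := h1 (u, v) (Finset.mem_univ _)
      simp [h] at this

/-- The weights in `pending` make every unit of work count: unmapping an edge at a dirty vertex
turns a `2` into a `1`, since the edge must be mapped again; mapping an edge when nothing is dirty
turns a `1` into a `0`; cleaning a vertex removes the unit of the vertex itself. -/
lemma Work.spec (hw : Work d d') (hE : EdgeInv G d) (hC : CenInv d) :
    EdgeInv G d' ∧ CenInv d' ∧ d'.isC = d.isC ∧ d'.key = d.key ∧ d'.cen = d.cen ∧
      d'.pending ≤ d.pending - 1 := by
  cases hw with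
  | unmap u v a b hu hv ha hb =>
    refine ⟨hE.unmap hv ha hb, ⟨hC.1, hC.2, hC.3⟩, rfl, rfl, rfl, Nat.le_sub_one_of_lt ?_⟩
    simp only [Data.pending, Data.unmap]
    refine Nat.add_lt_add_right (Finset.sum_lt_sum (fun p _ => ?_)
      ⟨(u, v), Finset.mem_univ _, ?_⟩) _
    · rcases setSym_bool (g := d.mp) (x := u) (y := v) (u := p.1) (v := p.2) (b := false) with
        ⟨h1, h2⟩ | ⟨h1, h2⟩
      · have h3 : d.mp p.1 p.2 = true := by
          rw [← mem_edgesOf hE.mp_symm, h1, mem_edgesOf hE.mp_symm]; exact hv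
        have h4 : (d.dirty p.1 || d.dirty p.2) = true := by
          rcases Sym2.eq_iff.1 h1 with ⟨h5, h6⟩ | ⟨h5, h6⟩ <;> simp [h5, h6, hu]
        simp only [h2, h3, h4, Bool.false_and, Bool.and_self, Bool.toNat_false, Bool.toNat_true]
        have := Bool.toNat_le (setSym d.un u v true p.1 p.2)
        omega
      · have h3 : setSym d.un u v true p.1 p.2 = d.un p.1 p.2 := by
          simp only [setSym, setSym_eq_iff, if_neg h1]
        rw [h2, h3]
    · simp [setSym, hv, hu, hE.disj u v hv]
  | clean u hu hmp =>
    have h1 := hC.dirty u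
    rw [hu] at h1
    obtain ⟨h2, h3⟩ := of_decide_eq_true h1.symm
    obtain h0 | ⟨r, hr, hr'⟩ := hC.cen_other u
    · exact absurd h0 h2
    have hCu : d.isC u = false := by
      by_contra hc
      rw [Bool.not_eq_false] at hc
      exact h3 ((hC.cen_center u hc).trans (hE.img_center u hc).symm)
    refine ⟨?_, ⟨hC.1, hC.2, fun v => ?_⟩, rfl, rfl, rfl, Nat.le_sub_one_of_lt ?_⟩
    · rw [hr']; exact hE.setImg hCu hmp hr
    · by_cases hv : v = u
      · subst hv; simp
      · simpa [hv] using hC.dirty v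
    · simp only [Data.pending]
      refine Nat.add_lt_add_of_le_of_lt (Finset.sum_le_sum fun p _ => ?_)
        (Finset.sum_lt_sum (fun v _ => ?_) ⟨u, Finset.mem_univ _, by simp [hu]⟩)
      · refine Nat.add_le_add_left ?_ _
        by_cases hp : d.mp p.1 p.2 = true
        · have hp1 : p.1 ≠ u := by rintro h; rw [h, hmp] at hp; cases hp
          have hp2 : p.2 ≠ u := by rintro h; rw [hE.mp_symm, h, hmp] at hp; cases hp
          simp [hp1, hp2]
        · simp [hp]
      · by_cases hv : v = u
        · subst hv; simp
        · simp [hv]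
  | map u v a b hd hun ha hb =>
    refine ⟨hE.map hun ha hb, ⟨hC.1, hC.2, hC.3⟩, rfl, rfl, rfl, Nat.le_sub_one_of_lt ?_⟩
    simp only [Data.pending, Data.map, hd]
    simp only [Bool.or_self, Bool.and_false, Bool.toNat_false, mul_zero, add_zero]
    refine Nat.add_lt_add_right (Finset.sum_lt_sum (fun p _ => ?_)
      ⟨(u, v), Finset.mem_univ _, ?_⟩) _
    · rcases setSym_bool (g := d.un) (x := u) (y := v) (u := p.1) (v := p.2) (b := false) with
        ⟨h1, h2⟩ | ⟨h1, h2⟩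
      · simp [h2]
      · rw [h2]
    · simp [setSym, hun]
  | done hd hun =>
    refine ⟨hE, hC, rfl, rfl, rfl, ?_⟩
    simp [Data.pending, hd, hun]

end StarContraction

namespace StarContraction

variable {n w l : ℕ} {d d' : Data n} {G : SimpleGraph (Fin n)}

/-! ### The centers as a function of the graph and the random words -/

/-- The key of `v` at `u` in the graph `G` with the centers `isC` and the priorities `prio`. -/
noncomputable def keyOf (G : SimpleGraph (Fin n)) (isC : Fin n → Bool) (l : ℕ)
    (prio : Fin n → Fin n → ℕ) (u v : Fin n) : ℕ := by
  classical exact if G.Adj u v ∧ isC v = true then prio u v % (2 ^ l) ^ 5 * n + (v + 1) else 0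

/-- The word that encodes the center of `u`. -/
noncomputable def centerOf (G : SimpleGraph (Fin n)) (isC : Fin n → Bool) (l : ℕ)
    (prio : Fin n → Fin n → ℕ) (u : Fin n) : ℕ :=
  cenWord (isC u) (keyOf G isC l prio u) u

section centerOf

variable {isC : Fin n → Bool} {prio prio' : Fin n → Fin n → ℕ} {u v : Fin n}

lemma keyOf_pos (h : G.Adj u v) (hv : isC v = true) :
    keyOf G isC l prio u v = prio u v % (2 ^ l) ^ 5 * n + (v + 1) := by
  simp [keyOf, h, hv]

lemma keyOf_neg (h : ¬ (G.Adj u v ∧ isC v = true)) : keyOf G isC l prio u v = 0 := by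
  rw [keyOf, if_neg h]

lemma centerOf_center (hu : isC u = true) : centerOf G isC l prio u = u + 1 := by
  simp [centerOf, cenWord, hu]

/-- Keys are positive exactly at adjacent centers, so a zero supremum means that there are none.
Otherwise the supremum is attained, and its residue modulo `n` after subtracting one is the vertex
that attains it. -/
lemma centerOf_other (hu : isC u = false) :
    (centerOf G isC l prio u = 0 ∧ ∀ v, G.Adj u v → isC v = false) ∨
    ∃ r : Fin n, centerOf G isC l prio u = r + 1 ∧ G.Adj u r ∧ isC r = true ∧
      ∀ v, keyOf G isC l prio u v ≤ keyOf G isC l prio u r := by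
  simp only [centerOf, cenWord, hu, Bool.false_eq_true, if_false]
  split_ifs with h0
  · refine .inl ⟨rfl, fun v hv => ?_⟩
    by_contra hc
    have h1 := Finset.le_sup (f := keyOf G isC l prio u) (Finset.mem_univ v)
    rw [keyOf_pos hv (by simpa using hc)] at h1
    omega
  · right
    obtain ⟨r, -, hr⟩ := Finset.exists_mem_eq_sup (Finset.univ : Finset (Fin n)) ⟨u, Finset.mem_univ u⟩
      (keyOf G isC l prio u)
    rw [hr] at h0 ⊢
    have h1 : G.Adj u r ∧ isC r = true := by
      by_contra hc
      exact h0 (keyOf_neg hc)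
    refine ⟨r, ?_, h1.1, h1.2, fun v => hr ▸ Finset.le_sup (Finset.mem_univ v)⟩
    rw [keyOf_pos h1.1 h1.2, ← add_assoc, Nat.add_sub_cancel, Nat.mul_add_mod_self_right,
      Nat.mod_eq_of_lt r.2]

lemma centerOf_eq (hu : isC u = false) {r : Fin n} (hr : G.Adj u r) (hC : isC r = true)
    (hmax : ∀ v, v ≠ r → keyOf G isC l prio u v < keyOf G isC l prio u r) :
    centerOf G isC l prio u = r + 1 := by
  rcases centerOf_other (G := G) (l := l) (prio := prio) hu with ⟨-, h⟩ | ⟨r', h1, -, -, h2⟩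
  · simp [h r hr] at hC
  · have : r' = r := by
      by_contra hne
      have := hmax r' hne
      have := h2 r
      omega
    rw [h1, this]

lemma centerOf_eq_zero (hu : isC u = false) (h : ∀ v, G.Adj u v → isC v = false) :
    centerOf G isC l prio u = 0 := by
  rcases centerOf_other (G := G) (l := l) (prio := prio) hu with ⟨h, -⟩ | ⟨r', -, h1, h2, -⟩
  · exact h
  · simp [h r' h1] at h2

lemma centerOf_congr {G' : SimpleGraph (Fin n)} (h : ∀ v, (G.Adj u v ↔ G'.Adj u v))
    (hp : ∀ v, prio u v = prio' u v) :
    centerOf G isC l prio u = centerOf G' isC l prio' u := by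
  have : keyOf G isC l prio u = keyOf G' isC l prio' u := by
    funext v
    by_cases hv : G.Adj u v ∧ isC v = true
    · rw [keyOf_pos hv.1 hv.2, keyOf_pos ((h v).1 hv.1) hv.2, hp]
    · rw [keyOf_neg hv, keyOf_neg (by rwa [← h v])]
  rw [centerOf, centerOf, this]

end centerOf

/-! ### The effect of an update -/

lemma Update.apply_adj {e : Update n} (he : e.u ≠ e.v) {p q : Fin n} :
    (e.apply G).Adj p q ↔
      if e.ins then G.Adj p q ∨ s(p, q) = s(e.u, e.v) else G.Adj p q ∧ s(p, q) ≠ s(e.u, e.v) := by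
  rw [Update.apply]
  split_ifs with h
  · rw [SimpleGraph.sup_adj, SimpleGraph.edge_adj, Sym2.eq_iff]
    constructor
    · rintro (h | ⟨h, -⟩)
      · exact .inl h
      · exact .inr h
    · rintro (h | h)
      · exact .inl h
      · refine .inr ⟨h, ?_⟩
        rintro rfl
        rcases h with ⟨h1, h2⟩ | ⟨h1, h2⟩
        · exact he (h1.symm.trans h2)
        · exact he (h2.symm.trans h1)
  · rw [SimpleGraph.deleteEdges_adj]
    simp

/-- The priorities after an update with the random words `z` and `z'`. -/
def newPrio (prio : Fin n → Fin n → ℕ) (e : Update n) (z z' : ℕ) : Fin n → Fin n → ℕ :=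
  if e.ins then setPair (setPair prio e.u e.v z) e.v e.u z' else prio

/-- The invariant that holds between updates. -/
structure Inv (G : SimpleGraph (Fin n)) (l : ℕ) (prio : Fin n → Fin n → ℕ) (d : Data n) :
    Prop where
  key : d.key = keyOf G d.isC l prio
  cen : d.cen = centerOf G d.isC l prio
  dirty : ∀ v, d.dirty v = decide (d.cen v ≠ 0 ∧ d.cen v ≠ d.img v)
  edge : EdgeInv G d

lemma Inv.cenInv {prio : Fin n → Fin n → ℕ} (h : Inv G l prio d) : CenInv d where
  cen_center v hv := by rw [h.cen, centerOf_center hv]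
  cen_other v := by
    by_cases hv : d.isC v = true
    · exact .inr ⟨v, hv, by rw [h.cen, centerOf_center hv]⟩
    · rcases centerOf_other (G := G) (l := l) (prio := prio) (by simpa using hv) with
        ⟨h1, -⟩ | ⟨r, h1, -, h3, -⟩
      · exact .inl (by rw [h.cen, h1])
      · exact .inr ⟨r, h3, by rw [h.cen, h1]⟩
  dirty := h.dirty

lemma Inv.center (h : Inv G l prio d) (u : Fin n) (hu : d.isC u = true) :
    d.cen u = u + 1 ∧ d.img u = u + 1 ∧ d.dirty u = false := by
  have h1 := h.cenInv.cen_center u hu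
  have h2 := h.edge.img_center u hu
  exact ⟨h1, h2, by rw [h.dirty, h1, h2]; simp⟩

lemma Inv.key_lt (hS : Sizes w n l) (h : Inv G l prio d) (u v : Fin n) : d.key u v < 2 ^ w := by
  rw [h.key]
  by_cases hv : G.Adj u v ∧ d.isC v = true
  · rw [keyOf_pos hv.1 hv.2]
    have := newKey_lt hS true (prio u v) v.2
    simpa [newKey] using this
  · rw [keyOf_neg hv]; exact hS.small (by norm_num)

/-- Every mapped edge at `x` is an edge of `G` and is counted in both orders. -/
lemma sum_incident_le (hE : EdgeInv G d) (x : Fin n) :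
    ∑ p : Fin n × Fin n, (d.mp p.1 p.2 && (decide (p.1 = x) || decide (p.2 = x))).toNat ≤
      2 * deg G x := by
  have hrow : ∑ q, (d.mp x q).toNat ≤ deg G x := by
    classical
    have : deg G x = ∑ q, (if q ∈ G.neighborSet x then 1 else 0) := by
      rw [deg, ← SimpleGraph.card_neighborFinset_eq_degree]
      simp only [SimpleGraph.mem_neighborSet]
      rw [Finset.sum_boole, SimpleGraph.neighborFinset_eq_filter]
      simp only [Nat.cast_id]
    rw [this]
    refine Finset.sum_le_sum fun q _ => ?_
    cases hm : d.mp x q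
    · simp
    · simp [hE.mp_adj x q hm]
  calc _ ≤ ∑ p : Fin n × Fin n, ((if p.1 = x then (d.mp x p.2).toNat else 0) +
        (if p.2 = x then (d.mp x p.1).toNat else 0)) := by
        refine Finset.sum_le_sum fun p _ => ?_
        by_cases h1 : p.1 = x
        · simp [h1]
        · by_cases h2 : p.2 = x
          · simp [h1, h2, hE.mp_symm x p.1]
          · simp [h1, h2]
    _ = 2 * ∑ q, (d.mp x q).toNat := by
        rw [Finset.sum_add_distrib, Fintype.sum_prod_type, Fintype.sum_prod_type_right]
        simp only [two_mul]
        congr 1 <;> rw [Finset.sum_comm] <;> simp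
    _ ≤ 2 * deg G x := by omega

/-- A vertex `x` that becomes dirty adds one unit for itself and, for each of at most `deg G x`
mapped edges, two ordered pairs of weight two. -/
lemma pending_le_of_dirty (hE : EdgeInv G d) (hmp : d'.mp = d.mp) (hun : d'.un = d.un)
    {p : Fin n → Prop} [DecidablePred p] (hd : ∀ x, d'.dirty x = true → d.dirty x = true ∨ p x) :
    d'.pending ≤ d.pending + ∑ x, if p x then 1 + 4 * deg G x else 0 := by
  have h1 : ∀ x, (d'.dirty x).toNat ≤ (d.dirty x).toNat + if p x then 1 else 0 := by
    intro x
    cases h : d'.dirty x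
    · simp
    · rcases hd x h with h2 | h2 <;> simp [h2]
  have h2 : ∀ q : Fin n × Fin n, (d'.mp q.1 q.2 && (d'.dirty q.1 || d'.dirty q.2)).toNat ≤
      (d.mp q.1 q.2 && (d.dirty q.1 || d.dirty q.2)).toNat +
      ∑ x, if p x then (d.mp q.1 q.2 && (decide (q.1 = x) || decide (q.2 = x))).toNat else 0 := by
    intro q
    rw [hmp]
    cases hm : d.mp q.1 q.2
    · simp
    · have hsum : ∀ y, p y → (q.1 = y ∨ q.2 = y) → 1 ≤
          ∑ x, if p x then (true && (decide (q.1 = x) || decide (q.2 = x))).toNat else 0 := by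
        intro y hy hq
        refine le_trans ?_ (Finset.single_le_sum (fun _ _ => Nat.zero_le _) (Finset.mem_univ y))
        rw [if_pos hy]
        rcases hq with hq | hq <;> simp [hq]
      rcases h : (d'.dirty q.1 || d'.dirty q.2)
      · simp
      · simp only [Bool.or_eq_true] at h
        simp only [Bool.and_self, Bool.toNat_true]
        rcases h with h | h
        · rcases hd _ h with h3 | h3
          · simp [h3]
          · have := hsum _ h3 (.inl rfl); omega
        · rcases hd _ h with h3 | h3
          · simp [h3]
          · have := hsum _ h3 (.inr rfl); omega
  have h3 : ∑ q : Fin n × Fin n, ∑ x, (if p x then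
      (d.mp q.1 q.2 && (decide (q.1 = x) || decide (q.2 = x))).toNat else 0) ≤
      ∑ x, if p x then 2 * deg G x else 0 := by
    rw [Finset.sum_comm]
    refine Finset.sum_le_sum fun x _ => ?_
    split_ifs
    · exact sum_incident_le hE x
    · simp
  have h4 : ∑ x, (if p x then 1 + 4 * deg G x else 0) =
      ∑ x, (if p x then 1 else 0) + 2 * ∑ x, if p x then 2 * deg G x else 0 := by
    rw [Finset.mul_sum, ← Finset.sum_add_distrib]
    refine Finset.sum_congr rfl fun x _ => ?_
    split_ifs <;> omega
  have h5 := Finset.sum_le_sum fun x (_ : x ∈ Finset.univ) => h1 x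
  have h6 := Finset.sum_le_sum fun x (_ : x ∈ Finset.univ) => h2 x
  rw [Finset.sum_add_distrib] at h5 h6
  simp only [Data.pending]
  rw [Finset.sum_add_distrib, Finset.sum_add_distrib, ← Finset.mul_sum, ← Finset.mul_sum, h4, hun]
  omega

lemma setSym_apply {α : Type*} {g : Fin n → Fin n → α} {x y u v : Fin n} {b : α} :
    setSym g x y b u v = if s(u, v) = s(x, y) then b else g u v := by
  simp only [setSym, setSym_eq_iff]

/-- An inserted edge waits to be mapped and counts in both orders, hence the `2`. A deletion creates
no work: if the edge is mapped it is unmapped at once, and then it is removed from the waiting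
edges. -/
lemma Data.edge_spec (hE : EdgeInv G d) {e : Update n} (he : e.Valid G) {a b : Fin n}
    (ha : (∃ c, d.isC c = true) → d.img e.u = a + 1)
    (hb : (∃ c, d.isC c = true) → d.img e.v = b + 1) :
    EdgeInv (e.apply G) (d.edge e.u e.v a b e.ins) ∧
      (d.edge e.u e.v a b e.ins).pending ≤ d.pending + 2 := by
  have hadj := fun p q => e.apply_adj (G := G) he.1 (p := p) (q := q)
  simp only [Data.edge]
  by_cases hc : ∃ c, d.isC c = true
  swap
  · rw [if_neg hc]
    refine ⟨⟨hE.1, hE.2, hE.3, hE.4, hE.5, fun u v h => ?_, fun u v h => ?_, hE.8,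
      fun h => absurd h hc, hE.10, hE.11⟩, by omega⟩
    · simp [(hE.empty hc u v).1] at h
    · simp [(hE.empty hc u v).2] at h
  rw [if_pos hc]
  cases hins : e.ins
  · have hG : G.Adj e.u e.v := he.2.2 hins
    simp only [hins, Bool.false_eq_true, if_false] at hadj ⊢
    have main : ∀ d0 : Data n, EdgeInv G d0 → (∃ c, d0.isC c = true) → d0.mp e.u e.v = false →
        EdgeInv (e.apply G) { d0 with un := setSym d0.un e.u e.v false } := by
      intro d0 h0 hc0 hm0
      refine ⟨h0.1, h0.2, h0.3, h0.4, setSym_symm h0.5 _ _ _, fun u v h => ?_, fun u v h => ?_,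
        fun u v h => ?_, fun hc u v h => ?_, fun h => absurd hc0 h, h0.11⟩
      · refine (hadj u v).2 ⟨h0.mp_adj u v h, fun heq => ?_⟩
        rw [← mem_edgesOf h0.mp_symm, heq, mem_edgesOf h0.mp_symm, hm0] at h
        cases h
      · simp only [setSym_apply] at h
        split_ifs at h with h1
        exact (hadj u v).2 ⟨h0.un_adj u v h, h1⟩
      · simp only [setSym_apply]
        split_ifs
        · rfl
        · exact h0.disj u v h
      · obtain ⟨h1, h2⟩ := (hadj u v).1 h
        simp only [setSym_apply, if_neg h2]
        exact h0.cover hc u v h1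
    cases hm : d.mp e.u e.v
    · simp only [Bool.false_eq_true, if_false]
      refine ⟨main d hE hc hm, ?_⟩
      refine le_trans ?_ (Nat.le_add_right _ 2)
      refine Nat.add_le_add_right (Finset.sum_le_sum fun p _ => Nat.add_le_add_right ?_ _) _
      simp only [setSym_apply]
      split_ifs <;> simp
    · simp only [if_true]
      refine ⟨main _ (hE.unmap hm (ha hc) (hb hc)) hc (by simp [Data.unmap, setSym]), ?_⟩
      refine le_trans ?_ (Nat.le_add_right _ 2)
      refine Nat.add_le_add_right (Finset.sum_le_sum fun p _ => ?_) _
      simp only [setSym_apply, Data.unmap]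
      split_ifs <;> simp
  · simp only [hins, if_true] at hadj ⊢
    have hG : ¬ G.Adj e.u e.v := fun h => by
      have := he.2.1 h
      rw [hins] at this
      cases this
    have hm : ∀ u v, s(u, v) = s(e.u, e.v) → d.mp u v = false := by
      intro u v h
      by_contra hne
      exact hG (adj_of_sym2_eq h.symm (hE.mp_adj u v (by simpa using hne)))
    refine ⟨⟨hE.1, hE.2, hE.3, hE.4, setSym_symm hE.5 _ _ _, fun u v h => ?_, fun u v h => ?_,
        fun u v h => ?_, fun hc u v h => ?_, fun h => absurd hc h, hE.11⟩, ?_⟩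
    · exact (hadj u v).2 (.inl (hE.mp_adj u v h))
    · simp only [setSym_apply] at h
      split_ifs at h with h1
      · exact (hadj u v).2 (.inr h1)
      · exact (hadj u v).2 (.inl (hE.un_adj u v h))
    · simp only [setSym_apply]
      split_ifs with h1
      · rw [show d.mp u v = false from hm u v h1] at h; cases h
      · exact hE.disj u v h
    · simp only [setSym_apply]
      split_ifs with h1
      · exact .inr rfl
      · exact hE.cover hc u v (((hadj u v).1 h).resolve_right h1)
    · have h1 : ∀ p : Fin n × Fin n, (setSym d.un e.u e.v true p.1 p.2).toNat ≤
          (d.un p.1 p.2).toNat + ((if p = (e.u, e.v) then 1 else 0) +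
            (if p = (e.v, e.u) then 1 else 0)) := by
        rintro ⟨p, q⟩
        simp only [setSym, Prod.mk.injEq]
        by_cases h1 : p = e.u ∧ q = e.v
        · rw [if_pos (.inl h1), if_pos h1]; simp; omega
        · by_cases h2 : p = e.v ∧ q = e.u
          · rw [if_pos (.inr h2), if_pos h2]; simp; omega
          · rw [if_neg (by tauto)]; simp
      have h2 := Finset.sum_le_sum fun p (_ : p ∈ Finset.univ) => h1 p
      rw [Finset.sum_add_distrib, Finset.sum_add_distrib] at h2
      simp only [Finset.sum_ite_eq', Finset.mem_univ, if_true] at h2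
      simp only [Data.pending]
      rw [Finset.sum_add_distrib, Finset.sum_add_distrib]
      omega

@[simp] lemma Data.edge_isC (d : Data n) (u v a b : Fin n) (ins : Bool) :
    (d.edge u v a b ins).isC = d.isC := by
  simp only [Data.edge]; split_ifs <;> rfl

@[simp] lemma Data.edge_key (d : Data n) (u v a b : Fin n) (ins : Bool) :
    (d.edge u v a b ins).key = d.key := by
  simp only [Data.edge]; split_ifs <;> rfl

@[simp] lemma Data.edge_cen (d : Data n) (u v a b : Fin n) (ins : Bool) :
    (d.edge u v a b ins).cen = d.cen := by
  simp only [Data.edge]; split_ifs <;> rfl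

@[simp] lemma Data.edge_img (d : Data n) (u v a b : Fin n) (ins : Bool) :
    (d.edge u v a b ins).img = d.img := by
  simp only [Data.edge]; split_ifs <;> rfl

@[simp] lemma Data.edge_dirty (d : Data n) (u v a b : Fin n) (ins : Bool) :
    (d.edge u v a b ins).dirty = d.dirty := by
  simp only [Data.edge]; split_ifs <;> rfl

lemma keyOf_update {isC : Fin n → Bool} {prio : Fin n → Fin n → ℕ} {e : Update n}
    (he : e.Valid G) {z z' : ℕ} (p q : Fin n) :
    keyOf (e.apply G) isC l (newPrio prio e z z') p q =
      if p = e.u ∧ q = e.v then (if isC e.v then newKey n l e.ins z e.v else 0)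
      else if p = e.v ∧ q = e.u then (if isC e.u then newKey n l e.ins z' e.u else 0)
      else keyOf G isC l prio p q := by
  have hadj := e.apply_adj (G := G) he.1 (p := p) (q := q)
  by_cases h1 : p = e.u ∧ q = e.v
  · obtain ⟨rfl, rfl⟩ := h1
    rw [if_pos ⟨rfl, rfl⟩]
    cases hins : e.ins
    · rw [keyOf_neg (by rw [hadj]; simp [hins])]
      simp [newKey]
    · cases hC : isC e.v
      · rw [keyOf_neg (by simp [hC])]; simp
      · rw [keyOf_pos (hadj.2 (by simp [hins])) hC]
        simp [newKey, newPrio, hins, setPair, he.1, he.1.symm]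
  rw [if_neg h1]
  by_cases h2 : p = e.v ∧ q = e.u
  · obtain ⟨rfl, rfl⟩ := h2
    rw [if_pos ⟨rfl, rfl⟩]
    cases hins : e.ins
    · rw [keyOf_neg (by rw [hadj]; simp [hins])]
      simp [newKey]
    · cases hC : isC e.u
      · rw [keyOf_neg (by simp [hC])]; simp
      · rw [keyOf_pos (hadj.2 (by simp [hins])) hC]
        simp [newKey, newPrio, hins, setPair]
  rw [if_neg h2]
  have h3 : s(p, q) ≠ s(e.u, e.v) := by rw [Ne, Sym2.eq_iff]; tauto
  have hadj' : (e.apply G).Adj p q ↔ G.Adj p q := by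
    rw [hadj]; split_ifs <;> simp [h3]
  have hp : newPrio prio e z z' p q = prio p q := by
    simp only [newPrio]
    split_ifs
    · simp only [setPair, if_neg h1, if_neg h2]
    · rfl
  by_cases hv : G.Adj p q ∧ isC q = true
  · rw [keyOf_pos (hadj'.2 hv.1) hv.2, keyOf_pos hv.1 hv.2, hp]
  · rw [keyOf_neg hv, keyOf_neg (by rwa [hadj'])]

/-- An update alters keys only in the rows of its endpoints, so recomputing two centers suffices.
The edge itself creates at most two units of work, all else comes from changed centers. Degrees
refer to the old graph because the edge is recorded last. -/
lemma Inv.struct (h : Inv G l prio d) {e : Update n} (he : e.Valid G) {a b : Fin n}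
    (ha : (∃ c, d.isC c = true) → d.img e.u = a + 1)
    (hb : (∃ c, d.isC c = true) → d.img e.v = b + 1) {z z' : ℕ} :
    Inv (e.apply G) l (newPrio prio e z z') (d.struct l e.u e.v a b e.ins z z') ∧
    (d.struct l e.u e.v a b e.ins z z').isC = d.isC ∧
    (d.struct l e.u e.v a b e.ins z z').pending ≤ d.pending + (2 + ∑ x,
      if centerOf (e.apply G) d.isC l (newPrio prio e z z') x ≠ centerOf G d.isC l prio x
      then 1 + 4 * deg G x else 0) := by
  have huv := he.1
  set d4 := ((((d.setKey e.u e.v (newKey n l e.ins z e.v)).recenter e.u).setKey e.v e.u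
    (newKey n l e.ins z' e.u)).recenter e.v) with hd4
  have hstruct : d.struct l e.u e.v a b e.ins z z' = d4.edge e.u e.v a b e.ins := rfl
  have hisC : d4.isC = d.isC := rfl
  have himg : d4.img = d.img := rfl
  have hkey : d4.key = keyOf (e.apply G) d.isC l (newPrio prio e z z') := by
    funext p q
    rw [keyOf_update he]
    change (if d.isC e.u then setPair (if d.isC e.v then setPair d.key e.u e.v
      (newKey n l e.ins z e.v) else d.key) e.v e.u (newKey n l e.ins z' e.u) else
        (if d.isC e.v then setPair d.key e.u e.v
      (newKey n l e.ins z e.v) else d.key)) p q = _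
    have h0 : ∀ x y : Fin n, d.isC y = false → keyOf G d.isC l prio x y = 0 := fun x y hy =>
      keyOf_neg (by simp [hy])
    rw [h.key]
    by_cases h1 : p = e.u ∧ q = e.v
    · obtain ⟨rfl, rfl⟩ := h1
      cases hcu : d.isC e.u <;> cases hcv : d.isC e.v <;> simp [setPair, huv, h0, hcv]
    · by_cases h2 : p = e.v ∧ q = e.u
      · obtain ⟨rfl, rfl⟩ := h2
        cases hcu : d.isC e.u <;> cases hcv : d.isC e.v <;>
          simp [setPair, huv.symm, h0, hcu]
      · cases hcu : d.isC e.u <;> cases hcv : d.isC e.v <;> simp [setPair, h1, h2]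
  have hrow : ∀ x, x ≠ e.u → x ≠ e.v → keyOf (e.apply G) d.isC l (newPrio prio e z z') x =
      keyOf G d.isC l prio x := by
    intro x h1 h2
    funext q
    rw [keyOf_update he, if_neg (by tauto), if_neg (by tauto)]
  -- The center of `e.u` is computed before the second key is written; this does no harm, as that
  -- key lies in the row of `e.v`.
  have hkeyu : (d.setKey e.u e.v (newKey n l e.ins z e.v)).key e.u = d4.key e.u := by
    change _ = (if d.isC e.u then setPair (d.setKey e.u e.v (newKey n l e.ins z e.v)).key e.v e.u
      (newKey n l e.ins z' e.u) else (d.setKey e.u e.v (newKey n l e.ins z e.v)).key) e.u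
    split_ifs
    · funext q; simp [setPair, huv]
    · rfl
  have hcen : ∀ x, d4.cen x = centerOf (e.apply G) d.isC l (newPrio prio e z z') x := by
    intro x
    change Function.update (Function.update d.cen e.u (cenWord (d.isC e.u)
      ((d.setKey e.u e.v (newKey n l e.ins z e.v)).key e.u) e.u)) e.v
      (cenWord (d.isC e.v) (d4.key e.v) e.v) x = _
    rw [hkeyu, hkey]
    by_cases hv : x = e.v
    · subst hv; simp [centerOf]
    · by_cases hu : x = e.u
      · subst hu; simp [centerOf, huv]
      · simp only [Function.update_of_ne hv, Function.update_of_ne hu]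
        rw [h.cen, centerOf, centerOf, hrow x hu hv]
  have hdirty : ∀ x, d4.dirty x = decide (d4.cen x ≠ 0 ∧ d4.cen x ≠ d4.img x) := by
    intro x
    by_cases hv : x = e.v
    · subst hv; simp [d4, Data.recenter]
    · by_cases hu : x = e.u
      · subst hu
        simp only [d4, Data.recenter, Data.setKey, Function.update_of_ne huv, Function.update_self]
        congr
      · have h1 : d4.dirty x = d.dirty x := by
          simp [d4, Data.recenter, Data.setKey, hv, hu]
        have h2 : d4.cen x = d.cen x := by
          simp [d4, Data.recenter, Data.setKey, hv, hu]
        rw [h1, h2, h.dirty, himg]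
  have hE4 : EdgeInv G d4 := h.edge.congr rfl rfl rfl rfl rfl
  obtain ⟨hE, hp⟩ := Data.edge_spec hE4 he (a := a) (b := b) ha hb
  rw [hstruct]
  refine ⟨⟨?_, ?_, ?_, hE⟩, by simp [hisC], ?_⟩
  · simp [hisC, hkey]
  · funext x; simp [hisC, hcen]
  · intro x; simpa using hdirty x
  · have := pending_le_of_dirty (d' := d4) h.edge rfl rfl
      (p := fun x => centerOf (e.apply G) d.isC l (newPrio prio e z z') x ≠
        centerOf G d.isC l prio x) (by
        intro x hx
        by_cases hp : centerOf (e.apply G) d.isC l (newPrio prio e z z') x ≠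
          centerOf G d.isC l prio x
        · exact .inr hp
        -- Images do not change here, so an unchanged center keeps its dirty flag.
        · left
          rw [not_not, ← hcen, ← h.cen] at hp
          rw [h.dirty, ← hx, hdirty, hp, himg])
    omega

end StarContraction

/-! ### Correctness of a whole update. -/

namespace StarContraction

variable {n w l : ℕ} {ω : Tape w} {s : State} {d : Data n} {G : SimpleGraph (Fin n)}

lemma randFree_workStep : workStep.randFree = true := rfl

/-- The work that an update creates: it is large only if the center of a vertex changes. -/
noncomputable def arrival (G G' : SimpleGraph (Fin n)) (isC : Fin n → Bool) (l : ℕ)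
    (prio prio' : Fin n → Fin n → ℕ) : ℕ :=
  2 + ∑ x, if centerOf G' isC l prio' x ≠ centerOf G isC l prio x then 1 + 4 * deg G x else 0

/-- The structural step adds at most `arrival` to the pending work, and each of the `l ^ 3 + 2`
background rounds removes a unit as long as there is one. The background work changes neither keys
nor centers, so the invariant for the new graph persists through the loop. -/
theorem update_spec {prio : Fin n → Fin n → ℕ} (hS : Sizes w n l) (h : Rep l d s)
    (hI : Inv G l prio d) {e : Update n} (he : e.Valid G) :
    ∃ d', Rep l d' (updateCmd.exec w ω (s.receive e)) ∧
      Inv (e.apply G) l (newPrio prio e (ω s.pos) (ω (s.pos + 1))) d' ∧ d'.isC = d.isC ∧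
      (updateCmd.exec w ω (s.receive e)).pos = s.pos + 2 ∧
      d'.pending ≤ d.pending + arrival G (e.apply G) d.isC l prio
        (newPrio prio e (ω s.pos) (ω (s.pos + 1))) - (l ^ 3 + 2) := by
  have hex : ∀ u : Fin n, ∃ a : Fin n, (∃ c, d.isC c = true) → d.img u = a + 1 := by
    intro u
    by_cases hc : ∃ c, d.isC c = true
    · obtain ⟨r, -, hr⟩ := hI.edge.img_other hc u
      exact ⟨r, fun _ => hr⟩
    · exact ⟨u, fun h => absurd h hc⟩
  obtain ⟨a, ha⟩ := hex e.u
  obtain ⟨b, hb⟩ := hex e.v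
  have hR0 : Rep l d (s.receive e) :=
    ((h.setReg (by decide) _).setReg (by decide) _).setReg (by decide) _
  have hpos0 : (s.receive e).pos = s.pos := rfl
  have hR1 := hR0.structStep (ω := ω) hS (u := e.u) (v := e.v) (a := a) (b := b) (ins := e.ins)
    he.1 (by simp [State.receive]) (by simp [State.receive]) (by simp [State.receive])
    (hI.key_lt hS) hI.center ha hb (hI.edge.wt_le hS.two_le)
  rw [hpos0] at hR1
  obtain ⟨hI1, hC1, hp1⟩ := hI.struct he ha hb (z := ω s.pos) (z' := ω (s.pos + 1))
  rw [updateCmd, exec_seq]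
  have hpos1 : (structStep.exec w ω (s.receive e)).pos = s.pos + 2 := by
    rw [structStep_pos, hpos0]
  have key := exec_loop_induct (w := w) (ω := ω) (x := 9) (k := l ^ 3 + 2) (c := workStep)
    (s := structStep.exec w ω (s.receive e))
    (fun j s' => ∃ d', Rep l d' s' ∧
      Inv (e.apply G) l (newPrio prio e (ω s.pos) (ω (s.pos + 1))) d' ∧ d'.isC = d.isC ∧
      s'.pos = s.pos + 2 ∧ d'.pending ≤ d.pending + arrival G (e.apply G) d.isC l prio
        (newPrio prio e (ω s.pos) (ω (s.pos + 1))) - j)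
    hR1.r9 ⟨_, hR1.tick _, hI1, hC1, hpos1, hp1⟩ (by
      rintro j - s' ⟨d', hR, hI', hC', hp', hq'⟩
      obtain ⟨d'', hwork, hR''⟩ := workStep_spec (ω := ω) hS (hR.tick 1)
        (hI'.edge.wt_le hS.two_le) (fun u v huv => by
          have hc := hI'.edge.exists_center huv
          obtain ⟨r, -, hr⟩ := hI'.edge.img_other hc u
          obtain ⟨r', -, hr'⟩ := hI'.edge.img_other hc v
          exact ⟨⟨r, hr⟩, ⟨r', hr'⟩⟩)
      obtain ⟨h1, h2, h3, h4, h5, h6⟩ := hwork.spec hI'.edge hI'.cenInv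
      refine ⟨d'', hR'', ⟨by rw [h4, hI'.key, h3], by rw [h5, hI'.cen, h3], h2.dirty, h1⟩,
        h3.trans hC', ?_, by omega⟩
      rw [exec_pos_of_randFree randFree_workStep]
      exact hp')
  exact key

/-! ### The preprocessing program -/

/-- Computes `l = ⌈log₂ n⌉` and `2 ^ l`. -/
def initSize : Cmd :=
  .assign 6 (.const 1) ;;
  .loop (.reg 0)
    (.ite (.bin .lt (.reg 6) (.reg 0))
      (.assign 6 (.bin .mul (.const 2) (.reg 6)) ;; .assign 5 (.bin .add (.reg 5) (.const 1)))
      .skip)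

/-- Computes the constants that are kept in registers. -/
def initConst : Cmd :=
  .assign 7 (.bin .mul (.const 2) (.reg 6)) ;;
  .assign 11 (.bin .mul (.reg 6) (.reg 6)) ;;
  .assign 8 (.bin .mul (.bin .mul (.reg 11) (.reg 11)) (.reg 6)) ;;
  .assign 9 (.bin .add (.bin .mul (.bin .mul (.reg 5) (.reg 5)) (.reg 5)) (.const 2)) ;;
  .assign 10 (.bin .mul (.const 2) (.reg 5)) ;;
  .assign 13 (.bin .mul (.bin .mul (.reg 8) (.reg 11)) (.reg 6)) ;;
  .assign 14 (.bin .mul (.const 8) (.reg 5)) ;;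
  .assign 19 (.bin .sub (.reg 0) (.const 1))

/-- Adds the terms of the series `-log (1 - 1 / k) = ∑ 1 / (j k ^ j)`, where `k` is `reg 16`. -/
def initTerm : Cmd :=
  .loop (.reg 14)
    (.assign 17 (.bin .div (.reg 17) (.reg 16)) ;;
     .assign 18 (.bin .add (.reg 18) (.const 1)) ;;
     .assign 15 (.bin .add (.reg 15) (.bin .div (.reg 17) (.reg 18))))

/-- Computes an approximation of `log n = -∑ log (1 - 1 / k)`, scaled by `reg 13`. -/
def initLog : Cmd :=
  .assign 15 (.const 0) ;; .assign 16 (.const 1) ;;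
  .loop (.reg 19)
    (.assign 16 (.bin .add (.reg 16) (.const 1)) ;;
     .assign 17 (.reg 13) ;;
     .assign 18 (.const 0) ;;
     initTerm)

/-- Samples the centers. -/
def initCoin : Cmd :=
  .assign 17 (.bin .mul (.const 800) (.bin .mul (.reg 8) (.reg 15))) ;;
  .assign 18 (.bin .mul (.reg 13) (.reg 1)) ;;
  .assign 20 (.const 0) ;;
  .loop (.reg 0)
    (.rand 21 ;;
     .ite (.bin .lt (.reg 17) (.bin .mul (.bin .add (.bin .mod (.reg 21) (.reg 8)) (.const 1))
        (.reg 18)))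
      .skip
      (.store 7 (.reg 20) (.const 1) ;;
       .store 0 (.reg 20) (.bin .add (.reg 20) (.const 1)) ;;
       .assign 12 (.bin .add (.reg 20) (.const 1))) ;;
     .assign 20 (.bin .add (.reg 20) (.const 1)))

/-- Initializes the images. -/
def initImg : Cmd :=
  .assign 20 (.const 0) ;;
  .loop (.reg 0)
    (.ite (.get 7 (.reg 20))
      (.store 1 (.reg 20) (.bin .add (.reg 20) (.const 1)))
      (.store 1 (.reg 20) (.reg 12)) ;;
     .assign 20 (.bin .add (.reg 20) (.const 1)))

/-- The preprocessing program. -/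
def initCmd : Cmd := initSize ;; initConst ;; initLog ;; initCoin ;; initImg

/-- The dynamic algorithm. -/
def starAlg : DynAlg where
  K := 60
  init := initCmd
  update := updateCmd

/-- The approximation from below of `log n`, scaled by `(2 ^ l) ^ 8`. -/
def logSum (n l : ℕ) : ℕ :=
  ∑ k ∈ Finset.Ico 2 (n + 1), ∑ j ∈ Finset.Ico 1 (8 * l + 1), (2 ^ l) ^ 8 / k ^ j / j

/-- The test whether a vertex with the random word `x` becomes a center. -/
def coin (n τ l x : ℕ) : Bool :=
  decide ((x % (2 ^ l) ^ 5 + 1) * ((2 ^ l) ^ 8 * τ) ≤ 800 * ((2 ^ l) ^ 5 * logSum n l))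

/-- The register doubles while it is below `n`, that is, while fewer than `⌈log₂ n⌉` rounds are
done. Since `⌈log₂ n⌉ ≤ n`, a loop of `n` rounds is long enough. -/
lemma initSize_spec (hS : Sizes w n (Nat.clog 2 n)) (h0 : s.reg 0 = n) (h5 : s.reg 5 = 0) :
    (initSize.exec w ω s).reg 5 = Nat.clog 2 n ∧
    (initSize.exec w ω s).reg 6 = 2 ^ Nat.clog 2 n := by
  set L := Nat.clog 2 n with hL
  have hW := hS.pow_lt (k := 2) (by norm_num)
  have h2 := hS.two_le_pow
  have hs1 := hS.small (k := 1) (by norm_num)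
  have hs2 := hS.small (k := 2) (by norm_num)
  have hw : w ≠ 0 := by rintro rfl; simp at hs1
  have hnn : L ≤ n := by
    rw [hL, Nat.clog_le_iff_le_pow (by norm_num)]
    exact Nat.lt_two_pow_self.le
  have hLS : L < 2 ^ L := Nat.lt_two_pow_self
  rw [initSize, exec_seq, exec_assign (by simp [Expr.Fits, hw])]
  have key := exec_loop_induct (w := w) (ω := ω) (x := 0) (k := n)
    (c := .ite (.bin .lt (.reg 6) (.reg 0))
      (.assign 6 (.bin .mul (.const 2) (.reg 6)) ;; .assign 5 (.bin .add (.reg 5) (.const 1)))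
      .skip)
    (s := (s.setReg 6 (Expr.val s (.const 1))).tick ((Expr.const 1).cost + 1))
    (fun j s' => s'.reg 0 = n ∧ s'.reg 5 = min j L ∧ s'.reg 6 = 2 ^ (min j L))
    (by simp [h0]) (by simp [h0, h5, Expr.val]) (by
      rintro j - s' ⟨g0, g5, g6⟩
      have hlt : 2 ^ (min j L) < n ↔ j < L := by
        rw [← Nat.lt_clog_iff_pow_lt (by norm_num)]
        omega
      rw [exec_ite (by simp [Expr.Fits, Op.Fits, hw])]
      simp only [Expr.val, State.tick_reg, Op.eval_lt, g6, g0, hlt]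
      by_cases hj : j < L
      · have e1 : min j L = j := by omega
        have e2 : min (j + 1) L = j + 1 := by omega
        have h3 : 2 ^ (j + 1) ≤ 2 ^ L := Nat.pow_le_pow_right (by norm_num) hj
        have h4 : 2 ^ L ≤ (2 ^ L) ^ 2 := by nlinarith
        rw [pow_succ] at h3
        rw [e1] at g5 g6
        rw [e2, if_pos hj, if_pos one_ne_zero, exec_seq, exec_assign (x := 6) (by
            simp [Expr.Fits, Expr.val, Op.Fits, g6]; omega),
          exec_assign (by simp [Expr.Fits, Expr.val, Op.Fits, g5, hw]; omega)]
        simp [Expr.val, g0, g5, g6]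
        ring
      · have e1 : min j L = L := by omega
        have e2 : min (j + 1) L = L := by omega
        rw [e1] at g5 g6
        rw [e2, if_neg hj, if_neg (by simp)]
        exact ⟨g0, g5, g6⟩)
  obtain ⟨-, g5, g6⟩ := key
  rw [min_eq_right hnn] at g5 g6
  exact ⟨g5, g6⟩

lemma initConst_spec (hS : Sizes w n l) (h0 : s.reg 0 = n) (h5 : s.reg 5 = l)
    (h6 : s.reg 6 = 2 ^ l) :
    (initConst.exec w ω s).reg 7 = 2 * 2 ^ l ∧ (initConst.exec w ω s).reg 8 = (2 ^ l) ^ 5 ∧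
    (initConst.exec w ω s).reg 9 = l ^ 3 + 2 ∧ (initConst.exec w ω s).reg 10 = 2 * l ∧
    (initConst.exec w ω s).reg 11 = 2 ^ (2 * l) ∧
    (initConst.exec w ω s).reg 13 = (2 ^ l) ^ 8 ∧ (initConst.exec w ω s).reg 14 = 8 * l ∧
    (initConst.exec w ω s).reg 19 = n - 1 := by
  have h2 := hS.two_le_pow
  have hs1 := hS.small (k := 1) (by norm_num)
  have hs2 := hS.small (k := 2) (by norm_num)
  have hs8 := hS.small (k := 8) (by norm_num)
  have hw : w ≠ 0 := by rintro rfl; simp at hs1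
  have hlS : l < 2 ^ l := Nat.lt_two_pow_self
  have hn := hS.le
  have hp1 := hS.pow_lt (k := 1) (by norm_num)
  have hp2 := hS.pow_lt (k := 2) (by norm_num)
  have hp3 := hS.pow_lt (k := 3) (by norm_num)
  have hp4 := hS.pow_lt (k := 4) (by norm_num)
  have hp5 := hS.pow_lt (k := 5) (by norm_num)
  have hp7 := hS.pow_lt (k := 7) (by norm_num)
  have hp8 := hS.pow_lt (k := 8) (by norm_num)
  have e2l : 2 ^ (2 * l) = 2 ^ l * 2 ^ l := by ring
  rw [e2l]
  have hS2 : 2 ^ l * 2 ^ l = (2 ^ l) ^ 2 := by ring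
  have hS4 : 2 ^ l * 2 ^ l * (2 ^ l * 2 ^ l) = (2 ^ l) ^ 4 := by ring
  have hS5 : 2 ^ l * 2 ^ l * (2 ^ l * 2 ^ l) * 2 ^ l = (2 ^ l) ^ 5 := by ring
  have hS7 : 2 ^ l * 2 ^ l * (2 ^ l * 2 ^ l) * 2 ^ l * (2 ^ l * 2 ^ l) = (2 ^ l) ^ 7 := by ring
  have hS8 : 2 ^ l * 2 ^ l * (2 ^ l * 2 ^ l) * 2 ^ l * (2 ^ l * 2 ^ l) * 2 ^ l = (2 ^ l) ^ 8 := by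
    ring
  have hl1 := hS.pos
  have hSS : 2 * 2 ^ l ≤ (2 ^ l) ^ 2 := by nlinarith
  have hl2 : l * l < (2 ^ l) ^ 2 := by rw [← hS2]; exact Nat.mul_lt_mul'' hlS hlS
  have hl3 : l * l * l < (2 ^ l) ^ 3 := by
    rw [pow_succ _ 2]; exact Nat.mul_lt_mul'' hl2 hlS
  have h8 : 2 ^ 3 ≤ (2 ^ l) ^ 3 := Nat.pow_le_pow_left h2 3
  have hS34 : (2 ^ l) ^ 3 * 2 ≤ (2 ^ l) ^ 4 := by
    rw [pow_succ _ 3]; exact Nat.mul_le_mul_left _ h2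
  have hl8 : 8 * l ≤ (2 ^ l) ^ 4 := by
    rw [pow_succ _ 3]; exact Nat.mul_le_mul h8 hlS.le
  rw [initConst, exec_seq, exec_assign (by simp [Expr.Fits, Expr.val, Op.Fits, h6]; omega),
    exec_seq, exec_assign (by simp [Expr.Fits, Expr.val, Op.Fits, h6]; omega),
    exec_seq, exec_assign (by simp [Expr.Fits, Expr.val, Op.Fits, h6]; omega),
    exec_seq, exec_assign (by simp [Expr.Fits, Expr.val, Op.Fits, h5]; omega),
    exec_seq, exec_assign (by simp [Expr.Fits, Expr.val, Op.Fits, h5]; omega),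
    exec_seq, exec_assign (by simp [Expr.Fits, Expr.val, Op.Fits, h6]; omega),
    exec_seq, exec_assign (x := 14) (by simp [Expr.Fits, Expr.val, Op.Fits, h5]; omega),
    exec_assign (by simp [Expr.Fits, Expr.val, Op.Fits, h0, hw]; omega)]
  simp only [Expr.val, State.tick_reg, State.setReg_reg, h0, h5, h6, Op.eval_mul, Op.eval_add,
    Op.eval_sub]
  norm_num
  refine ⟨hS5, by ring, hS8⟩

end StarContraction

/-! ### Correctness of the preprocessing. -/

namespace StarContraction

variable {n w l : ℕ} {ω : Tape w} {s : State}

/-- Repeated integer division by `k` gives `B / k ^ j` exactly, so the powers of `k`, which need not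
fit into a word, are never formed. -/
lemma initTerm_spec {k B J acc : ℕ} (h14 : s.reg 14 = J) (h15 : s.reg 15 = acc)
    (h16 : s.reg 16 = k) (h17 : s.reg 17 = B) (h18 : s.reg 18 = 0)
    (hW : acc + J * B < 2 ^ w) (hB : B < 2 ^ w) (hJ : J + 1 < 2 ^ w) :
    (initTerm.exec w ω s).reg 15 = acc + ∑ j ∈ Finset.Ico 1 (J + 1), B / k ^ j / j := by
  have hw : w ≠ 0 := by rintro rfl; simp at hJ
  have key := exec_loop_induct (w := w) (ω := ω) (x := 14) (k := J)
    (c := .assign 17 (.bin .div (.reg 17) (.reg 16)) ;;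
     .assign 18 (.bin .add (.reg 18) (.const 1)) ;;
     .assign 15 (.bin .add (.reg 15) (.bin .div (.reg 17) (.reg 18))))
    (s := s)
    (fun j s' => s'.reg 16 = k ∧ s'.reg 17 = B / k ^ j ∧ s'.reg 18 = j ∧
      s'.reg 15 = acc + ∑ j ∈ Finset.Ico 1 (j + 1), B / k ^ j / j) h14
    (by simp [h15, h16, h17, h18]) (by
      rintro j hj s' ⟨g16, g17, g18, g15⟩
      have hdiv : B / k ^ j / k = B / k ^ (j + 1) := by
        rw [Nat.div_div_eq_div_mul, pow_succ]
      have hle : B / k ^ j ≤ B := Nat.div_le_self _ _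
      have hle' : B / k ^ (j + 1) ≤ B := Nat.div_le_self _ _
      have hle2 : B / k ^ (j + 1) / (j + 1) ≤ B := (Nat.div_le_self _ _).trans hle'
      have hsum : ∑ j ∈ Finset.Ico 1 (j + 1), B / k ^ j / j ≤ j * B := by
        calc _ ≤ ∑ j ∈ Finset.Ico 1 (j + 1), B :=
              Finset.sum_le_sum fun _ _ => (Nat.div_le_self _ _).trans (Nat.div_le_self _ _)
          _ = j * B := by simp
      have hJB : (j + 1) * B ≤ J * B := Nat.mul_le_mul_right _ hj
      rw [add_mul, one_mul] at hJB
      rw [exec_seq, exec_assign (x := 17) (by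
          simp [Expr.Fits, Expr.val, Op.Fits, g17]; omega),
        exec_seq, exec_assign (x := 18) (by
          simp [Expr.Fits, Expr.val, Op.Fits, g18, hw]; omega),
        exec_assign (by
          simp [Expr.Fits, Expr.val, Op.Fits, g18, g17, g16, g15, hdiv]; omega)]
      refine ⟨by simp [g16], by simp [Expr.val, g17, g16, hdiv], by simp [Expr.val, g18], ?_⟩
      rw [Finset.sum_Ico_succ_top (by omega)]
      simp [Expr.val, g17, g16, g18, g15, hdiv, add_assoc])
  exact key.2.2.2

lemma initTerm_regs {z : ℕ} (hz : z ≠ 15 ∧ z ≠ 17 ∧ z ≠ 18) (s : State) :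
    (initTerm.exec w ω s).reg z = s.reg z :=
  exec_reg_of_notMem (by simp [initTerm, Cmd.regs]; omega) s

lemma initLog_spec (hS : Sizes w n l) (h13 : s.reg 13 = (2 ^ l) ^ 8) (h14 : s.reg 14 = 8 * l)
    (h19 : s.reg 19 = n - 1) : (initLog.exec w ω s).reg 15 = logSum n l := by
  have h2 := hS.two_le_pow
  have hs0 := hS.small (k := 0) (by norm_num)
  have hs1 := hS.small (k := 1) (by norm_num)
  have hw : w ≠ 0 := by rintro rfl; simp at hs1
  have hlS : l < 2 ^ l := Nat.lt_two_pow_self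
  have hn := hS.le
  have h8 : 2 ^ 3 ≤ (2 ^ l) ^ 3 := Nat.pow_le_pow_left h2 3
  have hl8 : 8 * l ≤ (2 ^ l) ^ 4 := by
    rw [pow_succ _ 3]; exact Nat.mul_le_mul h8 hlS.le
  have hp5 := hS.pow_lt (k := 5) (by norm_num)
  have hp45 : (2 ^ l) ^ 4 * 2 ≤ (2 ^ l) ^ 5 := by
    rw [pow_succ _ 4]; exact Nat.mul_le_mul_left _ h2
  have hp4 : 1 ≤ (2 ^ l) ^ 4 := Nat.one_le_pow _ _ (by omega)
  have hp8 := hS.pow_lt (k := 8) (by norm_num)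
  have hp13 := hS.pow_lt (k := 13) (by norm_num)
  have hJB : n * (8 * l * (2 ^ l) ^ 8) ≤ (2 ^ l) ^ 13 := by
    calc n * (8 * l * (2 ^ l) ^ 8) ≤ 2 ^ l * ((2 ^ l) ^ 4 * (2 ^ l) ^ 8) :=
          Nat.mul_le_mul hn (Nat.mul_le_mul_right _ hl8)
      _ = (2 ^ l) ^ 13 := by ring
  have hp1 := hS.pow_lt (k := 1) (by norm_num)
  rw [pow_one] at hp1
  rw [initLog, exec_seq, exec_assign (by exact hs0), exec_seq, exec_assign (by exact hs1)]
  have h2n := hS.two_le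
  have key := exec_loop_induct (w := w) (ω := ω) (x := 19) (k := n - 1)
    (c := .assign 16 (.bin .add (.reg 16) (.const 1)) ;;
     .assign 17 (.reg 13) ;;
     .assign 18 (.const 0) ;;
     initTerm)
    (s := (((s.setReg 15 (Expr.val s (.const 0))).tick ((Expr.const 0).cost + 1)).setReg 16
      (Expr.val ((s.setReg 15 (Expr.val s (.const 0))).tick ((Expr.const 0).cost + 1))
      (.const 1))).tick ((Expr.const 1).cost + 1))
    (fun i s' => s'.reg 13 = (2 ^ l) ^ 8 ∧ s'.reg 14 = 8 * l ∧ s'.reg 16 = i + 1 ∧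
      s'.reg 15 = ∑ k ∈ Finset.Ico 2 (i + 2), ∑ j ∈ Finset.Ico 1 (8 * l + 1),
        (2 ^ l) ^ 8 / k ^ j / j)
    (by simp [h19]) (by simp [h13, h14, Expr.val]) (by
      rintro i hi s' ⟨g13, g14, g16, g15⟩
      have hsum : ∑ k ∈ Finset.Ico 2 (i + 2), ∑ j ∈ Finset.Ico 1 (8 * l + 1),
        (2 ^ l) ^ 8 / k ^ j / j ≤ i * (8 * l * (2 ^ l) ^ 8) := by
        calc _ ≤ ∑ k ∈ Finset.Ico 2 (i + 2), ∑ j ∈ Finset.Ico 1 (8 * l + 1), (2 ^ l) ^ 8 :=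
              Finset.sum_le_sum fun _ _ => Finset.sum_le_sum fun _ _ =>
                (Nat.div_le_self _ _).trans (Nat.div_le_self _ _)
          _ = i * (8 * l * (2 ^ l) ^ 8) := by simp
      have hin : (i + 1) * (8 * l * (2 ^ l) ^ 8) ≤ n * (8 * l * (2 ^ l) ^ 8) :=
        Nat.mul_le_mul_right _ (by omega)
      rw [add_mul, one_mul] at hin
      rw [exec_seq, exec_assign (by simp [Expr.Fits, Expr.val, Op.Fits, g16, hw]; omega),
        exec_seq, exec_assign (by simp [Expr.Fits]), exec_seq, exec_assign (by exact hs0)]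
      refine ⟨by rw [initTerm_regs (by omega)]; simp [g13],
        by rw [initTerm_regs (by omega)]; simp [g14],
        by rw [initTerm_regs (by omega)]; simp [Expr.val, g16], ?_⟩
      rw [initTerm_spec (k := i + 2) (B := (2 ^ l) ^ 8) (J := 8 * l) (acc :=
        ∑ k ∈ Finset.Ico 2 (i + 2), ∑ j ∈ Finset.Ico 1 (8 * l + 1), (2 ^ l) ^ 8 / k ^ j / j)
        (by simp [g14]) (by simp [g15]) (by simp [Expr.val, g16]) (by simp [Expr.val, g13])
        (by simp [Expr.val]) (by omega) hp8 (by omega)]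
      rw [show i + 1 + 2 = i + 2 + 1 by ring, Finset.sum_Ico_succ_top (by omega : 2 ≤ i + 2)])
  rw [logSum, show n + 1 = n - 1 + 2 by omega]
  exact key.2.2.2

lemma logSum_le (hS : Sizes w n l) : logSum n l ≤ (2 ^ l) ^ 13 := by
  have h2 := hS.two_le_pow
  have hlS : l < 2 ^ l := Nat.lt_two_pow_self
  have h8 : 2 ^ 3 ≤ (2 ^ l) ^ 3 := Nat.pow_le_pow_left h2 3
  have hl8 : 8 * l ≤ (2 ^ l) ^ 4 := by
    rw [pow_succ _ 3]; exact Nat.mul_le_mul h8 hlS.le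
  have hn := hS.le
  calc logSum n l ≤ ∑ k ∈ Finset.Ico 2 (n + 1), ∑ j ∈ Finset.Ico 1 (8 * l + 1), (2 ^ l) ^ 8 :=
        Finset.sum_le_sum fun _ _ => Finset.sum_le_sum fun _ _ =>
          (Nat.div_le_self _ _).trans (Nat.div_le_self _ _)
    _ = (n - 1) * (8 * l * (2 ^ l) ^ 8) := by simp
    _ ≤ 2 ^ l * ((2 ^ l) ^ 4 * (2 ^ l) ^ 8) :=
        Nat.mul_le_mul (by omega) (Nat.mul_le_mul_right _ hl8)
    _ = (2 ^ l) ^ 13 := by ring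

/-- The fraction with denominator `τ` is cleared, so the test compares two integers; `hτ` makes the
left one fit. Register `12` retains one center, if any, as a default image. -/
lemma initCoin_spec {τ : ℕ} (hS : Sizes w n l) (hτ : (2 ^ l) ^ 20 * τ < 2 ^ w)
    (h0 : s.reg 0 = n) (h1 : s.reg 1 = τ) (h8 : s.reg 8 = (2 ^ l) ^ 5) (h12 : s.reg 12 = 0)
    (h13 : s.reg 13 = (2 ^ l) ^ 8) (h15 : s.reg 15 = logSum n l)
    (hm0 : ∀ i, s.mem 0 i = 0) (hm7 : ∀ i, s.mem 7 i = 0) (hpos : s.pos = 0) :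
    (initCoin.exec w ω s).pos = n ∧
    (∀ v < n, (initCoin.exec w ω s).mem 0 v = if coin n τ l (ω v) then v + 1 else 0) ∧
    (∀ v < n, (initCoin.exec w ω s).mem 7 v = if coin n τ l (ω v) then 1 else 0) ∧
    ((initCoin.exec w ω s).reg 12 = 0 → ∀ v < n, coin n τ l (ω v) = false) ∧
    ((initCoin.exec w ω s).reg 12 ≠ 0 → ∃ v < n, coin n τ l (ω v) = true ∧
      (initCoin.exec w ω s).reg 12 = v + 1) := by
  have hs0 := hS.small (k := 0) (by norm_num)
  have hs1 := hS.small (k := 1) (by norm_num)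
  have hs800 := hS.small (k := 800) (by norm_num)
  have hw : w ≠ 0 := by rintro rfl; simp at hs1
  have h2 := hS.two_le_pow
  have hlog := logSum_le hS
  have hsq := hS.sq
  have hn1 : n + 1 < 2 ^ w := by have := hS.two_le; nlinarith
  have hML : (2 ^ l) ^ 5 * logSum n l ≤ (2 ^ l) ^ 18 := by
    calc _ ≤ (2 ^ l) ^ 5 * (2 ^ l) ^ 13 := Nat.mul_le_mul_left _ hlog
      _ = (2 ^ l) ^ 18 := by ring
  have h800 : 800 * ((2 ^ l) ^ 5 * logSum n l) ≤ (2 ^ l) ^ 28 := by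
    calc _ ≤ (2 ^ l) ^ 10 * (2 ^ l) ^ 18 := Nat.mul_le_mul
          ((by norm_num : 800 ≤ 2 ^ 10).trans (Nat.pow_le_pow_left h2 10)) hML
      _ = (2 ^ l) ^ 28 := by ring
  have hp18 := hS.pow_lt (k := 18) (by norm_num)
  have hp28 := hS.pow_lt (k := 28) (by norm_num)
  have hp5 := hS.pow_lt (k := 5) (by norm_num)
  have hBτ : (2 ^ l) ^ 8 * τ < 2 ^ w := lt_of_le_of_lt
    (Nat.mul_le_mul_right _ (Nat.pow_le_pow_right (by omega) (by norm_num))) hτ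
  rw [initCoin, exec_seq, exec_assign (by
      simp [Expr.Fits, Expr.val, Op.Fits, h8, h15]; omega),
    exec_seq, exec_assign (by simp [Expr.Fits, Expr.val, Op.Fits, h13, h1]; omega),
    exec_seq, exec_assign (by exact hs0)]
  have key := exec_loop_induct (w := w) (ω := ω) (x := 0) (k := n)
    (c := .rand 21 ;;
     .ite (.bin .lt (.reg 17) (.bin .mul (.bin .add (.bin .mod (.reg 21) (.reg 8)) (.const 1))
        (.reg 18)))
      .skip
      (.store 7 (.reg 20) (.const 1) ;;
       .store 0 (.reg 20) (.bin .add (.reg 20) (.const 1)) ;;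
       .assign 12 (.bin .add (.reg 20) (.const 1))) ;;
     .assign 20 (.bin .add (.reg 20) (.const 1)))
    (s := Cmd.exec w ω (.assign 20 (.const 0)) (Cmd.exec w ω (.assign 18 (.bin .mul (.reg 13)
      (.reg 1))) (Cmd.exec w ω (.assign 17 (.bin .mul (.const 800) (.bin .mul (.reg 8)
      (.reg 15)))) s)))
    (fun i s' => s'.reg 8 = (2 ^ l) ^ 5 ∧ s'.reg 17 = 800 * ((2 ^ l) ^ 5 * logSum n l) ∧
      s'.reg 18 = (2 ^ l) ^ 8 * τ ∧ s'.reg 20 = i ∧ s'.pos = i ∧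
      (∀ v, s'.mem 0 v = if v < i ∧ coin n τ l (ω v) then v + 1 else 0) ∧
      (∀ v, s'.mem 7 v = if v < i ∧ coin n τ l (ω v) then 1 else 0) ∧
      (s'.reg 12 = 0 → ∀ v < i, coin n τ l (ω v) = false) ∧
      (s'.reg 12 ≠ 0 → ∃ v < i, coin n τ l (ω v) = true ∧ s'.reg 12 = v + 1)) ?_ ?_ ?_
  · rw [exec_assign (x := 17) (by simp [Expr.Fits, Expr.val, Op.Fits, h8, h15]; omega),
      exec_assign (x := 18) (by simp [Expr.Fits, Expr.val, Op.Fits, h13, h1]; omega),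
      exec_assign (by exact hs0)] at key
    obtain ⟨-, -, -, -, g1, g2, g3, g4, g5⟩ := key
    refine ⟨g1, fun v hv => ?_, fun v hv => ?_, g4, g5⟩
    · rw [g2]; simp [hv]
    · rw [g3]; simp [hv]
  · rw [exec_assign (x := 17) (by simp [Expr.Fits, Expr.val, Op.Fits, h8, h15]; omega),
      exec_assign (x := 18) (by simp [Expr.Fits, Expr.val, Op.Fits, h13, h1]; omega),
      exec_assign (by exact hs0)]
    simp [h0]
  · rw [exec_assign (x := 17) (by simp [Expr.Fits, Expr.val, Op.Fits, h8, h15]; omega),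
      exec_assign (x := 18) (by simp [Expr.Fits, Expr.val, Op.Fits, h13, h1]; omega),
      exec_assign (by exact hs0)]
    simp [Expr.val, h8, h13, h1, h15, h12, hm0, hm7, hpos]
  · rintro i hi s' ⟨g8, g17, g18, g20, gp, gm0, gm7, g12, g12'⟩
    have hx : (ω i : ℕ) % (2 ^ l) ^ 5 < (2 ^ l) ^ 5 := Nat.mod_lt _ (by positivity)
    have hxτ : ((ω i : ℕ) % (2 ^ l) ^ 5 + 1) * ((2 ^ l) ^ 8 * τ) < 2 ^ w := by
      refine lt_of_le_of_lt ?_ hτ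
      calc _ ≤ (2 ^ l) ^ 5 * ((2 ^ l) ^ 8 * τ) := Nat.mul_le_mul_right _ hx
        _ = (2 ^ l) ^ 13 * τ := by ring
        _ ≤ _ := Nat.mul_le_mul_right _ (Nat.pow_le_pow_right (by omega) (by norm_num))
    rw [exec_seq, exec_rand, exec_seq]
    simp only [State.tick_pos, gp]
    rw [exec_ite (by
      simp only [Expr.Fits, Op.Fits, Expr.val, State.tick_reg, State.nextWord_reg,
        State.setReg_reg, g8, g18, if_true, Op.eval_add, Op.eval_mod, true_and]
      simp only [show (8 : ℕ) ≠ 21 by decide, show (18 : ℕ) ≠ 21 by decide, if_false]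
      exact ⟨⟨⟨(ω i).2, hs1, by omega⟩, hxτ⟩, hs1⟩)]
    have hval : ∀ k, Expr.val ((((s'.tick 1).setReg 21 (ω i)).nextWord).tick k)
        (.bin .lt (.reg 17) (.bin .mul (.bin .add (.bin .mod (.reg 21) (.reg 8)) (.const 1))
        (.reg 18))) = if coin n τ l (ω i) then 0 else 1 := by
      intro k
      simp only [Expr.val, State.tick_reg, State.nextWord_reg, State.setReg_reg, if_true,
        show (8 : ℕ) ≠ 21 by decide, show (18 : ℕ) ≠ 21 by decide, show (17 : ℕ) ≠ 21 by decide,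
        if_false, g8, g18, g17, Op.eval_lt, Op.eval_mul, Op.eval_add, Op.eval_mod, coin]
      by_cases hc : ((ω i : ℕ) % (2 ^ l) ^ 5 + 1) * ((2 ^ l) ^ 8 * τ) ≤
        800 * ((2 ^ l) ^ 5 * logSum n l)
      · simp [hc]
      · simp [hc, not_le.1 hc]
    rw [hval]
    cases hc : coin n τ l (ω i)
    · simp only [Bool.false_eq_true, if_false, ne_eq, one_ne_zero, not_false_eq_true, if_true]
      rw [exec_skip, exec_assign (by
        simp [Expr.Fits, Expr.val, Op.Fits, g20, hw]; omega)]
      have hlt : ∀ v, (v < i + 1 ∧ coin n τ l (ω v) = true) ↔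
          (v < i ∧ coin n τ l (ω v) = true) := by
        intro v
        constructor
        · rintro ⟨h1, h2⟩
          refine ⟨?_, h2⟩
          rcases Nat.lt_succ_iff_lt_or_eq.1 h1 with h | rfl
          · exact h
          · simp [hc] at h2
        · rintro ⟨h1, h2⟩
          exact ⟨by omega, h2⟩
      refine ⟨by simp [g8], by simp [g17], by simp [g18], by simp [Expr.val, g20], by simp [gp],
        fun v => ?_, fun v => ?_, fun h v hv => ?_, fun h => ?_⟩
      · simp only [hlt]; simp [gm0]
      · simp only [hlt]; simp [gm7]
      · rcases Nat.lt_succ_iff_lt_or_eq.1 hv with h' | rfl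
        · exact g12 (by simpa using h) v h'
        · exact hc
      · obtain ⟨v, hv, h1, h2⟩ := g12' (by simpa using h)
        exact ⟨v, by omega, h1, by simpa using h2⟩
    · simp only [if_true, ne_eq, not_true, if_false]
      rw [exec_seq, exec_store (a := 7) (by simp [Expr.Fits]) (by exact hs1), exec_seq,
        exec_store (a := 0) (by simp [Expr.Fits]) (by
          simp [Expr.Fits, Expr.val, Op.Fits, g20, hw]; omega),
        exec_assign (x := 12) (by simp [Expr.Fits, Expr.val, Op.Fits, g20, hw]; omega),
        exec_assign (x := 20) (by simp [Expr.Fits, Expr.val, Op.Fits, g20, hw]; omega)]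
      refine ⟨by simp [g8], by simp [g17], by simp [g18], by simp [Expr.val, g20], by simp [gp],
        fun v => ?_, fun v => ?_, fun h v hv => ?_, fun h => ?_⟩
      · by_cases hv : v = i
        · subst hv; simp [Expr.val, g20, hc]
        · simp [Expr.val, g20, gm0, hv, show v < i + 1 ↔ v < i by omega]
      · by_cases hv : v = i
        · subst hv; simp [Expr.val, g20, hc]
        · simp [Expr.val, g20, gm7, hv, show v < i + 1 ↔ v < i by omega]
      · simp [Expr.val] at h
      · exact ⟨i, by omega, hc, by simp [Expr.val, g20]⟩

lemma initImg_spec (hS : Sizes w n l) (h0 : s.reg 0 = n) :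
    ∀ v < n, (initImg.exec w ω s).mem 1 v = if s.mem 7 v ≠ 0 then v + 1 else s.reg 12 := by
  have hs0 := hS.small (k := 0) (by norm_num)
  have hs1 := hS.small (k := 1) (by norm_num)
  have hw : w ≠ 0 := by rintro rfl; simp at hs1
  have hsq := hS.sq
  have hn1 : n + 1 < 2 ^ w := by have := hS.two_le; nlinarith
  rw [initImg, exec_seq, exec_assign (by exact hs0)]
  have key := exec_loop_induct (w := w) (ω := ω) (x := 0) (k := n)
    (c := .ite (.get 7 (.reg 20))
      (.store 1 (.reg 20) (.bin .add (.reg 20) (.const 1)))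
      (.store 1 (.reg 20) (.reg 12)) ;;
     .assign 20 (.bin .add (.reg 20) (.const 1)))
    (s := (s.setReg 20 (Expr.val s (.const 0))).tick ((Expr.const 0).cost + 1))
    (fun i s' => s'.reg 12 = s.reg 12 ∧ s'.reg 20 = i ∧ s'.mem 7 = s.mem 7 ∧
      ∀ v < i, s'.mem 1 v = if s.mem 7 v ≠ 0 then v + 1 else s.reg 12) (by simp [h0])
    (by simp [Expr.val]) (by
      rintro i hi s' ⟨g12, g20, g7, g1⟩
      rw [exec_seq, exec_ite (by simp [Expr.Fits])]
      have hval : Expr.val (s'.tick 1) (.get 7 (.reg 20)) = s.mem 7 i := by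
        simp [Expr.val, g20, g7]
      rw [hval]
      have hfin : ∀ s'' : State, s''.reg 12 = s.reg 12 → s''.reg 20 = i → s''.mem 7 = s.mem 7 →
          s''.mem 1 = Function.update (s'.mem 1) i
            (if s.mem 7 i ≠ 0 then i + 1 else s.reg 12) →
          let t := (Cmd.assign 20 (.bin .add (.reg 20) (.const 1))).exec w ω s''
          t.reg 12 = s.reg 12 ∧ t.reg 20 = i + 1 ∧ t.mem 7 = s.mem 7 ∧
          ∀ v < i + 1, t.mem 1 v = if s.mem 7 v ≠ 0 then v + 1 else s.reg 12 := by
        intro s'' e12 e20 e7 e1 t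
        have ht : t = _ := exec_assign (by simp [Expr.Fits, Expr.val, Op.Fits, e20, hw]; omega)
        rw [ht]
        refine ⟨by simp [e12], by simp [Expr.val, e20], by simp [e7], fun v hv => ?_⟩
        simp only [State.tick_mem, State.setReg_mem, e1, Function.update_apply]
        by_cases hvi : v = i
        · rw [if_pos hvi, hvi]
        · rw [if_neg hvi, g1 v (by omega)]
      by_cases h7 : s.mem 7 i ≠ 0
      · rw [if_pos h7, exec_store (by simp [Expr.Fits]) (by
          simp [Expr.Fits, Expr.val, Op.Fits, g20, hw]; omega)]
        exact hfin _ (by simp [g12]) (by simp [g20]) (by simp [g7])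
          (by simp [Expr.val, g20, h7])
      · rw [if_neg h7, exec_store (by simp [Expr.Fits]) (by simp [Expr.Fits])]
        exact hfin _ (by simp [g12]) (by simp [g20]) (by simp [g7])
          (by simp only [ne_eq, not_not] at h7; simp [Expr.val, g20, g12, h7]))
  exact key.2.2.2

/-- The data after the preprocessing. -/
def Data.start (isC : Fin n → Bool) (r : ℕ) : Data n where
  isC := isC
  key _ _ := 0
  cen v := if isC v then v + 1 else 0
  img v := if isC v then v + 1 else r
  mp _ _ := false
  un _ _ := false
  dirty _ := false
  wt _ _ := 0

lemma isTree_zero {m f : ℕ → ℕ} {b l : ℕ} (hm : ∀ i, m i = 0) (hf : ∀ i, f i = 0) :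
    IsTree m b l f where
  leaf i _ := by rw [hm, hf]
  node q _ _ := by simp [hm]

/-- In the empty graph there is nothing to map and no key is positive. Hence any center may serve as
the image of all non-centers, and `prio` is arbitrary. -/
theorem init_spec {τ : ℕ} (hS : Sizes w n (Nat.clog 2 n))
    (hτ : (2 ^ Nat.clog 2 n) ^ 20 * τ < 2 ^ w) (prio : Fin n → Fin n → ℕ) :
    ∃ d : Data n, Rep (Nat.clog 2 n) d (initCmd.exec w ω (startState n τ)) ∧
      Inv ⊥ (Nat.clog 2 n) prio d ∧ (∀ v, d.isC v = coin n τ (Nat.clog 2 n) (ω v)) ∧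
      (initCmd.exec w ω (startState n τ)).pos = n ∧ d.pending = 0 := by
  set l := Nat.clog 2 n with hl
  simp only [initCmd, exec_seq]
  set s1 := initSize.exec w ω (startState n τ) with hs1
  set s2 := initConst.exec w ω s1 with hs2
  set s3 := initLog.exec w ω s2 with hs3
  set s4 := initCoin.exec w ω s3 with hs4
  set s5 := initImg.exec w ω s4 with hs5
  have f1 : ∀ z, z ≠ 5 → z ≠ 6 → s1.reg z = (startState n τ).reg z := fun z h5 h6 =>
    exec_reg_of_notMem (by simp [initSize, Cmd.regs, h5, h6]) _
  have f2 : ∀ z, z ∉ [7, 8, 9, 10, 11, 13, 14, 19] → s2.reg z = s1.reg z := fun z hz =>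
    exec_reg_of_notMem (by simp [initConst, Cmd.regs] at hz ⊢; omega) _
  have f3 : ∀ z, z ∉ [15, 16, 17, 18] → s3.reg z = s2.reg z := fun z hz =>
    exec_reg_of_notMem (by simp [initLog, initTerm, Cmd.regs] at hz ⊢; omega) _
  have f4 : ∀ z, z ∉ [12, 17, 18, 20, 21] → s4.reg z = s3.reg z := fun z hz =>
    exec_reg_of_notMem (by simp [initCoin, Cmd.regs] at hz ⊢; omega) _
  have f5 : ∀ z, z ≠ 20 → s5.reg z = s4.reg z := fun z hz =>
    exec_reg_of_notMem (by simp [initImg, Cmd.regs, hz]) _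
  have m1 : ∀ a, s1.mem a = fun _ => 0 := fun a =>
    exec_mem_of_notMem (by simp [initSize, Cmd.arrs]) _
  have m2 : ∀ a, s2.mem a = fun _ => 0 := fun a =>
    (exec_mem_of_notMem (by simp [initConst, Cmd.arrs]) _).trans (m1 a)
  have m3 : ∀ a, s3.mem a = fun _ => 0 := fun a =>
    (exec_mem_of_notMem (by simp [initLog, initTerm, Cmd.arrs]) _).trans (m2 a)
  have m4 : ∀ a, a ≠ 0 → a ≠ 7 → s4.mem a = fun _ => 0 := fun a h0 h7 =>
    (exec_mem_of_notMem (by simp [initCoin, Cmd.arrs, h0, h7]) _).trans (m3 a)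
  have m5 : ∀ a, a ≠ 1 → s5.mem a = s4.mem a := fun a h1 =>
    exec_mem_of_notMem (by simp [initImg, Cmd.arrs, h1]) _
  have p3 : s3.pos = 0 := by
    rw [hs3, exec_pos_of_randFree rfl, hs2, exec_pos_of_randFree rfl, hs1,
      exec_pos_of_randFree rfl]
    rfl
  have a1 := initSize_spec (ω := ω) (s := startState n τ) hS rfl rfl
  rw [← hs1] at a1
  have r0 : s1.reg 0 = n := by rw [f1 0 (by norm_num) (by norm_num)]; rfl
  obtain ⟨b7, b8, b9, b10, b11, b13, b14, b19⟩ :=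
    initConst_spec (ω := ω) (s := s1) hS r0 a1.1 a1.2
  rw [← hs2] at b7 b8 b9 b10 b11 b13 b14 b19
  have c15 := initLog_spec (ω := ω) hS b13 b14 b19
  rw [← hs3] at c15
  have r0' : s3.reg 0 = n := by rw [f3 0 (by simp), f2 0 (by simp), r0]
  obtain ⟨e1, e2, e3, e4, e5⟩ := initCoin_spec (ω := ω) (s := s3) hS hτ r0'
    (by rw [f3 1 (by simp), f2 1 (by simp), f1 1 (by norm_num) (by norm_num)]; rfl)
    (by rw [f3 8 (by simp), b8])
    (by rw [f3 12 (by simp), f2 12 (by simp), f1 12 (by norm_num) (by norm_num)]; rfl)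
    (by rw [f3 13 (by simp), b13]) c15 (by simp [m3]) (by simp [m3]) p3
  rw [← hs4] at e1 e2 e3 e4 e5
  have g1 := initImg_spec (ω := ω) (s := s4) hS (by rw [f4 0 (by simp), r0'])
  rw [← hs5] at g1
  set isC : Fin n → Bool := fun v => coin n τ l (ω v) with hisC
  have hex : s4.reg 12 ≠ 0 ↔ ∃ v, isC v = true := by
    constructor
    · intro h
      obtain ⟨v, hv, h1, -⟩ := e5 h
      exact ⟨⟨v, hv⟩, h1⟩
    · rintro ⟨v, hv⟩ h
      have := e4 h v v.2
      simp only [hisC, this] at hv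
      cases hv
  refine ⟨Data.start isC (s4.reg 12), ?_, ?_, fun v => rfl, ?_, ?_⟩
  · refine ⟨?_, ?_, ?_, ?_, ?_, ?_, ?_, ?_, ?_, ?_, ?_, ?_, ?_, ?_, ?_, ?_, ?_⟩
    · rw [f5 0 (by norm_num), f4 0 (by simp), r0']
    · rw [f5 5 (by norm_num), f4 5 (by simp), f3 5 (by simp), f2 5 (by simp), a1.1]
    · rw [f5 6 (by norm_num), f4 6 (by simp), f3 6 (by simp), f2 6 (by simp), a1.2]
    · rw [f5 7 (by norm_num), f4 7 (by simp), f3 7 (by simp), b7]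
    · rw [f5 8 (by norm_num), f4 8 (by simp), f3 8 (by simp), b8]
    · rw [f5 9 (by norm_num), f4 9 (by simp), f3 9 (by simp), b9]
    · rw [f5 10 (by norm_num), f4 10 (by simp), f3 10 (by simp), b10]
    · rw [f5 11 (by norm_num), f4 11 (by simp), f3 11 (by simp), b11]
    · rw [f5 12 (by norm_num)]; exact hex
    · intro v; rw [m5 0 (by norm_num), e2 v v.2]; rfl
    · intro v
      rw [g1 v v.2, e3 v v.2]
      simp only [Data.start, hisC]
      cases coin n τ l (ω v) <;> simp
    · intro a b; rw [m5 2 (by norm_num), m4 2 (by norm_num) (by norm_num)]; rfl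
    · intro u
      rw [m5 3 (by norm_num), m4 3 (by norm_num) (by norm_num)]
      exact isTree_zero (fun _ => rfl) (fun i => by simp [extend, Data.start])
    · intro u
      rw [m5 4 (by norm_num), m4 4 (by norm_num) (by norm_num)]
      exact isTree_zero (fun _ => rfl) (fun i => by simp [extend, Data.start, setLeaves])
    · rw [m5 5 (by norm_num), m4 5 (by norm_num) (by norm_num)]
      exact isTree_zero (fun _ => rfl) (fun i => by simp [extend, Data.start, setLeaves])
    · rw [m5 6 (by norm_num), m4 6 (by norm_num) (by norm_num)]
      exact isTree_zero (fun _ => rfl) (fun i => by simp [pairLeaves, Data.start])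
    · intro v; rw [m5 7 (by norm_num), e3 v v.2]; rfl
  · have hcen : ∀ v, (Data.start isC (s4.reg 12)).cen v = centerOf ⊥ isC l prio v := by
      intro v
      cases hv : isC v
      · rw [centerOf_eq_zero hv (by simp)]; simp [Data.start, hv]
      · rw [centerOf_center hv]; simp [Data.start, hv]
    refine ⟨?_, funext hcen, ?_, ?_⟩
    · funext u v; rw [keyOf_neg (by simp)]; rfl
    · intro v
      cases hv : isC v <;> simp [Data.start, hv]
    · refine ⟨?_, ?_, ?_, ?_, ?_, ?_, ?_, ?_, ?_, ?_, ?_⟩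
      · intro v hv; simp only [Data.start] at hv ⊢; simp [hv]
      · intro hc v
        cases hv : isC v
        · obtain ⟨r, hr, h1, h2⟩ := e5 (hex.2 hc)
          exact ⟨⟨r, hr⟩, h1, by simp [Data.start, hv, h2]⟩
        · exact ⟨v, hv, by simp [Data.start, hv]⟩
      · intro hc v
        have h0 : s4.reg 12 = 0 := by
          by_contra h
          exact hc (hex.1 h)
        have hv : isC v = false := e4 h0 v v.2
        simp [Data.start, hv, h0]
      · intro _ _; rfl
      · intro _ _; rfl
      · intro _ _ h; cases h
      · intro _ _ h; cases h
      · intro _ _ h; cases h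
      · intro _ u v h; simp at h
      · intro _ _ _; exact ⟨rfl, rfl⟩
      · intro a b
        have : fiber (Data.start isC (s4.reg 12)).img (Data.start isC (s4.reg 12)).mp a b = ∅ := by
          ext e
          simp [fiber, edgesOf, Data.start]
        rw [this]; simp [Data.start]
  · rw [hs5, exec_pos_of_randFree rfl, e1]
  · simp [Data.pending, Data.start]

end StarContraction

namespace StarContraction

/-! ### The run of the algorithm -/

variable {n w l τ : ℕ}

lemma bits_starAlg (n τ : ℕ) : starAlg.bits n τ = 60 * Nat.clog 2 (n + τ + 2) := rfl

lemma sizes_starAlg (hn : 2 ≤ n) (τ : ℕ) : Sizes (starAlg.bits n τ) n (Nat.clog 2 n) where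
  two_le := hn
  pos := Nat.clog_pos (by norm_num) hn
  le := Nat.le_pow_clog (by norm_num) n
  word := by
    rw [← pow_mul, bits_starAlg]
    have : Nat.clog 2 n ≤ Nat.clog 2 (n + τ + 2) := Nat.clog_mono_right 2 (by omega)
    exact Nat.pow_le_pow_right (by norm_num) (by omega)

lemma mul_lt_starAlg (n τ : ℕ) : (2 ^ Nat.clog 2 n) ^ 20 * τ < 2 ^ starAlg.bits n τ := by
  have h1 : Nat.clog 2 n ≤ Nat.clog 2 (n + τ + 2) := Nat.clog_mono_right 2 (by omega)
  have h2 : n + τ + 2 ≤ 2 ^ Nat.clog 2 (n + τ + 2) := Nat.le_pow_clog (by norm_num) _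
  calc (2 ^ Nat.clog 2 n) ^ 20 * τ < (2 ^ Nat.clog 2 n) ^ 20 * 2 ^ Nat.clog 2 (n + τ + 2) :=
        Nat.mul_lt_mul_of_pos_left (by omega) (by positivity)
    _ = 2 ^ (Nat.clog 2 n * 20 + Nat.clog 2 (n + τ + 2)) := by rw [pow_add, pow_mul]
    _ ≤ 2 ^ starAlg.bits n τ := Nat.pow_le_pow_right (by norm_num) (by rw [bits_starAlg]; omega)

/-- The positions on the tape of the priorities at time `t`. -/
def prioPos (upd : ℕ → Update n) : ℕ → Fin n → Fin n → ℕ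
  | 0 => fun _ _ => 0
  | t + 1 => newPrio (prioPos upd t) (upd t) (n + 2 * t) (n + 2 * t + 1)

/-- The priorities at time `t`. -/
def prioAt (upd : ℕ → Update n) (ω : Tape w) (t : ℕ) (u v : Fin n) : ℕ := ω (prioPos upd t u v)

/-- The centers. -/
def coins (n τ : ℕ) (ω : Tape w) (v : Fin n) : Bool := coin n τ (Nat.clog 2 n) (ω v)

/-- The word that encodes the center of `v` at time `t`. -/
noncomputable def centerAt (τ : ℕ) (upd : ℕ → Update n) (ω : Tape w) (t : ℕ) (v : Fin n) : ℕ :=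
  centerOf (graphAt upd t) (coins n τ ω) (Nat.clog 2 n) (prioAt upd ω t) v

/-- The work that update `t` creates. -/
noncomputable def arrivalAt (τ : ℕ) (upd : ℕ → Update n) (ω : Tape w) (t : ℕ) : ℕ :=
  2 + ∑ x, if centerAt τ upd ω (t + 1) x ≠ centerAt τ upd ω t x
    then 1 + 4 * deg (graphAt upd t) x else 0

lemma prioAt_succ (upd : ℕ → Update n) (ω : Tape w) (t : ℕ) :
    prioAt upd ω (t + 1) =
      newPrio (prioAt upd ω t) (upd t) (ω (n + 2 * t)) (ω (n + 2 * t + 1)) := by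
  funext u v
  simp only [prioAt, prioPos, newPrio]
  split_ifs with h
  · simp only [setPair]
    split_ifs <;> rfl
  · rfl

/-- The data in memory at time `t`. -/
structure RunAt (τ : ℕ) (upd : ℕ → Update n) (ω : Tape (starAlg.bits n τ)) (t : ℕ)
    (d : Data n) : Prop where
  rep : Rep (Nat.clog 2 n) d (starAlg.stateAt τ upd ω t)
  inv : Inv (graphAt upd t) (Nat.clog 2 n) (prioAt upd ω t) d
  isC : d.isC = coins n τ ω
  pos : (starAlg.stateAt τ upd ω t).pos = n + 2 * t

lemma RunAt.cen {upd : ℕ → Update n} {ω : Tape (starAlg.bits n τ)} {t : ℕ} {d : Data n}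
    (h : RunAt τ upd ω t d) : d.cen = centerAt τ upd ω t := by
  rw [h.inv.cen, h.isC]; rfl

/-- The one-step statements are strung together by choice. The last clause is the recursion of a
queue with arrivals `arrivalAt` and service `Nat.clog 2 n ^ 3 + 2`. -/
theorem exists_run (hn : 2 ≤ n) {upd : ℕ → Update n} (hupd : ValidSeq upd)
    (ω : Tape (starAlg.bits n τ)) :
    ∃ d : ℕ → Data n, (∀ t, RunAt τ upd ω t (d t)) ∧ (d 0).pending = 0 ∧
      ∀ t, (d (t + 1)).pending ≤
        (d t).pending + arrivalAt τ upd ω t - (Nat.clog 2 n ^ 3 + 2) := by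
  have hS := sizes_starAlg hn τ
  obtain ⟨d₀, h1, h2, h3, h4, h5⟩ := init_spec (ω := ω) (prio := prioAt upd ω 0) hS
    (mul_lt_starAlg n τ)
  have h0 : RunAt τ upd ω 0 d₀ := ⟨h1, h2, funext h3, h4⟩
  have hstep : ∀ t d, RunAt τ upd ω t d → ∃ d', RunAt τ upd ω (t + 1) d' ∧
      d'.pending ≤ d.pending + arrivalAt τ upd ω t - (Nat.clog 2 n ^ 3 + 2) := by
    intro t d h
    obtain ⟨d', g1, g2, g3, g4, g5⟩ := update_spec (ω := ω) hS h.rep h.inv (hupd t)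
    rw [h.pos, ← prioAt_succ] at g2 g5
    rw [h.pos] at g4
    refine ⟨d', ⟨g1, g2, g3.trans h.isC, g4⟩, ?_⟩
    rw [h.isC] at g5
    exact g5
  choose f hf using hstep
  let r : (t : ℕ) → {d : Data n // RunAt τ upd ω t d} := fun t =>
    Nat.rec ⟨d₀, h0⟩ (fun t d => ⟨f t d.1 d.2, (hf t d.1 d.2).1⟩) t
  exact ⟨fun t => (r t).1, fun t => (r t).2, h5, fun t => (hf t (r t).1 (r t).2).2⟩

/-! ### The output -/

lemma decodeVertex_zero : decodeVertex n 0 = none := rfl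

lemma decodeVertex_succ (r : Fin n) : decodeVertex n (r + 1) = some r := by
  simp [decodeVertex, Nat.succ_le_of_lt r.2]

/-- A word that encodes a vertex or `none`. -/
def IsCode (n x : ℕ) : Prop := x = 0 ∨ ∃ r : Fin n, x = r + 1

lemma decodeVertex_eq_some {x : ℕ} (hx : IsCode n x) (r : Fin n) :
    decodeVertex n x = some r ↔ x = r + 1 := by
  rcases hx with rfl | ⟨r', rfl⟩
  · simp [decodeVertex_zero]
  · simp [decodeVertex_succ, Fin.ext_iff]

lemma isCode_centerOf (G : SimpleGraph (Fin n)) (isC : Fin n → Bool) (l : ℕ)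
    (prio : Fin n → Fin n → ℕ) (u : Fin n) : IsCode n (centerOf G isC l prio u) := by
  cases hu : isC u
  · rcases centerOf_other (G := G) (l := l) (prio := prio) hu with ⟨h, -⟩ | ⟨r, h, -⟩
    · exact .inl h
    · exact .inr ⟨r, h⟩
  · exact .inr ⟨u, centerOf_center hu⟩

lemma centerOf_eq_self {G : SimpleGraph (Fin n)} {isC : Fin n → Bool} {prio : Fin n → Fin n → ℕ}
    {u : Fin n} : centerOf G isC l prio u = u + 1 ↔ isC u = true := by
  refine ⟨fun h => ?_, centerOf_center⟩
  by_contra hu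
  rcases centerOf_other (G := G) (l := l) (prio := prio) (by simpa using hu) with
    ⟨h1, -⟩ | ⟨r, h1, h2, -⟩
  · omega
  · have : r = u := Fin.ext (by omega)
    exact h2.ne this.symm

section output

variable {upd : ℕ → Update n} {ω : Tape (starAlg.bits n τ)} {t : ℕ} {d : Data n}

lemma RunAt.center (h : RunAt τ upd ω t d) (v : Fin n) :
    (starAlg.outputAt τ upd ω t).center v = decodeVertex n (centerAt τ upd ω t v) := by
  simp only [DynAlg.outputAt, State.output]
  rw [h.rep.cen, h.cen]

lemma RunAt.image (h : RunAt τ upd ω t d) (v : Fin n) :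
    (starAlg.outputAt τ upd ω t).image v = decodeVertex n (d.img v) := by
  simp only [DynAlg.outputAt, State.output]
  rw [h.rep.img]

lemma RunAt.weight (h : RunAt τ upd ω t d) (a b : Fin n) :
    (starAlg.outputAt τ upd ω t).weight a b = d.wt a b := h.rep.wt a b

lemma RunAt.isCode_img (h : RunAt τ upd ω t d) (v : Fin n) : IsCode n (d.img v) := by
  by_cases hc : ∃ c, d.isC c = true
  · obtain ⟨r, -, hr⟩ := h.inv.edge.img_other hc v
    exact .inr ⟨r, hr⟩
  · exact .inl (h.inv.edge.img_none hc v)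

lemma RunAt.isCenterAssignment (h : RunAt τ upd ω t d) :
    IsCenterAssignment (graphAt upd t) (starAlg.outputAt τ upd ω t).center := by
  intro v
  simp only [h.center]
  cases hv : coins n τ ω v
  · rcases centerOf_other (G := graphAt upd t) (l := Nat.clog 2 n) (prio := prioAt upd ω t) hv with
      ⟨h1, h2⟩ | ⟨r, h1, h2, h3, -⟩
    · refine .inr (.inr ⟨?_, fun r hr => ?_⟩)
      · rw [centerAt, h1, decodeVertex_zero]
      · rw [Ne, centerAt, decodeVertex_eq_some (isCode_centerOf _ _ _ _ _), centerOf_eq_self,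
          h2 r hr]
        simp
    · refine .inr (.inl ⟨r, ?_, h2, ?_⟩)
      · rw [centerAt, h1, decodeVertex_succ]
      · rw [centerAt, centerOf_center h3, decodeVertex_succ]
  · left
    rw [centerAt, centerOf_center hv, decodeVertex_succ]

/-- Whenever an image is defined it is a center, even if it is outdated or a default that is not
adjacent to the vertex. A non-center can therefore never be its own image. -/
lemma RunAt.imageOK (h : RunAt τ upd ω t d) : (starAlg.outputAt τ upd ω t).ImageOK := by
  have hcen : ∀ v, (starAlg.outputAt τ upd ω t).center v = some v ↔ d.isC v = true := by
    intro v
    rw [h.center, centerAt, decodeVertex_eq_some (isCode_centerOf _ _ _ _ _), centerOf_eq_self,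
      h.isC]
  have key : ∀ v r, (starAlg.outputAt τ upd ω t).image v = some r → d.isC r = true := by
    intro v r hr
    rw [h.image, decodeVertex_eq_some (h.isCode_img v)] at hr
    by_cases hc : ∃ c, d.isC c = true
    · obtain ⟨r', h1, h2⟩ := h.inv.edge.img_other hc v
      have : r' = r := Fin.ext (by omega)
      rwa [this] at h1
    · rw [h.inv.edge.img_none hc v] at hr
      omega
  refine ⟨fun v => ?_, fun v r hr => (hcen r).2 (key v r hr)⟩
  rw [hcen]
  refine ⟨key v v, fun hv => ?_⟩
  rw [h.image, h.inv.edge.img_center v hv, decodeVertex_succ]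

lemma RunAt.mapsEdges (h : RunAt τ upd ω t d) :
    (starAlg.outputAt τ upd ω t).MapsEdges (edgesOf d.mp) := by
  refine ⟨?_, fun a b => ?_⟩
  · rintro e ⟨u, v, rfl, huv⟩ x -
    have hc := h.inv.edge.exists_center (.inl huv)
    obtain ⟨r, -, hr⟩ := h.inv.edge.img_other hc x
    rw [h.image, hr, decodeVertex_succ]
    simp
  · rw [h.weight, h.inv.edge.wt]
    congr 1
    ext e
    simp only [fiber, Set.mem_ofPred_eq]
    refine and_congr_right fun _ => ?_
    induction e using Sym2.ind with
    | _ u v =>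
      change s(d.img u, d.img v) = s((a : ℕ) + 1, (b : ℕ) + 1) ↔
        s((starAlg.outputAt τ upd ω t).image u, (starAlg.outputAt τ upd ω t).image v) =
          s(some a, some b)
      rw [Sym2.eq_iff, Sym2.eq_iff]
      simp only [h.image, decodeVertex_eq_some (h.isCode_img _)]

lemma RunAt.isContraction (h : RunAt τ upd ω t d) :
    (starAlg.outputAt τ upd ω t).IsContraction (graphAt upd t) := by
  refine ⟨h.imageOK, edgesOf d.mp, ?_, h.mapsEdges⟩
  rintro e ⟨u, v, rfl, huv⟩
  exact h.inv.edge.mp_adj u v huv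

lemma RunAt.isComplete (h : RunAt τ upd ω t d) (hp : d.pending = 0)
    (hcen : ∀ v, centerAt τ upd ω t v ≠ 0) :
    (starAlg.outputAt τ upd ω t).image = (starAlg.outputAt τ upd ω t).center ∧
      (starAlg.outputAt τ upd ω t).IsComplete (graphAt upd t) := by
  obtain ⟨h1, h2⟩ := Data.eq_of_pending_eq_zero h.inv.edge h.inv.cenInv hp
    (by rw [h.cen]; exact hcen)
  refine ⟨?_, h.imageOK, ?_⟩
  · funext v
    rw [h.image, h.center, h1, h.cen]
  · have : edgesOf d.mp = (graphAt upd t).edgeSet := by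
      ext e
      induction e using Sym2.ind with
      | _ u v =>
        rw [mem_edgesOf h.inv.edge.mp_symm, h2, SimpleGraph.mem_edgeSet]
    rw [← this]
    exact h.mapsEdges

end output

end StarContraction

namespace StarContraction

/-! ### Running times -/

variable {n w τ : ℕ}

lemma half_le_log (hn : 2 ≤ n) : 1 / 2 ≤ Real.log n := by
  have h1 : Real.log 2 ≤ Real.log n :=
    Real.log_le_log (by norm_num) (by exact_mod_cast hn)
  linarith [Real.log_two_gt_d9]

/-- `2 ^ (clog - 1) < n` gives `clog ≤ 1 + log n / log 2 ≤ 2 log n / log 2`, and `2 / log 2 < 3`. -/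
lemma clog_le_log (hn : 2 ≤ n) : (Nat.clog 2 n : ℝ) ≤ 3 * Real.log n := by
  have h1 : Real.log 2 ≤ Real.log n :=
    Real.log_le_log (by norm_num) (by exact_mod_cast hn)
  have h0 := Real.log_two_gt_d9
  have h2 : 2 ^ (Nat.clog 2 n - 1) < n := Nat.pow_pred_clog_lt_self (by norm_num) (by omega)
  have hpos : 0 < Nat.clog 2 n := Nat.clog_pos (by norm_num) hn
  have h3 : ((Nat.clog 2 n - 1 : ℕ) : ℝ) * Real.log 2 ≤ Real.log n := by
    rw [← Real.log_pow]
    exact Real.log_le_log (by positivity) (by exact_mod_cast h2.le)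
  rw [Nat.cast_sub hpos, Nat.cast_one] at h3
  nlinarith

lemma log_le_clog (hn : 2 ≤ n) : Real.log n ≤ Nat.clog 2 n := by
  have h1 : n ≤ 2 ^ Nat.clog 2 n := Nat.le_pow_clog (by norm_num) n
  have h2 : Real.log n ≤ Real.log ((2 : ℝ) ^ Nat.clog 2 n) :=
    Real.log_le_log (by positivity) (by exact_mod_cast h1)
  rw [Real.log_pow] at h2
  have := Real.log_two_lt_d9
  have : (0 : ℝ) ≤ Nat.clog 2 n := Nat.cast_nonneg _
  nlinarith

lemma updateCmd_loops : (∀ x ∈ [5, 9, 10], x ∉ updateCmd.regs) ∧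
    updateCmd.loopsOver [5, 9, 10] = true := by
  constructor
  · decide
  · decide

/-- All loops are counted by registers `5`, `9` and `10`, which hold `l`, `l ^ 3 + 2` and `2 * l`
and are not written by an update. The bound is independent of the graph and of the random words. -/
lemma exists_updateTime_le : ∃ C k : ℕ, ∀ {n τ : ℕ}, 2 ≤ n → ∀ {upd : ℕ → Update n},
    ValidSeq upd → ∀ (ω : Tape (starAlg.bits n τ)) (t : ℕ),
      starAlg.updateTime τ upd ω t ≤ C * (Nat.clog 2 n ^ 3 + 2) ^ k := by
  obtain ⟨C, hC⟩ := exists_timeBound_le updateCmd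
  refine ⟨C, updateCmd.depth, fun {n τ} hn {upd} hupd ω t => ?_⟩
  obtain ⟨d, hd, -⟩ := exists_run hn hupd ω
  have hR := (hd t).rep
  set l := Nat.clog 2 n
  let ρ : ℕ → ℕ := fun x => if x = 5 then l else if x = 9 then l ^ 3 + 2 else
    if x = 10 then 2 * l else 0
  have h1 := exec_time_le (w := starAlg.bits n τ) (ω := ω) (ρ := ρ) updateCmd_loops.1
    updateCmd_loops.2 (s := (starAlg.stateAt τ upd ω t).receive (upd t)) (by
      simp [State.receive, ρ, hR.r5, hR.r9, hR.r10])
  have hll : 2 * l ≤ l ^ 3 + 2 := by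
    rcases Nat.lt_or_ge l 2 with h | h
    · interval_cases l <;> norm_num
    · nlinarith [Nat.pow_le_pow_left h 2]
  have h2 := hC (l ^ 3 + 2) ρ (by omega) (by
    intro x
    simp only [ρ]
    split_ifs <;> omega)
  have h3 : ((starAlg.stateAt τ upd ω t).receive (upd t)).time =
    (starAlg.stateAt τ upd ω t).time := rfl
  rw [h3] at h1
  rw [DynAlg.updateTime]
  have h4 : (starAlg.stateAt τ upd ω (t + 1)).time ≤
    (starAlg.stateAt τ upd ω t).time + updateCmd.timeBound ρ := h1
  omega

/-- The dominating part is the series for the logarithm, with `8 l` terms for each of `n - 1` values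
of `k`. -/
lemma initTime_le (hn : 2 ≤ n) (upd : ℕ → Update n) (ω : Tape (starAlg.bits n τ)) :
    starAlg.initTime τ upd ω ≤ 400 * (n * Nat.clog 2 n) := by
  have hS := sizes_starAlg hn τ
  have hl := hS.pos
  set l := Nat.clog 2 n with hll
  set s₀ := startState n τ
  have h0 : s₀.reg 0 = n := rfl
  change (initCmd.exec _ ω s₀).time ≤ _
  simp only [initCmd, exec_seq]
  set s1 := initSize.exec (starAlg.bits n τ) ω s₀ with hs1
  set s2 := initConst.exec (starAlg.bits n τ) ω s1 with hs2
  set s3 := initLog.exec (starAlg.bits n τ) ω s2 with hs3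
  set s4 := initCoin.exec (starAlg.bits n τ) ω s3 with hs4
  set s5 := initImg.exec (starAlg.bits n τ) ω s4 with hs5
  have a1 := initSize_spec (ω := ω) hS h0 rfl
  rw [← hs1] at a1
  have f1 : s1.reg 0 = n := by rw [hs1, exec_reg_of_notMem (by decide), h0]
  obtain ⟨-, -, -, -, -, -, b14, b19⟩ := initConst_spec (ω := ω) hS f1 a1.1 a1.2
  rw [← hs2] at b14 b19
  have f2 : s2.reg 0 = n := by rw [hs2, exec_reg_of_notMem (by decide), f1]
  have f3 : s3.reg 0 = n := by rw [hs3, exec_reg_of_notMem (by decide), f2]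
  have f4 : s4.reg 0 = n := by rw [hs4, exec_reg_of_notMem (by decide), f3]
  have t1 := exec_time_le (w := starAlg.bits n τ) (ω := ω) (c := initSize) (L := [0])
    (ρ := fun _ => n) (by decide) (by decide) (s := s₀) (by simp [h0])
  have t2 := exec_time_le (w := starAlg.bits n τ) (ω := ω) (c := initConst) (L := [])
    (ρ := fun _ => n) (by decide) (by decide) (s := s1) (by simp)
  have t3 := exec_time_le (w := starAlg.bits n τ) (ω := ω) (c := initLog) (L := [14, 19])
    (ρ := fun x => if x = 14 then 8 * l else n - 1) (by decide) (by decide) (s := s2)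
    (by simp [b14, b19])
  have t4 := exec_time_le (w := starAlg.bits n τ) (ω := ω) (c := initCoin) (L := [0])
    (ρ := fun _ => n) (by decide) (by decide) (s := s3) (by simp [f3])
  have t5 := exec_time_le (w := starAlg.bits n τ) (ω := ω) (c := initImg) (L := [0])
    (ρ := fun _ => n) (by decide) (by decide) (s := s4) (by simp [f4])
  rw [← hs1] at t1
  rw [← hs2] at t2
  rw [← hs3] at t3
  rw [← hs4] at t4
  rw [← hs5] at t5
  have t0 : s₀.time = 0 := rfl
  simp only [initSize, initConst, initLog, initTerm, initCoin, initImg, Cmd.timeBound,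
    Expr.cost, if_true, show (19 : ℕ) ≠ 14 by decide, if_false] at t1 t2 t3 t4 t5
  obtain ⟨m, rfl⟩ : ∃ m, n = m + 1 := ⟨n - 1, by omega⟩
  simp only [Nat.add_sub_cancel] at t3
  have hml : m ≤ m * l := Nat.le_mul_of_pos_right _ hl
  have e3 : m * (1 + 1 + 1 + 1 + (1 + 1 + (1 + 1 + (2 + 8 * l * 13))) + 1) ≤ 120 * (m * l) := by
    nlinarith
  ring_nf at t1 t2 t3 t4 t5 e3 ⊢
  omega

/-- The minimum degree is below `n`, so the factor `n / max 1 δ` is at least `1` and a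
polylogarithmic bound for each single update implies the worst-case claim; summation gives the
amortized one. -/
theorem starAlg_deterministic :
    ∃ (C : ℝ) (k : ℕ), ∀ n τ : ℕ, 2 ≤ n → 1 ≤ τ → ∀ upd : ℕ → Update n, ValidSeq upd →
        ∀ ω : Tape (starAlg.bits n τ),
          (starAlg.initTime τ upd ω : ℝ) ≤ C * n * Real.log n ^ k ∧
          (∀ t, (starAlg.updateTime τ upd ω t : ℝ) ≤
            C * (n / max 1 (minDeg (graphAt upd (t + 1)) : ℝ)) * Real.log n ^ k) ∧
          (∀ T, (∑ t ∈ Finset.range T, (starAlg.updateTime τ upd ω t : ℝ)) ≤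
            T * (C * Real.log n ^ k)) ∧
          (∀ t, IsCenterAssignment (graphAt upd t) (starAlg.outputAt τ upd ω t).center ∧
            (starAlg.outputAt τ upd ω t).IsContraction (graphAt upd t)) := by
  obtain ⟨C, k, hC⟩ := exists_updateTime_le
  -- `400` serves the preprocessing and `C * 3 ^ k` the updates; the powers of `3` come from `clog ≤
  -- 3 log n`. The exponent exceeds `3 * k` by one to leave a logarithm for the preprocessing even
  -- if `k = 0`.
  refine ⟨(400 + C * 3 ^ k) * 3 ^ (3 * k + 1), 3 * k + 1, fun n τ hn hτ upd hupd ω => ?_⟩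
  have hlog := half_le_log hn
  have h3 : (1 : ℝ) ≤ 3 * Real.log n := by linarith
  have hl := clog_le_log hn
  have hup : ∀ t, (starAlg.updateTime τ upd ω t : ℝ) ≤
      (400 + C * 3 ^ k) * 3 ^ (3 * k + 1) * Real.log n ^ (3 * k + 1) := by
    intro t
    have h := hC hn hupd ω t
    have hq : ((Nat.clog 2 n : ℝ) ^ 3 + 2) ^ k ≤ 3 ^ k * (3 * Real.log n) ^ (3 * k) := by
      rw [pow_mul, ← mul_pow]
      have g1 : (Nat.clog 2 n : ℝ) ^ 3 ≤ (3 * Real.log n) ^ 3 := by gcongr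
      have g2 : 1 ≤ (3 * Real.log n) ^ 3 := one_le_pow₀ h3
      gcongr
      linarith
    calc (starAlg.updateTime τ upd ω t : ℝ) ≤ C * ((Nat.clog 2 n : ℝ) ^ 3 + 2) ^ k := by
          exact_mod_cast h
      _ ≤ C * (3 ^ k * (3 * Real.log n) ^ (3 * k + 1)) := by
          gcongr
          exact hq.trans (by gcongr; omega)
      _ = C * 3 ^ k * (3 * Real.log n) ^ (3 * k + 1) := by ring
      _ ≤ (400 + C * 3 ^ k) * (3 * Real.log n) ^ (3 * k + 1) := by gcongr; linarith
      _ = _ := by rw [mul_pow]; ring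
  refine ⟨?_, fun t => ?_, fun T => ?_, fun t => ?_⟩
  · have h := initTime_le (τ := τ) hn upd ω
    calc (starAlg.initTime τ upd ω : ℝ) ≤ 400 * (n * Nat.clog 2 n) := by exact_mod_cast h
      _ ≤ 400 * (n * (3 * Real.log n) ^ (3 * k + 1)) := by
          gcongr
          exact hl.trans (le_self_pow₀ h3 (by omega))
      _ = 400 * (n * (3 * Real.log n) ^ (3 * k + 1)) := by ring
      _ ≤ (400 + C * 3 ^ k) * (n * (3 * Real.log n) ^ (3 * k + 1)) := by
          gcongr
          have : (0 : ℝ) ≤ C * 3 ^ k := by positivity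
          linarith
      _ = _ := by rw [mul_pow]; ring
  · refine (hup t).trans ?_
    have hdeg : (minDeg (graphAt upd (t + 1)) : ℝ) ≤ n := by
      classical
      have : Nonempty (Fin n) := ⟨⟨0, by omega⟩⟩
      have := (graphAt upd (t + 1)).minDegree_lt_card (V := Fin n)
      rw [Fintype.card_fin] at this
      rw [minDeg]
      exact_mod_cast (by convert this.le)
    have h1 : (1 : ℝ) ≤ n / max 1 (minDeg (graphAt upd (t + 1)) : ℝ) := by
      rw [one_le_div (by positivity)]
      exact max_le (by exact_mod_cast (by omega : 1 ≤ n)) hdeg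
    have h2 : (0 : ℝ) ≤ Real.log n := by linarith
    exact mul_le_mul_of_nonneg_right (le_mul_of_one_le_right (by positivity) h1) (by positivity)
  · calc _ ≤ ∑ t ∈ Finset.range T,
          (400 + C * 3 ^ k) * 3 ^ (3 * k + 1) * Real.log n ^ (3 * k + 1) :=
          Finset.sum_le_sum fun t _ => hup t
      _ = _ := by simp
  · obtain ⟨d, hd, -⟩ := exists_run hn hupd ω
    exact ⟨(hd t).isCenterAssignment, (hd t).isContraction⟩

end StarContraction

namespace StarContraction

/-! ### The random tape -/

variable {w : ℕ}

instance (w : ℕ) : IsProbabilityMeasure (tapeLaw w) := by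
  unfold tapeLaw; infer_instance

/-- The law of a random word. -/
noncomputable def wordLaw (w : ℕ) : Measure (Fin (2 ^ w)) :=
  (PMF.uniformOfFintype (Fin (2 ^ w))).toMeasure

instance (w : ℕ) : IsProbabilityMeasure (wordLaw w) := by
  unfold wordLaw; infer_instance

/-- Such a function factors through the finite, discrete space of prefixes of length `m`. -/
lemma measurable_of_prefix {α : Type*} [MeasurableSpace α] (m : ℕ) {f : Tape w → α}
    (hf : ∀ ω ω' : Tape w, (∀ i < m, ω i = ω' i) → f ω = f ω') : Measurable f := by
  have : Nonempty (Fin (2 ^ w)) := ⟨⟨0, by positivity⟩⟩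
  let r : Tape w → (Fin m → Fin (2 ^ w)) := fun ω i => ω i
  let e : (Fin m → Fin (2 ^ w)) → Tape w := fun x i =>
    if h : i < m then x ⟨i, h⟩ else Classical.arbitrary _
  have h : f = (f ∘ e) ∘ r := by
    funext ω
    exact hf _ _ fun i hi => by simp [e, r, hi]
  rw [h]
  exact (measurable_of_finite _).comp (by fun_prop)

lemma measurableSet_of_prefix (m : ℕ) {p : Tape w → Prop}
    (hp : ∀ ω ω' : Tape w, (∀ i < m, ω i = ω' i) → (p ω ↔ p ω')) :
    MeasurableSet {ω | p ω} :=
  (measurable_of_prefix m fun ω ω' h => propext (hp ω ω' h)).setOf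

lemma measurableSet_box {ι : Type*} (S : Finset ι) (pos : ι → ℕ) (A : ι → Set (Fin (2 ^ w))) :
    MeasurableSet {ω : Tape w | ∀ i ∈ S, ω (pos i) ∈ A i} :=
  measurableSet_of_prefix (S.sup pos + 1) fun ω ω' h => by
    refine forall₂_congr fun i hi => ?_
    rw [h (pos i) (Nat.lt_succ_of_le (Finset.le_sup hi))]

/-- Distinct cells of the tape are independent. The abstract index set makes room for coordinates
named by vertices and pairs of vertices. -/
lemma tapeLaw_box {ι : Type*} {S : Finset ι} {pos : ι → ℕ} (hpos : Set.InjOn pos S)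
    (A : ι → Set (Fin (2 ^ w))) :
    tapeLaw w {ω | ∀ i ∈ S, ω (pos i) ∈ A i} = ∏ i ∈ S, wordLaw w (A i) := by
  classical
  rcases isEmpty_or_nonempty ι with h | h
  · have : S = ∅ := Finset.eq_empty_of_isEmpty S
    subst this
    simp
  let B : ℕ → Set (Fin (2 ^ w)) := fun k => A (Function.invFunOn pos S k)
  have hB : ∀ i ∈ S, B (pos i) = A i := fun i hi => by
    simp only [B]
    rw [hpos.leftInvOn_invFunOn hi]
  have h1 : {ω : Tape w | ∀ i ∈ S, ω (pos i) ∈ A i} =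
      Set.pi (S.image pos : Finset ℕ) B := by
    ext ω
    simp only [Set.mem_ofPred_eq, Set.mem_pi, Finset.mem_coe, Finset.mem_image,
      forall_exists_index, and_imp, forall_apply_eq_imp_iff₂]
    exact forall₂_congr fun i hi => by rw [hB i hi]
  rw [h1, tapeLaw, Measure.infinitePi_pi _ (fun _ _ => Set.Finite.measurableSet (Set.toFinite _)),
    Finset.prod_image hpos]
  exact Finset.prod_congr rfl fun i hi => by rw [hB i hi]; rfl

/-- The words are independent and identically distributed, hence exchangeable. This symmetry
replaces the computation of the probability that a given neighbor wins. -/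
lemma measurePreserving_perm (σ : Equiv.Perm ℕ) :
    MeasurePreserving (fun (ω : Tape w) i => ω (σ i)) (tapeLaw w) (tapeLaw w) := by
  have hm : Measurable (fun (ω : Tape w) i => ω (σ i)) := by fun_prop
  refine ⟨hm, ?_⟩
  conv_rhs => rw [tapeLaw]
  refine Measure.eq_infinitePi _ fun s t ht => ?_
  rw [Measure.map_apply hm (MeasurableSet.pi s.countable_toSet fun i _ => ht i)]
  exact tapeLaw_box (S := s) (pos := σ) (σ.injective.injOn) t

lemma wordLaw_apply (A : Set (Fin (2 ^ w))) [DecidablePred (· ∈ A)] :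
    (wordLaw w).real A = (Finset.univ.filter (· ∈ A)).card / 2 ^ w := by
  classical
  rw [Measure.real, wordLaw,
    PMF.toMeasure_uniformOfFintype_apply A (Set.Finite.measurableSet (Set.toFinite _)),
    Fintype.card_fin, ENNReal.toReal_div, ENNReal.toReal_natCast, ENNReal.toReal_natCast,
    Fintype.card_subtype]
  push_cast
  congr!

/-- The residue of a random word is uniformly distributed. -/
lemma wordLaw_mod {M : ℕ} (hM : M ∣ 2 ^ w) (p : ℕ → Prop) [DecidablePred p] :
    (wordLaw w).real {x | p (x % M)} = ((Finset.range M).filter p).card / M := by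
  obtain ⟨k, hk⟩ := hM
  have hMk : 0 < M * k := by rw [← hk]; positivity
  have hM0 : 0 < M := Nat.pos_of_mul_pos_right hMk
  have hk0 : 0 < k := Nat.pos_of_mul_pos_left hMk
  rw [wordLaw_apply]
  have h1 : (Finset.univ.filter (fun x : Fin (2 ^ w) => x ∈ {x : Fin (2 ^ w) | p (x % M)})).card =
      k * ((Finset.range M).filter p).card := by
    rw [← Finset.card_range k, ← Finset.card_product]
    refine Finset.card_bij (fun x _ => ((x : ℕ) / M, (x : ℕ) % M)) ?_ ?_ ?_
    · intro x hx
      simp only [Finset.mem_filter, Finset.mem_univ, true_and, Set.mem_ofPred_eq] at hx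
      simp only [Finset.mem_product, Finset.mem_range, Finset.mem_filter]
      exact ⟨Nat.div_lt_of_lt_mul (hk ▸ x.2), Nat.mod_lt _ hM0, hx⟩
    · intro x _ y _ h
      simp only [Prod.mk.injEq] at h
      apply Fin.ext
      rw [← Nat.div_add_mod (x : ℕ) M, ← Nat.div_add_mod (y : ℕ) M, h.1, h.2]
    · rintro ⟨a, b⟩ h
      simp only [Finset.mem_product, Finset.mem_range, Finset.mem_filter] at h
      have hlt : M * a + b < 2 ^ w := by
        rw [hk]
        calc M * a + b < M * a + M := by omega
          _ = M * (a + 1) := by ring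
          _ ≤ M * k := Nat.mul_le_mul_left _ h.1
      have hmod : (M * a + b) % M = b := by rw [Nat.mul_add_mod, Nat.mod_eq_of_lt h.2.1]
      refine ⟨⟨M * a + b, hlt⟩, ?_, ?_⟩
      · simp [hmod, h.2.2]
      · simp [hmod, Nat.mul_add_div hM0, Nat.div_eq_of_lt h.2.1]
  rw [h1]
  have : (2 : ℝ) ^ w = M * k := by exact_mod_cast hk
  rw [this]
  push_cast
  rw [mul_comm, mul_div_mul_right _ _ (by positivity)]

end StarContraction

namespace StarContraction

/-! ### Positions of the priorities -/

variable {n w τ : ℕ} {upd : ℕ → Update n}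

lemma newPrio_apply (prio : Fin n → Fin n → ℕ) {e : Update n} (he : e.u ≠ e.v) (z z' : ℕ)
    (u v : Fin n) : newPrio prio e z z' u v =
      if e.ins = true ∧ u = e.u ∧ v = e.v then z
      else if e.ins = true ∧ u = e.v ∧ v = e.u then z' else prio u v := by
  rw [newPrio]
  by_cases h : e.ins = true
  · simp only [h, if_true, setPair, true_and]
    by_cases h1 : u = e.u ∧ v = e.v
    · rw [if_pos h1, if_neg (by rintro ⟨h2, -⟩; exact he (h1.1.symm.trans h2)), if_pos h1]
    · rw [if_neg h1]
      by_cases h2 : u = e.v ∧ v = e.u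
      · rw [if_pos h2, if_neg h1]
      · rw [if_neg h2, if_neg h1]
  · simp [h]

lemma prioPos_lt (hn : 0 < n) (hupd : ValidSeq upd) (t : ℕ) (u v : Fin n) :
    prioPos upd t u v < n + 2 * t := by
  induction t with
  | zero => simpa [prioPos] using hn
  | succ t ih =>
    rw [prioPos, newPrio_apply _ (hupd t).1]
    split_ifs <;> omega

lemma adj_succ (hupd : ValidSeq upd) {t : ℕ} {u v : Fin n} (h : (graphAt upd (t + 1)).Adj u v) :
    ((upd t).ins = true ∧ u = (upd t).u ∧ v = (upd t).v) ∨
    ((upd t).ins = true ∧ u = (upd t).v ∧ v = (upd t).u) ∨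
    ((graphAt upd t).Adj u v ∧ ¬ ((upd t).ins = true ∧ u = (upd t).u ∧ v = (upd t).v) ∧
      ¬ ((upd t).ins = true ∧ u = (upd t).v ∧ v = (upd t).u)) := by
  rw [graphAt, Update.apply_adj (hupd t).1, Sym2.eq_iff] at h
  by_cases hi : (upd t).ins = true
  · simp only [hi, if_true] at h
    simp only [hi, true_and]
    tauto
  · simp only [hi, Bool.false_eq_true, if_false, false_and, not_false_eq_true, and_true,
      false_or] at h ⊢
    exact h.1

/-- An edge that is present has been inserted, and insertions use cells behind the first `n`, which
belong to the coins. The default position `0` of other pairs thus never matters. -/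
lemma le_prioPos (hupd : ValidSeq upd) {t : ℕ} {u v : Fin n} (h : (graphAt upd t).Adj u v) :
    n ≤ prioPos upd t u v := by
  induction t with
  | zero => simp [graphAt] at h
  | succ t ih =>
    rw [prioPos, newPrio_apply _ (hupd t).1]
    rcases adj_succ hupd h with h1 | h1 | ⟨h1, h2, h3⟩
    · rw [if_pos h1]; omega
    · split_ifs <;> omega
    · rw [if_neg h2, if_neg h3]; exact ih h1

/-- Each insertion takes two cells behind all cells in use so far, by `prioPos_lt`. Distinct ordered
pairs of adjacent vertices therefore have independent priorities. -/
lemma prioPos_inj (hn : 0 < n) (hupd : ValidSeq upd) {t : ℕ} {u v u' v' : Fin n}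
    (h : (graphAt upd t).Adj u v) (h' : (graphAt upd t).Adj u' v')
    (he : prioPos upd t u v = prioPos upd t u' v') : u = u' ∧ v = v' := by
  induction t with
  | zero => simp [graphAt] at h
  | succ t ih =>
    rw [prioPos, newPrio_apply _ (hupd t).1, newPrio_apply _ (hupd t).1] at he
    have b := prioPos_lt hn hupd t u v
    have b' := prioPos_lt hn hupd t u' v'
    have hne := (hupd t).1
    rcases adj_succ hupd h with h1 | h1 | ⟨h1, h2, h3⟩ <;>
    rcases adj_succ hupd h' with g1 | g1 | ⟨g1, g2, g3⟩
    · exact ⟨h1.2.1.trans g1.2.1.symm, h1.2.2.trans g1.2.2.symm⟩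
    · rw [if_pos h1, if_neg (fun h => hne (h.2.1.symm.trans g1.2.1)), if_pos g1] at he; omega
    · rw [if_pos h1, if_neg g2, if_neg g3] at he; omega
    · rw [if_pos g1, if_neg (fun h => hne (h.2.1.symm.trans h1.2.1)), if_pos h1] at he; omega
    · exact ⟨h1.2.1.trans g1.2.1.symm, h1.2.2.trans g1.2.2.symm⟩
    · rw [if_neg (fun h => hne (h.2.1.symm.trans h1.2.1)), if_pos h1, if_neg g2, if_neg g3] at he
      omega
    · rw [if_pos g1, if_neg h2, if_neg h3] at he; omega
    · rw [if_neg h2, if_neg h3, if_neg (fun h => hne (h.2.1.symm.trans g1.2.1)), if_pos g1] at he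
      omega
    · rw [if_neg h2, if_neg h3, if_neg g2, if_neg g3] at he
      exact ih h1 g1 he

lemma coins_congr {ω ω' : Tape w} (h : ∀ i < n, ω i = ω' i) :
    coins n τ ω = coins n τ ω' := by
  funext v; rw [coins, coins, h v v.2]

lemma prioAt_congr (hn : 0 < n) (hupd : ValidSeq upd) {t : ℕ} {ω ω' : Tape w}
    (h : ∀ i < n + 2 * t, ω i = ω' i) : prioAt upd ω t = prioAt upd ω' t := by
  funext u v; rw [prioAt, prioAt, h _ (prioPos_lt hn hupd t u v)]

lemma centerAt_congr (hn : 0 < n) (hupd : ValidSeq upd) {t : ℕ} {ω ω' : Tape w}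
    (h : ∀ i < n + 2 * t, ω i = ω' i) : centerAt τ upd ω t = centerAt τ upd ω' t := by
  funext v
  rw [centerAt, centerAt, prioAt_congr hn hupd h, coins_congr fun i hi => h i (by omega)]

/-! ### The probability that a given vertex is the center of another one -/

/-- `v` is a center, and its priority at `u` is strictly larger than that of any other center. -/
def StrictMax (τ : ℕ) (upd : ℕ → Update n) (t : ℕ) (u v : Fin n) (ω : Tape w) : Prop :=
  coins n τ ω v = true ∧ ∀ x, x ≠ v → (graphAt upd t).Adj u x → coins n τ ω x = true →
    prioAt upd ω t u x % (2 ^ Nat.clog 2 n) ^ 5 < prioAt upd ω t u v % (2 ^ Nat.clog 2 n) ^ 5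

lemma measurableSet_strictMax (hn : 0 < n) (hupd : ValidSeq upd) (t : ℕ) (u v : Fin n) :
    MeasurableSet {ω : Tape w | StrictMax τ upd t u v ω} :=
  measurableSet_of_prefix (n + 2 * t) fun ω ω' h => by
    rw [StrictMax, StrictMax, prioAt_congr hn hupd h, coins_congr fun i hi => h i (by omega)]

lemma strictMax_disjoint {t : ℕ} {u v v' : Fin n} {ω : Tape w} (hv : (graphAt upd t).Adj u v)
    (hv' : (graphAt upd t).Adj u v') (h : StrictMax τ upd t u v ω)
    (h' : StrictMax τ upd t u v' ω) : v = v' := by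
  by_contra hne
  have h1 := h.2 v' (Ne.symm hne) hv' h'.1
  have h2 := h'.2 v hne hv h.1
  omega

/-- Exchanging the coins of `v` and `v'` together with their priorities at `u` is a permutation of
the tape that carries one event to the other. Whether `u` itself is a center plays no role in the
event, which keeps the symmetry perfect. -/
lemma tapeLaw_strictMax_eq (hn : 0 < n) (hupd : ValidSeq upd) {t : ℕ} {u v v' : Fin n}
    (hv : (graphAt upd t).Adj u v) (hv' : (graphAt upd t).Adj u v') :
    tapeLaw w {ω | StrictMax τ upd t u v ω} = tapeLaw w {ω | StrictMax τ upd t u v' ω} := by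
  by_cases hne : v = v'
  · rw [hne]
  let σ : Equiv.Perm ℕ := (Equiv.swap (v : ℕ) v').trans
    (Equiv.swap (prioPos upd t u v) (prioPos upd t u v'))
  have b := le_prioPos hupd hv
  have b' := le_prioPos hupd hv'
  have hvn := v.2
  have hvn' := v'.2
  have s1 : ∀ x : Fin n, σ x = Equiv.swap v v' x := by
    intro x
    have hx := x.2
    have : Equiv.swap (v : ℕ) v' x = Equiv.swap v v' x := by
      rw [Equiv.swap_apply_def, Equiv.swap_apply_def]
      simp only [Fin.ext_iff]
      split_ifs <;> rfl
    simp only [σ, Equiv.trans_apply, this]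
    have hx' := (Equiv.swap v v' x).2
    exact Equiv.swap_apply_of_ne_of_ne (by omega) (by omega)
  have s2 : ∀ x, (graphAt upd t).Adj u x →
      σ (prioPos upd t u x) = prioPos upd t u (Equiv.swap v v' x) := by
    intro x hx
    have bx := le_prioPos hupd hx
    simp only [σ, Equiv.trans_apply]
    rw [Equiv.swap_apply_of_ne_of_ne (a := (v : ℕ)) (by omega) (by omega)]
    by_cases h1 : x = v
    · rw [h1, Equiv.swap_apply_left, Equiv.swap_apply_left]
    by_cases h2 : x = v'
    · rw [h2, Equiv.swap_apply_right, Equiv.swap_apply_right]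
    rw [Equiv.swap_apply_of_ne_of_ne h1 h2, Equiv.swap_apply_of_ne_of_ne]
    · exact fun h => h1 (prioPos_inj hn hupd hx hv h).2
    · exact fun h => h2 (prioPos_inj hn hupd hx hv' h).2
  have hadj : ∀ x, (graphAt upd t).Adj u (Equiv.swap v v' x) ↔ (graphAt upd t).Adj u x := by
    intro x
    rw [Equiv.swap_apply_def]
    split_ifs with h1 h2
    · rw [h1]; simp [hv, hv']
    · rw [h2]; simp [hv, hv']
    · rfl
  have hpre : {ω : Tape w | StrictMax τ upd t u v ω} =
      (fun (ω : Tape w) i => ω (σ i)) ⁻¹' {ω | StrictMax τ upd t u v' ω} := by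
    ext ω
    have c1 : ∀ x : Fin n, coins n τ (fun i => ω (σ i)) x = coins n τ ω (Equiv.swap v v' x) := by
      intro x; simp only [coins, s1]
    have c2 : ∀ x, (graphAt upd t).Adj u x → prioAt upd (fun i => ω (σ i)) t u x =
        prioAt upd ω t u (Equiv.swap v v' x) := by
      intro x hx; simp only [prioAt, s2 x hx]
    simp only [Set.mem_preimage, Set.mem_ofPred_eq, StrictMax]
    rw [c1, c2 v' hv', Equiv.swap_apply_right]
    refine and_congr_right fun _ => ?_
    constructor
    · intro h x hx hxa hxc
      rw [c1] at hxc
      rw [c2 x hxa]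
      refine h _ ?_ ((hadj x).2 hxa) hxc
      intro e
      have := congrArg (Equiv.swap v v') e
      rw [Equiv.swap_apply_self, Equiv.swap_apply_left] at this
      exact hx this
    · intro h x hx hxa hxc
      have := h (Equiv.swap v v' x) ?_ ((hadj x).2 hxa) (by rw [c1, Equiv.swap_apply_self]; exact hxc)
      · rwa [c2 _ ((hadj x).2 hxa), Equiv.swap_apply_self] at this
      · intro e
        have := congrArg (Equiv.swap v v') e
        rw [Equiv.swap_apply_self, Equiv.swap_apply_right] at this
        exact hx this
  rw [hpre, (measurePreserving_perm σ).measure_preimage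
    (measurableSet_strictMax hn hupd t u v').nullMeasurableSet]

lemma deg_eq_card (G : SimpleGraph (Fin n)) [DecidableRel G.Adj] (u : Fin n) :
    deg G u = (Finset.univ.filter (G.Adj u)).card := by
  rw [deg, ← SimpleGraph.card_neighborFinset_eq_degree, SimpleGraph.neighborFinset_eq_filter]
  congr!

/-- The corresponding events for the neighbors of `u` are disjoint and equally likely. -/
lemma tapeLaw_strictMax_le (hn : 0 < n) (hupd : ValidSeq upd) {t : ℕ} {u v : Fin n}
    (hv : (graphAt upd t).Adj u v) :
    (tapeLaw w).real {ω | StrictMax τ upd t u v ω} ≤ 1 / deg (graphAt upd t) u := by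
  classical
  have hdisj : (tapeLaw w).real (⋃ x ∈ Finset.univ.filter ((graphAt upd t).Adj u),
      {ω | StrictMax τ upd t u x ω}) = ∑ x ∈ Finset.univ.filter ((graphAt upd t).Adj u),
      (tapeLaw w).real {ω | StrictMax τ upd t u x ω} := by
    refine measureReal_biUnion_finset ?_ (fun x _ => measurableSet_strictMax hn hupd t u x)
    intro x hx y hy hxy
    simp only [Finset.coe_filter, Finset.mem_univ, true_and, Set.mem_ofPred_eq] at hx hy
    rw [Function.onFun, Set.disjoint_left]
    exact fun ω h h' => hxy (strictMax_disjoint hx hy h h')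
  have hsum : ∑ x ∈ Finset.univ.filter ((graphAt upd t).Adj u),
      (tapeLaw w).real {ω | StrictMax τ upd t u x ω} =
      deg (graphAt upd t) u * (tapeLaw w).real {ω | StrictMax τ upd t u v ω} := by
    rw [deg_eq_card, ← nsmul_eq_mul, ← Finset.sum_const]
    refine Finset.sum_congr rfl fun x hx => ?_
    simp only [Finset.mem_filter, Finset.mem_univ, true_and] at hx
    rw [Measure.real, Measure.real, tapeLaw_strictMax_eq hn hupd hx hv]
  have hpos : 0 < deg (graphAt upd t) u := by
    rw [deg_eq_card]; exact Finset.card_pos.2 ⟨v, by simp [hv]⟩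
  rw [le_div_iff₀ (by exact_mod_cast hpos), mul_comm, ← hsum, ← hdisj]
  exact measureReal_le_one

/-- Two given priorities are equal with probability `1 / M`. -/
lemma tapeLaw_tie {M : ℕ} (hM : M ∣ 2 ^ w) {i j : ℕ} (hij : i ≠ j) :
    (tapeLaw w).real {ω | (ω i : ℕ) % M = (ω j : ℕ) % M} = 1 / M := by
  classical
  have hM0 : 0 < M := Nat.pos_of_dvd_of_pos hM (by positivity)
  have hU : {ω : Tape w | (ω i : ℕ) % M = (ω j : ℕ) % M} = ⋃ m ∈ Finset.range M,
      {ω : Tape w | ∀ b ∈ (Finset.univ : Finset Bool),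
        ω (if b then i else j) ∈ {x : Fin (2 ^ w) | (x : ℕ) % M = m}} := by
    ext ω
    simp only [Set.mem_ofPred_eq, Set.mem_iUnion, Finset.mem_range, Finset.mem_univ,
      forall_const, Bool.forall_bool, exists_prop]
    constructor
    · intro h
      exact ⟨_, Nat.mod_lt (ω i) hM0, by simp [h]⟩
    · rintro ⟨m, -, h1, h2⟩
      simp at h1 h2
      rw [h1, h2]
  rw [hU, measureReal_biUnion_finset]
  · have : ∀ m ∈ Finset.range M, (tapeLaw w).real {ω : Tape w | ∀ b ∈ (Finset.univ : Finset Bool),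
        ω (if b then i else j) ∈ {x : Fin (2 ^ w) | (x : ℕ) % M = m}} = 1 / M * (1 / M) := by
      intro m hm
      rw [Measure.real, tapeLaw_box (S := Finset.univ) (by
        intro a _ b _ hab
        cases a <;> cases b <;> simp_all), Fintype.prod_bool, ENNReal.toReal_mul]
      have := wordLaw_mod hM (fun y => y = m)
      rw [Measure.real, Finset.filter_eq', if_pos hm, Finset.card_singleton, Nat.cast_one] at this
      rw [this]
    rw [Finset.sum_congr rfl this, Finset.sum_const, Finset.card_range, nsmul_eq_mul]
    field_simp
  · intro m _ m' _ hne
    rw [Function.onFun, Set.disjoint_left]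
    intro ω h h'
    have h1 := h true (Finset.mem_univ _)
    have h2 := h' true (Finset.mem_univ _)
    exact hne (h1.symm.trans h2)
  · exact fun m _ => measurableSet_box _ _ _

/-- The modulus of the priorities. -/
lemma modulus_dvd (hn : 2 ≤ n) (τ : ℕ) : (2 ^ Nat.clog 2 n) ^ 5 ∣ 2 ^ starAlg.bits n τ := by
  rw [← pow_mul]
  have := (Nat.pow_le_pow_iff_right (by norm_num : 1 < 2)).1
    (by simpa [← pow_mul] using (sizes_starAlg hn τ).word)
  exact pow_dvd_pow _ (by omega)

/-- If `v` wins without a strictly largest priority, it ties with another neighbor. There are at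
most `n` candidates, and each tie has probability `1 / (2 ^ clog) ^ 5 ≤ 1 / n ^ 2`, so ties add at
most `1 / n ≤ 1 / deg`. -/
theorem centerAt_eq_le (hn : 2 ≤ n) (hupd : ValidSeq upd) {t : ℕ} {u v : Fin n}
    (hv : (graphAt upd t).Adj u v) :
    (tapeLaw (starAlg.bits n τ)).real {ω | centerAt τ upd ω t u = v + 1} ≤
      2 / deg (graphAt upd t) u := by
  classical
  set w := starAlg.bits n τ
  have hn0 : 0 < n := by omega
  have hsub : {ω : Tape w | centerAt τ upd ω t u = v + 1} ⊆
      {ω | StrictMax τ upd t u v ω} ∪ ⋃ x ∈ Finset.univ.filter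
        (fun x => (graphAt upd t).Adj u x ∧ x ≠ v),
        {ω | (ω (prioPos upd t u x) : ℕ) % (2 ^ Nat.clog 2 n) ^ 5 =
          (ω (prioPos upd t u v) : ℕ) % (2 ^ Nat.clog 2 n) ^ 5} := by
    intro ω hω
    simp only [Set.mem_ofPred_eq, centerAt] at hω
    by_contra hcon
    simp only [Set.mem_union, not_or, Set.mem_iUnion, Finset.mem_filter, Finset.mem_univ,
      true_and, Set.mem_ofPred_eq, not_exists] at hcon
    obtain ⟨h1, h2⟩ := hcon
    cases hu : coins n τ ω u
    · rcases centerOf_other (G := graphAt upd t) (l := Nat.clog 2 n) (prio := prioAt upd ω t) hu with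
        ⟨h3, -⟩ | ⟨r, h3, h4, h5, h6⟩
      · omega
      · have hr : r = v := Fin.ext (by omega)
        subst hr
        refine h1 ⟨h5, fun x hx hxa hxc => ?_⟩
        have h7 := h6 x
        rw [keyOf_pos hxa hxc, keyOf_pos h4 h5] at h7
        have h8 := h2 x ⟨hxa, hx⟩
        have hx2 := x.2
        have hr2 := r.2
        by_contra hlt
        have h9 : prioAt upd ω t u r % (2 ^ Nat.clog 2 n) ^ 5 + 1 ≤ prioAt upd ω t u x % (2 ^ Nat.clog 2 n) ^ 5 := by
          simp only [prioAt] at hlt ⊢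
          omega
        have h10 := Nat.mul_le_mul_right n h9
        rw [add_mul, one_mul] at h10
        omega
    · rw [centerOf_center hu] at hω
      have : u = v := Fin.ext (by omega)
      exact hv.ne this
  have hdeg : ((Finset.univ.filter fun x => (graphAt upd t).Adj u x ∧ x ≠ v).card : ℝ) ≤ n := by
    have := Finset.card_le_univ (Finset.univ.filter fun x => (graphAt upd t).Adj u x ∧ x ≠ v)
    rw [Fintype.card_fin] at this
    exact_mod_cast this
  have hd : (deg (graphAt upd t) u : ℝ) ≤ n := by
    have := Finset.card_le_univ (Finset.univ.filter ((graphAt upd t).Adj u))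
    rw [Fintype.card_fin, ← deg_eq_card] at this
    exact_mod_cast this
  have hpos : 0 < deg (graphAt upd t) u := by
    rw [deg_eq_card]; exact Finset.card_pos.2 ⟨v, by simp [hv]⟩
  have hpos' : (0 : ℝ) < deg (graphAt upd t) u := by exact_mod_cast hpos
  have hM : (n : ℝ) ^ 2 ≤ ((2 ^ Nat.clog 2 n) ^ 5 : ℕ) := by
    have h1 : n ≤ 2 ^ Nat.clog 2 n := Nat.le_pow_clog (by norm_num) n
    have h2 : n ^ 2 ≤ (2 ^ Nat.clog 2 n) ^ 5 := (Nat.pow_le_pow_left h1 2).trans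
      (Nat.pow_le_pow_right (by positivity) (by norm_num))
    exact_mod_cast h2
  have hn' : (0 : ℝ) < n := by exact_mod_cast hn0
  calc (tapeLaw w).real {ω | centerAt τ upd ω t u = v + 1} ≤ _ := measureReal_mono hsub
    _ ≤ _ := measureReal_union_le _ _
    _ ≤ 1 / deg (graphAt upd t) u + 1 / deg (graphAt upd t) u := by
        refine add_le_add (tapeLaw_strictMax_le hn0 hupd hv) ?_
        refine (measureReal_biUnion_finset_le _ _).trans ?_
        calc _ ≤ ∑ x ∈ Finset.univ.filter (fun x => (graphAt upd t).Adj u x ∧ x ≠ v),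
              (1 / ((2 ^ Nat.clog 2 n) ^ 5 : ℕ) : ℝ) := by
              refine Finset.sum_le_sum fun x hx => ?_
              simp only [Finset.mem_filter, Finset.mem_univ, true_and] at hx
              refine (tapeLaw_tie (modulus_dvd hn τ) ?_).le
              exact fun h => hx.2 (prioPos_inj hn0 hupd hx.1 hv h).2
          _ ≤ n * (1 / ((2 ^ Nat.clog 2 n) ^ 5 : ℕ)) := by
              rw [Finset.sum_const, nsmul_eq_mul]
              gcongr
          _ ≤ n * (1 / n ^ 2) := by gcongr
          _ = 1 / n := by field_simp
          _ ≤ 1 / deg (graphAt upd t) u := by gcongr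
    _ = 2 / deg (graphAt upd t) u := by ring

end StarContraction

namespace StarContraction

/-! ### Changes of centers -/

lemma tapeLaw_mono {w : ℕ} {A B : Set (Tape w)} (h : A ⊆ B) :
    (tapeLaw w).real A ≤ (tapeLaw w).real B :=
  measureReal_mono h (measure_ne_top _ _)

variable {n w τ l : ℕ} {upd : ℕ → Update n}

/-- Removing a key that is not the chosen maximum leaves the maximum alone. Phrased in terms of the
graph `G'` that contains the edge, this covers insertions and deletions alike. -/
lemma centerOf_eq_of_ne {G G' : SimpleGraph (Fin n)} {isC : Fin n → Bool}
    {prio prio' : Fin n → Fin n → ℕ} {u v : Fin n} (hle : ∀ x, G.Adj u x → G'.Adj u x)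
    (hadj : ∀ x, x ≠ v → G'.Adj u x → G.Adj u x) (hv : ¬ G.Adj u v)
    (hp : ∀ x, x ≠ v → prio u x = prio' u x) (hne : centerOf G' isC l prio' u ≠ v + 1) :
    centerOf G isC l prio u = centerOf G' isC l prio' u := by
  cases hu : isC u
  · rcases centerOf_other (G := G') (l := l) (prio := prio') hu with ⟨h, h1⟩ | ⟨r, h, h1, h2, h3⟩
    · rw [h, centerOf_eq_zero hu fun x hx => h1 x (hle x hx)]
    · have hr : r ≠ v := by rintro rfl; exact hne h
      have hk : ∀ x, x ≠ v → keyOf G isC l prio u x = keyOf G' isC l prio' u x := by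
        intro x hx
        by_cases hc : G.Adj u x ∧ isC x = true
        · rw [keyOf_pos hc.1 hc.2, keyOf_pos (hle x hc.1) hc.2, hp x hx]
        · rw [keyOf_neg hc, keyOf_neg (fun h => hc ⟨hadj x hx h.1, h.2⟩)]
      have hsup : Finset.univ.sup (keyOf G isC l prio u) =
          Finset.univ.sup (keyOf G' isC l prio' u) := by
        refine le_antisymm (Finset.sup_mono_fun fun x _ => ?_) (Finset.sup_le fun x _ => ?_)
        · by_cases hx : x = v
          · rw [hx, keyOf_neg (fun h => hv h.1)]; exact Nat.zero_le _
          · exact (hk x hx).le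
        · exact (h3 x).trans ((hk r hr).ge.trans (Finset.le_sup (Finset.mem_univ r)))
      simp only [centerOf, cenWord, hsup]
  · rw [centerOf_center hu, centerOf_center hu]

/-- The time at which the edge of update `t` is present. -/
def presentAt (upd : ℕ → Update n) (t : ℕ) : ℕ := if (upd t).ins then t + 1 else t

lemma presentAt_adj (hupd : ValidSeq upd) (t : ℕ) :
    (graphAt upd (presentAt upd t)).Adj (upd t).u (upd t).v := by
  rw [presentAt]
  split_ifs with h
  · rw [graphAt, Update.apply_adj (hupd t).1, if_pos h]; exact .inr rfl
  · exact (hupd t).2.2 (by simpa using h)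

lemma le_presentAt (hupd : ValidSeq upd) (t : ℕ) :
    graphAt upd t ≤ graphAt upd (presentAt upd t) := by
  intro x y hxy
  rw [presentAt]
  split_ifs with h
  · rw [graphAt, Update.apply_adj (hupd t).1, if_pos h]; exact .inl hxy
  · exact hxy

/-- Only the endpoints see a different neighborhood, and the key that appears or disappears there
matters only if it is the winning one while the edge is present. -/
lemma centerAt_change (hupd : ValidSeq upd) {t : ℕ} {x : Fin n} {ω : Tape w}
    (hx : centerAt τ upd ω (t + 1) x ≠ centerAt τ upd ω t x) :
    (x = (upd t).u ∧ centerAt τ upd ω (presentAt upd t) (upd t).u = (upd t).v + 1) ∨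
    (x = (upd t).v ∧ centerAt τ upd ω (presentAt upd t) (upd t).v = (upd t).u + 1) := by
  obtain ⟨hne, hval⟩ := hupd t
  have hadj := fun p q => Update.apply_adj (e := upd t) (G := graphAt upd t) hne (p := p) (q := q)
  have key : ∀ {u v : Fin n}, s(u, v) = s((upd t).u, (upd t).v) →
      centerAt τ upd ω (presentAt upd t) u ≠ v + 1 →
      centerAt τ upd ω (t + 1) u = centerAt τ upd ω t u := by
    intro u v huv hc
    have huv' := Sym2.eq_iff.1 huv
    have hp : ∀ x, x ≠ v → prioAt upd ω (t + 1) u x = prioAt upd ω t u x := by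
      intro x hx
      rw [prioAt_succ, newPrio_apply _ hne, if_neg, if_neg]
      · rintro ⟨-, h1, h2⟩
        rcases huv' with ⟨h3, h4⟩ | ⟨h3, h4⟩
        · exact hne (by rw [← h3, h1])
        · exact hx (by rw [h2, h4])
      · rintro ⟨-, h1, h2⟩
        rcases huv' with ⟨h3, h4⟩ | ⟨h3, h4⟩
        · exact hx (by rw [h2, h4])
        · exact hne (by rw [← h1, h3])
    have hs : ∀ x, x ≠ v → s(u, x) ≠ s((upd t).u, (upd t).v) := by
      intro x hx h
      rw [← huv, Sym2.eq_iff] at h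
      rcases h with h | h
      · exact hx h.2
      · exact hx (h.2.trans h.1)
    rw [presentAt] at hc
    by_cases hi : (upd t).ins = true
    · rw [if_pos hi] at hc
      refine (centerOf_eq_of_ne (v := v) ?_ ?_ ?_ (fun x hx => (hp x hx).symm) hc).symm
      · intro x hx; rw [graphAt, hadj, if_pos hi]; exact .inl hx
      · intro x hx h
        rw [graphAt, hadj, if_pos hi] at h
        exact h.resolve_right (hs x hx)
      · intro h
        have := hval.1 (adj_of_sym2_eq huv.symm h)
        simp [hi] at this
    · rw [if_neg hi] at hc
      refine centerOf_eq_of_ne (v := v) ?_ ?_ ?_ hp hc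
      · intro x hx; rw [graphAt, hadj, if_neg hi] at hx; exact hx.1
      · intro x hx h
        rw [graphAt, hadj, if_neg hi]
        exact ⟨h, hs x hx⟩
      · intro h
        rw [graphAt, hadj, if_neg hi] at h
        exact h.2 huv
  by_cases h1 : x = (upd t).u
  · subst h1
    by_contra hcon
    simp only [true_and, not_or] at hcon
    exact hx (key rfl hcon.1)
  by_cases h2 : x = (upd t).v
  · subst h2
    by_contra hcon
    simp only [true_and, not_or] at hcon
    exact hx (key Sym2.eq_swap hcon.2)
  refine absurd ?_ hx
  have hs : ∀ y, s(x, y) ≠ s((upd t).u, (upd t).v) := by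
    intro y h
    rcases Sym2.eq_iff.1 h with h | h
    · exact h1 h.1
    · exact h2 h.1
  refine centerOf_congr (fun y => ?_) fun y => ?_
  · rw [graphAt, hadj]
    split_ifs
    · exact ⟨fun h => h.resolve_right (hs y), .inl⟩
    · exact ⟨fun h => h.1, fun h => ⟨h, hs y⟩⟩
  · rw [prioAt_succ, newPrio_apply _ hne, if_neg (fun h => h1 h.2.1), if_neg (fun h => h2 h.2.1)]

lemma measurableSet_change (hn : 0 < n) (hupd : ValidSeq upd) (t : ℕ) (x : Fin n) :
    MeasurableSet {ω : Tape w | centerAt τ upd ω (t + 1) x ≠ centerAt τ upd ω t x} :=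
  measurableSet_of_prefix (n + 2 * (t + 1)) fun ω ω' h => by
    rw [centerAt_congr hn hupd h, centerAt_congr hn hupd fun i hi => h i (by omega)]

lemma centerAt_change_le (hn : 2 ≤ n) (hupd : ValidSeq upd) (t : ℕ) (x : Fin n) :
    (tapeLaw (starAlg.bits n τ)).real
      {ω | centerAt τ upd ω (t + 1) x ≠ centerAt τ upd ω t x} ≤
    if x = (upd t).u ∨ x = (upd t).v then (2 / deg (graphAt upd (presentAt upd t)) x : ℝ) else 0 := by
  have hne := (hupd t).1
  have hadj := presentAt_adj hupd t
  by_cases h1 : x = (upd t).u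
  · rw [if_pos (.inl h1)]
    subst h1
    refine (tapeLaw_mono fun ω hω => ?_).trans (centerAt_eq_le hn hupd hadj)
    rcases centerAt_change hupd hω with h | h
    · exact h.2
    · exact absurd h.1 hne
  by_cases h2 : x = (upd t).v
  · rw [if_pos (.inr h2)]
    subst h2
    refine (tapeLaw_mono fun ω hω => ?_).trans (centerAt_eq_le hn hupd hadj.symm)
    rcases centerAt_change hupd hω with h | h
    · exact absurd h.1.symm hne
    · exact h.2
  · rw [if_neg (by tauto)]
    have : {ω : Tape (starAlg.bits n τ) |
        centerAt τ upd ω (t + 1) x ≠ centerAt τ upd ω t x} = ∅ := by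
      rw [Set.eq_empty_iff_forall_notMem]
      intro ω hω
      rcases centerAt_change hupd hω with h | h
      · exact h1 h.1
      · exact h2 h.1
    rw [this]
    simp

lemma deg_mono {G G' : SimpleGraph (Fin n)} (h : G ≤ G') (x : Fin n) : deg G x ≤ deg G' x := by
  classical
  rw [deg_eq_card, deg_eq_card]
  refine Finset.card_le_card fun y hy => ?_
  simp only [Finset.mem_filter, Finset.mem_univ, true_and] at hy ⊢
  exact h hy

lemma deg_pos {G : SimpleGraph (Fin n)} {x y : Fin n} (h : G.Adj x y) : 0 < deg G x := by
  classical
  rw [deg_eq_card]; exact Finset.card_pos.2 ⟨y, by simp [h]⟩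

/-! ### The expected amount of work -/

lemma arrivalAt_eq (ω : Tape w) (t : ℕ) : (arrivalAt τ upd ω t : ℝ) = 2 + ∑ x,
    {ω : Tape w | centerAt τ upd ω (t + 1) x ≠ centerAt τ upd ω t x}.indicator
      (fun _ => (1 + 4 * deg (graphAt upd t) x : ℝ)) ω := by
  classical
  rw [arrivalAt]
  push_cast
  congr 1
  refine Finset.sum_congr rfl fun x _ => ?_
  rw [Set.indicator_apply]
  congr!

lemma integrable_arrivalAt (hn : 0 < n) (hupd : ValidSeq upd) (t : ℕ) :
    Integrable (fun ω : Tape w => (arrivalAt τ upd ω t : ℝ)) (tapeLaw w) := by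
  simp_rw [arrivalAt_eq]
  exact (integrable_const _).add (integrable_finsetSum _ fun x _ =>
    (integrable_const _).indicator (measurableSet_change hn hupd t x))

/-- With `D` the degree of an endpoint while the edge is present, its center changes with
probability at most `2 / D` and then creates at most `1 + 4 D ≤ 5 D` units. Two endpoints and the
constant `2` give `2 * 10 + 2 = 22`. -/
lemma integral_arrivalAt_le (hn : 2 ≤ n) (hupd : ValidSeq upd) (t : ℕ) :
    ∫ ω, (arrivalAt τ upd ω t : ℝ) ∂tapeLaw (starAlg.bits n τ) ≤ 22 := by
  classical
  have hn0 : 0 < n := by omega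
  simp_rw [arrivalAt_eq]
  rw [integral_add (integrable_const _) (integrable_finsetSum _ fun x _ =>
    (integrable_const _).indicator (measurableSet_change hn0 hupd t x)),
    integral_finsetSum _ fun x _ =>
      (integrable_const _).indicator (measurableSet_change hn0 hupd t x)]
  simp only [integral_const, integral_indicator_const _ (measurableSet_change hn0 hupd t _),
    smul_eq_mul, probReal_univ, one_mul]
  have hadj := presentAt_adj hupd t
  have h1 : ∀ x, (tapeLaw (starAlg.bits n τ)).real
      {ω | centerAt τ upd ω (t + 1) x ≠ centerAt τ upd ω t x} *
        (1 + 4 * deg (graphAt upd t) x) ≤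
      if x = (upd t).u ∨ x = (upd t).v then 10 else 0 := by
    intro x
    have h2 := centerAt_change_le (τ := τ) hn hupd t x
    by_cases hx : x = (upd t).u ∨ x = (upd t).v
    · rw [if_pos hx] at h2 ⊢
      have hd : 0 < deg (graphAt upd (presentAt upd t)) x := by
        rcases hx with rfl | rfl
        · exact deg_pos hadj
        · exact deg_pos hadj.symm
      have hd1 : (1 : ℝ) ≤ deg (graphAt upd (presentAt upd t)) x := by exact_mod_cast hd
      have hd2 : (deg (graphAt upd t) x : ℝ) ≤ deg (graphAt upd (presentAt upd t)) x := by
        exact_mod_cast deg_mono (le_presentAt hupd t) x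
      calc _ ≤ 2 / (deg (graphAt upd (presentAt upd t)) x : ℝ) *
            (5 * deg (graphAt upd (presentAt upd t)) x) := by
            gcongr
            linarith
        _ = 10 := by field_simp; norm_num
    · rw [if_neg hx] at h2 ⊢
      have h3 : (0 : ℝ) ≤ 1 + 4 * deg (graphAt upd t) x := by positivity
      exact mul_nonpos_of_nonpos_of_nonneg h2 h3
  have h2 : ∑ x : Fin n, (if x = (upd t).u ∨ x = (upd t).v then (10 : ℝ) else 0) ≤ 20 := by
    rw [← Finset.sum_filter, Finset.sum_const, nsmul_eq_mul]
    have : (Finset.univ.filter fun x => x = (upd t).u ∨ x = (upd t).v).card ≤ 2 := by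
      refine (Finset.card_le_card (t := {(upd t).u, (upd t).v}) fun x hx => ?_).trans
        Finset.card_le_two
      simpa using hx
    have : ((Finset.univ.filter fun x => x = (upd t).u ∨ x = (upd t).v).card : ℝ) ≤ 2 := by
      exact_mod_cast this
    linarith
  linarith [Finset.sum_le_sum fun x (_ : x ∈ Finset.univ) => h1 x]

/-- A queue that is not empty at time `t` has received many arrivals in some recent interval. -/
lemma exists_busy_interval {q a : ℕ → ℕ} {b H t : ℕ} (h0 : q 0 = 0) (hH : ∀ s, q s ≤ H)
    (hq : ∀ s, q (s + 1) ≤ q s + a s - (b + 1)) (ht : q t ≠ 0) :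
    ∃ k, 1 ≤ k ∧ k ≤ min H t ∧ b * k ≤ ∑ i ∈ Finset.range k, a (t - 1 - i) := by
  have key : ∀ j ≤ min H t, (∃ k, 1 ≤ k ∧ k ≤ min H t ∧
      b * k ≤ ∑ i ∈ Finset.range k, a (t - 1 - i)) ∨
      q t + (b + 1) * j ≤ q (t - j) + ∑ i ∈ Finset.range j, a (t - 1 - i) := by
    intro j
    induction j with
    | zero => intro _; right; simp
    | succ j ih =>
      intro hj
      rcases ih (by omega) with h | h
      · exact .inl h
      -- The queue was empty `j` steps ago: all service since then was paid for by arrivals, so `j`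
      -- is the required length. Otherwise the subtraction in `hq` is not truncated and one more
      -- step back can be taken.
      by_cases hz : q (t - j) = 0
      · left
        refine ⟨j, ?_, by omega, ?_⟩
        · rcases Nat.eq_zero_or_pos j with rfl | h'
          · exact absurd hz ht
          · exact h'
        · rw [hz, add_mul] at h
          omega
      · right
        have hs := hq (t - (j + 1))
        rw [show t - (j + 1) + 1 = t - j by omega] at hs
        rw [Finset.sum_range_succ, show t - 1 - j = t - (j + 1) by omega, mul_add, mul_one]
        omega
  have ht0 : t ≠ 0 := by rintro rfl; exact ht h0
  have hHt := hH t
  rcases key (min H t) le_rfl with h | h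
  · exact h
  · refine ⟨min H t, by omega, le_rfl, ?_⟩
    rw [add_mul, one_mul] at h
    -- If the queue was nonempty all the way, its content at the start is at most `H`; spread over
    -- `H` steps this costs one unit of service per step, which is why `b` remains of `b + 1`.
    rcases le_total H t with h' | h'
    · have := hH (t - min H t)
      rw [min_eq_left h'] at *
      omega
    · rw [min_eq_right h', Nat.sub_self, h0] at h
      rw [min_eq_right h']
      omega

/-- Many arrivals before time `t`. -/
def Busy (τ : ℕ) (upd : ℕ → Update n) (t : ℕ) (ω : Tape w) : Prop :=
  ∃ k, 1 ≤ k ∧ k ≤ min (4 * (n * n)) t ∧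
    (Nat.clog 2 n ^ 3 + 1) * k ≤ ∑ i ∈ Finset.range k, arrivalAt τ upd ω (t - 1 - i)

lemma measurableSet_busy (hn : 0 < n) (hupd : ValidSeq upd) (t : ℕ) :
    MeasurableSet {ω : Tape w | Busy τ upd t ω} := by
  refine measurableSet_of_prefix (n + 2 * t) fun ω ω' h => ?_
  have h1 : ∀ s < t, arrivalAt τ upd ω s = arrivalAt τ upd ω' s := by
    intro s hs
    rw [arrivalAt, arrivalAt, centerAt_congr (t := s + 1) hn hupd fun i hi => h i (by omega),
      centerAt_congr (t := s) hn hupd fun i hi => h i (by omega)]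
  refine exists_congr fun k => and_congr_right fun hk1 => and_congr_right fun hk => ?_
  rw [Finset.sum_congr rfl fun i hi => h1 (t - 1 - i) (by omega)]

/-- A maximal inequality without independence: the weight `1 / (i + 1)` of the update `i` steps back
is at least `1 / k` for all `i < k`, so the single sum `F` dominates the averages over all windows.
Its expectation is at most `22` times a harmonic number, and Markov's inequality applies. -/
lemma tapeLaw_busy_le (hn : 2 ≤ n) (hupd : ValidSeq upd) (t : ℕ) :
    (tapeLaw (starAlg.bits n τ)).real {ω | Busy τ upd t ω} ≤
      22 * (1 + Real.log (4 * (n * n) : ℕ)) / ((Nat.clog 2 n : ℝ) ^ 3 + 1) := by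
  have hn0 : 0 < n := by omega
  set K := min (4 * (n * n)) t with hK
  let F : Tape (starAlg.bits n τ) → ℝ := fun ω =>
    ∑ i ∈ Finset.range K, (arrivalAt τ upd ω (t - 1 - i) : ℝ) * ((i : ℝ) + 1)⁻¹
  have hint : ∀ i, Integrable (fun ω : Tape (starAlg.bits n τ) =>
      (arrivalAt τ upd ω (t - 1 - i) : ℝ) * ((i : ℝ) + 1)⁻¹) (tapeLaw (starAlg.bits n τ)) :=
    fun i => (integrable_arrivalAt hn0 hupd _).mul_const _
  have hF : Integrable F (tapeLaw (starAlg.bits n τ)) :=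
    integrable_finsetSum _ fun i _ => hint i
  have hF0 : ∀ ω, 0 ≤ F ω := fun ω => Finset.sum_nonneg fun i _ => by positivity
  have hsub : {ω | Busy τ upd t ω} ⊆ {ω | (Nat.clog 2 n : ℝ) ^ 3 + 1 ≤ F ω} := by
    rintro ω ⟨k, hk1, hk, hb⟩
    have hk0 : (0 : ℝ) < k := by exact_mod_cast hk1
    have hb' : ((Nat.clog 2 n : ℝ) ^ 3 + 1) * k ≤
        ∑ i ∈ Finset.range k, (arrivalAt τ upd ω (t - 1 - i) : ℝ) := by exact_mod_cast hb
    calc (Nat.clog 2 n : ℝ) ^ 3 + 1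
        ≤ (∑ i ∈ Finset.range k, (arrivalAt τ upd ω (t - 1 - i) : ℝ)) * (k : ℝ)⁻¹ := by
          rwa [← div_eq_mul_inv, le_div_iff₀ hk0]
      _ = ∑ i ∈ Finset.range k, (arrivalAt τ upd ω (t - 1 - i) : ℝ) * (k : ℝ)⁻¹ :=
          Finset.sum_mul _ _ _
      _ ≤ ∑ i ∈ Finset.range k, (arrivalAt τ upd ω (t - 1 - i) : ℝ) * ((i : ℝ) + 1)⁻¹ := by
          refine Finset.sum_le_sum fun i hi => ?_
          have : i + 1 ≤ k := Finset.mem_range.1 hi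
          have : (i : ℝ) + 1 ≤ k := by exact_mod_cast this
          gcongr
      _ ≤ F ω := Finset.sum_le_sum_of_subset_of_nonneg
          (Finset.range_subset_range.2 hk) fun i _ _ => by positivity
  have hEF : ∫ ω, F ω ∂tapeLaw (starAlg.bits n τ) ≤ 22 * (1 + Real.log (4 * (n * n) : ℕ)) := by
    calc ∫ ω, F ω ∂tapeLaw (starAlg.bits n τ)
        = ∑ i ∈ Finset.range K, (∫ ω, (arrivalAt τ upd ω (t - 1 - i) : ℝ)
            ∂tapeLaw (starAlg.bits n τ)) * ((i : ℝ) + 1)⁻¹ := by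
          rw [integral_finsetSum _ fun i _ => hint i]
          exact Finset.sum_congr rfl fun i _ => integral_mul_const _ _
      _ ≤ ∑ i ∈ Finset.range K, 22 * ((i : ℝ) + 1)⁻¹ := by
          refine Finset.sum_le_sum fun i _ => ?_
          have := integral_arrivalAt_le (τ := τ) hn hupd (t - 1 - i)
          gcongr
      _ ≤ ∑ i ∈ Finset.range (4 * (n * n)), 22 * ((i : ℝ) + 1)⁻¹ :=
          Finset.sum_le_sum_of_subset_of_nonneg
            (Finset.range_subset_range.2 (min_le_left _ _)) fun i _ _ => by positivity
      _ = 22 * (harmonic (4 * (n * n)) : ℝ) := by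
          rw [← Finset.mul_sum, harmonic]; push_cast; rfl
      _ ≤ 22 * (1 + Real.log (4 * (n * n) : ℕ)) := by
          gcongr
          exact harmonic_le_one_add_log _
  have hb : (0 : ℝ) < (Nat.clog 2 n : ℝ) ^ 3 + 1 := by positivity
  rw [le_div_iff₀ hb, mul_comm]
  calc _ ≤ ((Nat.clog 2 n : ℝ) ^ 3 + 1) *
        (tapeLaw (starAlg.bits n τ)).real {ω | (Nat.clog 2 n : ℝ) ^ 3 + 1 ≤ F ω} := by
        exact mul_le_mul_of_nonneg_left (tapeLaw_mono hsub) hb.le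
    _ ≤ _ := (mul_meas_ge_le_integral_of_nonneg (.of_forall hF0) hF _).trans hEF

lemma exists_runAt_of_not_busy (hn : 2 ≤ n) (hupd : ValidSeq upd)
    {ω : Tape (starAlg.bits n τ)} {t : ℕ} (h : ¬ Busy τ upd t ω) :
    ∃ d, RunAt τ upd ω t d ∧ d.pending = 0 := by
  obtain ⟨d, hd, h0, hs⟩ := exists_run hn hupd ω
  refine ⟨d t, hd t, ?_⟩
  by_contra ht
  exact h (exists_busy_interval (q := fun s => (d s).pending) h0
    (fun s => Data.pending_le hn (d s)) hs ht)

/-! ### Stability of the centers -/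

lemma deg_le_deg_succ (hupd : ValidSeq upd) (t : ℕ) (x : Fin n) :
    deg (graphAt upd t) x ≤ deg (graphAt upd (t + 1)) x + 1 := by
  classical
  rw [deg_eq_card, deg_eq_card]
  set y := if x = (upd t).u then (upd t).v else (upd t).u with hy
  refine (Finset.card_le_card (t := insert y (Finset.univ.filter
    ((graphAt upd (t + 1)).Adj x))) fun z hz => ?_).trans (Finset.card_insert_le _ _)
  simp only [Finset.mem_filter, Finset.mem_univ, true_and, Finset.mem_insert] at hz ⊢
  by_cases hs : s(x, z) = s((upd t).u, (upd t).v)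
  · left
    rcases Sym2.eq_iff.1 hs with h | h
    · rw [hy, if_pos h.1, h.2]
    · rw [hy, if_neg (by rw [h.1]; exact (hupd t).1.symm), h.2]
  · right
    rw [graphAt, Update.apply_adj (hupd t).1]
    split_ifs
    · exact .inl hz
    · exact ⟨hz, hs⟩

lemma deg_le_deg_add (hupd : ValidSeq upd) (t k : ℕ) (x : Fin n) :
    deg (graphAt upd t) x ≤ deg (graphAt upd (t + k)) x + k := by
  induction k with
  | zero => simp
  | succ k ih =>
    have := deg_le_deg_succ hupd (t + k) x
    rw [add_assoc t k 1] at this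
    omega

lemma minDeg_le_deg (G : SimpleGraph (Fin n)) (x : Fin n) : minDeg G ≤ deg G x := by
  classical
  rw [minDeg, deg]
  exact SimpleGraph.minDegree_le_degree _ _

/-- During `N ≤ δ / 2` updates all degrees stay at least `δ / 2`, so each endpoint changes its
center with probability at most `4 / δ`. The union bound `8 N / δ` is at most `8 c / log ^ 3 n`. -/
theorem starAlg_stable :
    ∀ c : ℝ, ∃ C : ℝ, ∀ n τ : ℕ, 2 ≤ n → 1 ≤ τ → ∀ upd : ℕ → Update n, ValidSeq upd →
        ∀ t N : ℕ, Real.log n ^ 4 < (minDeg (graphAt upd t) : ℝ) →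
          (N : ℝ) ≤ c * minDeg (graphAt upd t) / Real.log n ^ 3 →
          tapeLaw (starAlg.bits n τ)
            {ω | ∃ s, t ≤ s ∧ s < t + N ∧ ∃ v,
              (starAlg.outputAt τ upd ω (s + 1)).center v ≠
                (starAlg.outputAt τ upd ω s).center v} ≤
            ENNReal.ofReal (C / Real.log n ^ 2) := by
  intro c
  refine ⟨16 * c, fun n τ hn hτ upd hupd t N hδ hN => ?_⟩
  classical
  set δ := minDeg (graphAt upd t) with hδdef
  have hlog := half_le_log hn
  have hlog0 : 0 < Real.log n := by linarith
  have hδ0 : (0 : ℝ) < δ := lt_of_le_of_lt (by positivity) hδ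
  have hc : 0 ≤ c := by
    by_contra hc
    have : c * δ / Real.log n ^ 3 < 0 := div_neg_of_neg_of_pos
      (mul_neg_of_neg_of_pos (not_le.1 hc) hδ0) (by positivity)
    have := Nat.cast_nonneg (α := ℝ) N
    linarith
  rw [← ofReal_measureReal]
  refine ENNReal.ofReal_le_ofReal ?_
  rw [le_div_iff₀ (by positivity)]
  -- For `log ^ 3 n < 2 c` the hypothesis does not give `N ≤ δ / 2`, but then `n` is bounded in
  -- terms of `c` and the trivial bound `1` is good enough.
  rcases lt_or_ge (Real.log n ^ 3) (2 * c) with hsmall | hbig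
  · have h1 : (tapeLaw (starAlg.bits n τ)).real
            {ω | ∃ s, t ≤ s ∧ s < t + N ∧ ∃ v,
              (starAlg.outputAt τ upd ω (s + 1)).center v ≠
                (starAlg.outputAt τ upd ω s).center v} ≤ 1 := measureReal_le_one
    have h2 : Real.log n ^ 2 ≤ 2 * Real.log n ^ 3 := by
      have : 0 ≤ Real.log n ^ 2 := by positivity
      nlinarith
    calc _ ≤ 1 * Real.log n ^ 2 := by gcongr
      _ ≤ 16 * c := by linarith
  have hN2 : (N : ℝ) ≤ δ / 2 := by
    refine hN.trans ?_
    rw [div_le_div_iff₀ (by positivity) (by norm_num)]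
    nlinarith
  have hsub : {ω : Tape (starAlg.bits n τ) | ∃ s, t ≤ s ∧ s < t + N ∧ ∃ v,
      (starAlg.outputAt τ upd ω (s + 1)).center v ≠ (starAlg.outputAt τ upd ω s).center v} ⊆
      ⋃ i ∈ Finset.range N, ⋃ x ∈ ({(upd (t + i)).u, (upd (t + i)).v} : Finset (Fin n)),
        {ω | centerAt τ upd ω (t + i + 1) x ≠ centerAt τ upd ω (t + i) x} := by
    rintro ω ⟨s, hs1, hs2, v, hv⟩
    obtain ⟨d, hd, -⟩ := exists_run hn hupd ω
    rw [(hd _).center, (hd _).center] at hv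
    have hv' : centerAt τ upd ω (s + 1) v ≠ centerAt τ upd ω s v := fun h => hv (by rw [h])
    obtain ⟨i, rfl⟩ := Nat.exists_eq_add_of_le hs1
    simp only [Set.mem_iUnion]
    refine ⟨i, by simpa using hs2, v, ?_, hv'⟩
    rcases centerAt_change hupd hv' with h | h
    · simp [h.1]
    · simp [h.1]
  have hterm : ∀ i ∈ Finset.range N,
      ∀ x ∈ ({(upd (t + i)).u, (upd (t + i)).v} : Finset (Fin n)),
      (tapeLaw (starAlg.bits n τ)).real
        {ω | centerAt τ upd ω (t + i + 1) x ≠ centerAt τ upd ω (t + i) x} ≤ 4 / δ := by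
    intro i hi x hx
    have hi' : i < N := Finset.mem_range.1 hi
    refine (centerAt_change_le hn hupd (t + i) x).trans ?_
    rw [if_pos (by simpa using hx)]
    have h1 : deg (graphAt upd t) x ≤ deg (graphAt upd (t + i)) x + i := deg_le_deg_add hupd t i x
    have h2 := deg_mono (le_presentAt hupd (t + i)) x
    have h3 := minDeg_le_deg (graphAt upd t) x
    have h4 : δ ≤ deg (graphAt upd (presentAt upd (t + i))) x + N := by omega
    have h5 : (δ : ℝ) ≤ deg (graphAt upd (presentAt upd (t + i))) x + N := by exact_mod_cast h4
    rw [div_le_div_iff₀ (by linarith) hδ0]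
    linarith
  have hcard : ∀ i, ((({(upd (t + i)).u, (upd (t + i)).v} : Finset (Fin n)).card : ℕ) : ℝ) ≤ 2 :=
    fun i => by exact_mod_cast Finset.card_le_two
  calc _ ≤ (N * (2 * (4 / δ))) * Real.log n ^ 2 := by
        gcongr
        refine (tapeLaw_mono hsub).trans ?_
        refine (measureReal_biUnion_finset_le _ _).trans ?_
        calc _ ≤ ∑ i ∈ Finset.range N, 2 * (4 / (δ : ℝ)) := by
              refine Finset.sum_le_sum fun i hi => ?_
              refine (measureReal_biUnion_finset_le _ _).trans ?_
              refine (Finset.sum_le_sum (hterm i hi)).trans ?_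
              rw [Finset.sum_const, nsmul_eq_mul]
              gcongr
              exact hcard i
          _ = N * (2 * (4 / δ)) := by simp
    _ ≤ ((c * δ / Real.log n ^ 3) * (2 * (4 / δ))) * Real.log n ^ 2 := by gcongr
    _ = 8 * c / Real.log n := by field_simp; ring
    _ ≤ 16 * c := by
        rw [div_le_iff₀ hlog0]
        nlinarith

end StarContraction

namespace StarContraction

/-! ### The probability of being a center -/

variable {n w τ l : ℕ}

lemma sum_div_le (B k J : ℕ) : ((∑ j ∈ Finset.Ico 1 (J + 1), B / k ^ j / j : ℕ) : ℝ) ≤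
    B * ∑ i ∈ Finset.range J, ((k : ℝ)⁻¹) ^ (i + 1) / (i + 1) := by
  rw [Finset.sum_Ico_eq_sum_range, Nat.add_sub_cancel, Finset.mul_sum]
  push_cast
  refine Finset.sum_le_sum fun i _ => ?_
  rw [Nat.div_div_eq_div_mul, add_comm 1 i]
  refine Nat.cast_div_le.trans (le_of_eq ?_)
  push_cast
  rw [inv_pow, div_eq_mul_inv, mul_inv, div_eq_mul_inv]

lemma le_sum_div (B J : ℕ) {k : ℕ} (hk : 0 < k) :
    B * ∑ i ∈ Finset.range J, ((k : ℝ)⁻¹) ^ (i + 1) / (i + 1) ≤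
    ((∑ j ∈ Finset.Ico 1 (J + 1), B / k ^ j / j : ℕ) : ℝ) + J := by
  rw [Finset.sum_Ico_eq_sum_range, Nat.add_sub_cancel, Finset.mul_sum]
  push_cast
  have : (J : ℝ) = ∑ i ∈ Finset.range J, (1 : ℝ) := by simp
  rw [this, ← Finset.sum_add_distrib]
  refine Finset.sum_le_sum fun i _ => ?_
  rw [Nat.div_div_eq_div_mul, add_comm 1 i]
  have hpos : 0 < k ^ (i + 1) * (i + 1) := by positivity
  have h := Nat.lt_mul_div_succ B hpos
  have h' : (B : ℝ) ≤ ((k ^ (i + 1) * (i + 1) : ℕ) : ℝ) *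
      (((B / (k ^ (i + 1) * (i + 1)) : ℕ) : ℝ) + 1) := by exact_mod_cast h.le
  have hpos' : (0 : ℝ) < ((k ^ (i + 1) * (i + 1) : ℕ) : ℝ) := by exact_mod_cast hpos
  calc (B : ℝ) * ((k : ℝ)⁻¹ ^ (i + 1) / (i + 1)) = B / ((k ^ (i + 1) * (i + 1) : ℕ) : ℝ) := by
        push_cast
        rw [inv_pow, div_eq_mul_inv, div_eq_mul_inv, mul_inv]
    _ ≤ _ := by rwa [div_le_iff₀' hpos']

lemma log_sub_log {k : ℕ} (hk : 2 ≤ k) :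
    Real.log k - Real.log ((k - 1 : ℕ) : ℝ) = -Real.log (1 - (k : ℝ)⁻¹) := by
  have h1 : (k : ℝ) ≠ 0 := by positivity
  have h2 : ((k - 1 : ℕ) : ℝ) ≠ 0 := by
    have : k - 1 ≠ 0 := by omega
    exact_mod_cast this
  have h3 : 1 - (k : ℝ)⁻¹ = ((k - 1 : ℕ) : ℝ) / k := by
    rw [Nat.cast_sub (by omega)]
    field_simp
    simp
  rw [h3, Real.log_div h2 h1]
  ring

lemma log_eq_sum (hn : 1 ≤ n) : Real.log n =
    ∑ k ∈ Finset.Ico 2 (n + 1), (Real.log k - Real.log ((k - 1 : ℕ) : ℝ)) := by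
  induction n, hn using Nat.le_induction with
  | base => simp
  | succ n hn ih =>
    rw [Finset.sum_Ico_succ_top (by omega), ← ih]
    simp

/-- All terms of the series of `-log (1 - x)` at `x = 1 / k` are nonnegative, and for `x ≤ 1 / 2`
the remainder `x ^ (J + 1) / (1 - x)` is at most `(1 / 2) ^ J`. -/
lemma log_bounds {k : ℕ} (hk : 2 ≤ k) (J : ℕ) :
    ∑ i ∈ Finset.range J, ((k : ℝ)⁻¹) ^ (i + 1) / (i + 1) ≤ -Real.log (1 - (k : ℝ)⁻¹) ∧
    -Real.log (1 - (k : ℝ)⁻¹) ≤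
      ∑ i ∈ Finset.range J, ((k : ℝ)⁻¹) ^ (i + 1) / (i + 1) + (1 / 2) ^ J := by
  have hk' : (2 : ℝ) ≤ k := by exact_mod_cast hk
  have hx0 : (0 : ℝ) ≤ (k : ℝ)⁻¹ := by positivity
  have hx : (k : ℝ)⁻¹ ≤ 1 / 2 := by rw [one_div]; gcongr
  have habs : |(k : ℝ)⁻¹| < 1 := by rw [abs_of_nonneg hx0]; linarith
  constructor
  · exact sum_le_hasSum _ (fun i _ => by positivity) (Real.hasSum_pow_div_log_of_abs_lt_one habs)
  · have h := (abs_le.1 (Real.abs_log_sub_add_sum_range_le habs J)).1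
    rw [abs_of_nonneg hx0] at h
    have h2 : (k : ℝ)⁻¹ ^ (J + 1) / (1 - (k : ℝ)⁻¹) ≤ (1 / 2) ^ J := by
      rw [div_le_iff₀ (by linarith)]
      calc (k : ℝ)⁻¹ ^ (J + 1) ≤ (1 / 2) ^ (J + 1) := by gcongr
        _ = (1 / 2) ^ J * (1 / 2) := pow_succ _ _
        _ ≤ (1 / 2) ^ J * (1 - (k : ℝ)⁻¹) := by gcongr; linarith
    linarith

/-- By telescoping, `log n` is the sum of `-log (1 - 1 / k)` over `2 ≤ k ≤ n`; truncating these
series and rounding terms down can only lose. -/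
lemma logSum_le_log (hn : 1 ≤ n) (l : ℕ) :
    (logSum n l : ℝ) ≤ ((2 : ℝ) ^ l) ^ 8 * Real.log n := by
  rw [logSum, log_eq_sum hn, Nat.cast_sum, Finset.mul_sum]
  refine Finset.sum_le_sum fun k hk => ?_
  have hk2 : 2 ≤ k := (Finset.mem_Ico.1 hk).1
  rw [log_sub_log hk2]
  refine (sum_div_le _ _ _).trans ?_
  push_cast
  gcongr
  exact (log_bounds hk2 _).1

/-- For each `k`, rounding loses at most `1` in each of `8 l` terms, and truncation loses at most
`(2 ^ l) ^ 8 * (1 / 2) ^ (8 * l) = 1`. -/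
lemma log_le_logSum (hn : 1 ≤ n) (l : ℕ) :
    ((2 : ℝ) ^ l) ^ 8 * Real.log n ≤ logSum n l + n * (8 * l + 1) := by
  have h1 : ((2 : ℝ) ^ l) ^ 8 * Real.log n ≤ logSum n l +
      ∑ k ∈ Finset.Ico 2 (n + 1), (8 * (l : ℝ) + 1) := by
    rw [logSum, log_eq_sum hn, Nat.cast_sum, Finset.mul_sum, ← Finset.sum_add_distrib]
    refine Finset.sum_le_sum fun k hk => ?_
    have hk2 : 2 ≤ k := (Finset.mem_Ico.1 hk).1
    rw [log_sub_log hk2]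
    have h2 := le_sum_div ((2 ^ l) ^ 8) (8 * l) (k := k) (by omega)
    have h3 := (log_bounds hk2 (8 * l)).2
    have h4 : ((2 : ℝ) ^ l) ^ 8 * (1 / 2) ^ (8 * l) = 1 := by
      rw [← pow_mul, mul_comm l 8, ← mul_pow]; norm_num
    push_cast at h2
    push_cast
    calc ((2 : ℝ) ^ l) ^ 8 * -Real.log (1 - (k : ℝ)⁻¹) ≤ ((2 : ℝ) ^ l) ^ 8 *
          (∑ i ∈ Finset.range (8 * l), ((k : ℝ)⁻¹) ^ (i + 1) / (i + 1) + (1 / 2) ^ (8 * l)) := by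
          gcongr
      _ ≤ _ := by rw [mul_add, h4]; linarith
  refine h1.trans ?_
  rw [Finset.sum_const, Nat.card_Ico, nsmul_eq_mul]
  gcongr
  omega

/-- The probability that a vertex becomes a center. -/
noncomputable def coinProb (n τ l : ℕ) : ℝ :=
  ((Finset.range ((2 ^ l) ^ 5)).filter fun y =>
    (y + 1) * ((2 ^ l) ^ 8 * τ) ≤ 800 * ((2 ^ l) ^ 5 * logSum n l)).card / ((2 ^ l) ^ 5 : ℕ)

lemma wordLaw_coin (hM : (2 ^ l) ^ 5 ∣ 2 ^ w) :
    (wordLaw w).real {x | coin n τ l x = true} = coinProb n τ l := by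
  rw [coinProb, ← wordLaw_mod hM]
  congr 1
  ext x
  simp [coin]

lemma coinProb_eq (hτ : 1 ≤ τ) : coinProb n τ l =
    (min ((2 ^ l) ^ 5) (800 * ((2 ^ l) ^ 5 * logSum n l) / ((2 ^ l) ^ 8 * τ)) : ℕ) /
      ((2 ^ l) ^ 5 : ℕ) := by
  rw [coinProb]
  congr 2
  rw [← Finset.card_range (min _ _)]
  congr 1
  ext y
  rw [Finset.mem_filter, Finset.mem_range, Finset.mem_range,
    ← Nat.le_div_iff_mul_le (by positivity), lt_min_iff]
  rfl

lemma coinProb_nonneg : 0 ≤ coinProb n τ l := by rw [coinProb]; positivity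

lemma coe_centerProb (hn : 1 ≤ n) :
    (centerProb n τ : ℝ) = min 1 (800 * Real.log n / τ) := by
  have : 0 ≤ Real.log n := Real.log_nonneg (by exact_mod_cast hn)
  rw [centerProb, NNReal.coe_min, NNReal.coe_one, Real.coe_toNNReal _ (by positivity)]

/-- All rounding goes downwards. The one-sided error matters: the probability of not becoming a
center is then at least that of the static procedure. -/
lemma coinProb_le (hn : 1 ≤ n) (hτ : 1 ≤ τ) : coinProb n τ l ≤ centerProb n τ := by
  have hM : (0 : ℝ) < ((2 ^ l) ^ 5 : ℕ) := by positivity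
  have hτ' : (0 : ℝ) < τ := by exact_mod_cast hτ
  rw [coe_centerProb hn, coinProb_eq hτ, Nat.cast_min, ← min_div_div_right hM.le, div_self hM.ne']
  refine min_le_min le_rfl ?_
  rw [div_le_iff₀ hM]
  refine Nat.cast_div_le.trans ?_
  have h := logSum_le_log hn l
  push_cast
  rw [div_le_iff₀ (by positivity)]
  calc (800 : ℝ) * ((2 ^ l) ^ 5 * logSum n l) ≤ 800 * ((2 ^ l) ^ 5 * ((2 ^ l) ^ 8 * Real.log n)) := by
        gcongr
    _ = _ := by field_simp

/-- With `S = 2 ^ l`, the scaled logarithm is off by at most `n (8 l + 1) ≤ 9 S ^ 2`, which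
contributes `800 * 9 / (S ^ 6 τ)`; the granularity of the random words contributes `1 / S ^ 5`. -/
lemma le_coinProb (hn : 2 ≤ n) (hτ : 1 ≤ τ) (hnl : n ≤ 2 ^ l) :
    min 1 (800 * Real.log n / τ - (7200 / ((2 ^ l) ^ 6 * τ) + 1 / (2 ^ l) ^ 5)) ≤
      coinProb n τ l := by
  have hM : (0 : ℝ) < ((2 ^ l) ^ 5 : ℕ) := by positivity
  have hτ' : (0 : ℝ) < τ := by exact_mod_cast hτ
  rw [coinProb_eq hτ, Nat.cast_min, ← min_div_div_right hM.le, div_self hM.ne']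
  refine min_le_min le_rfl ?_
  rw [le_div_iff₀ hM]
  set X := 800 * ((2 ^ l) ^ 5 * logSum n l)
  have hD : 0 < (2 ^ l) ^ 8 * τ := by positivity
  have h := Nat.lt_mul_div_succ X hD
  have h' : (X : ℝ) ≤ (((2 ^ l) ^ 8 * τ : ℕ) : ℝ) *
      (((X / ((2 ^ l) ^ 8 * τ) : ℕ) : ℝ) + 1) := by exact_mod_cast h.le
  have hD' : (0 : ℝ) < (((2 ^ l) ^ 8 * τ : ℕ) : ℝ) := by exact_mod_cast hD
  rw [← div_le_iff₀' hD'] at h'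
  have hlog := log_le_logSum (n := n) (by omega) l
  have hl : (l : ℝ) ≤ 2 ^ l := by exact_mod_cast (Nat.lt_two_pow_self (n := l)).le
  have h1S : (1 : ℝ) ≤ 2 ^ l := one_le_pow₀ (by norm_num)
  have hn' : (n : ℝ) ≤ 2 ^ l := by exact_mod_cast hnl
  have herr : (n : ℝ) * (8 * l + 1) ≤ 9 * (2 ^ l) ^ 2 := by
    calc (n : ℝ) * (8 * l + 1) ≤ 2 ^ l * (8 * 2 ^ l + 2 ^ l) := by gcongr
      _ = _ := by ring
  have hX : (X : ℝ) / (((2 ^ l) ^ 8 * τ : ℕ) : ℝ) ≥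
      (800 * Real.log n / τ - 7200 / ((2 ^ l) ^ 6 * τ)) * ((2 ^ l) ^ 5 : ℕ) := by
    rw [ge_iff_le, le_div_iff₀ hD']
    simp only [X]
    push_cast
    calc (800 * Real.log n / τ - 7200 / ((2 ^ l) ^ 6 * τ)) * ((2 : ℝ) ^ l) ^ 5 *
          (((2 : ℝ) ^ l) ^ 8 * τ) =
          800 * (((2 : ℝ) ^ l) ^ 5 * (((2 : ℝ) ^ l) ^ 8 * Real.log n - 9 * (2 ^ l) ^ 2)) := by
          field_simp
          ring
      _ ≤ 800 * ((2 ^ l) ^ 5 * (logSum n l : ℝ)) := by gcongr; linarith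
  have hone : (1 : ℝ) / (2 ^ l) ^ 5 * ((2 ^ l) ^ 5 : ℕ) = 1 := by push_cast; field_simp
  rw [← sub_sub, sub_mul, hone]
  linarith

/-- The additive error becomes a relative one because the exact probability is at least `1 / τ`,
while `τ ≤ 2 ^ l` turns the error `1 / (2 ^ l) ^ 5` into `1 / ((2 ^ l) ^ 4 τ)` at most. -/
lemma centerProb_mul_le (hn : 2 ≤ n) (hτ : 1 ≤ τ) (hnl : n ≤ 2 ^ l) (hτn : τ ≤ n) :
    (1 - 7201 / (2 ^ l) ^ 4) * centerProb n τ ≤ coinProb n τ l := by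
  have hτ1 : (1 : ℝ) ≤ τ := by exact_mod_cast hτ
  have hτ' : (0 : ℝ) < τ := by linarith
  have hlog := half_le_log hn
  have h1S : (1 : ℝ) ≤ 2 ^ l := one_le_pow₀ (by norm_num)
  have hτS : (τ : ℝ) ≤ 2 ^ l := by exact_mod_cast hτn.trans hnl
  have hp : 1 / (τ : ℝ) ≤ centerProb n τ := by
    rw [coe_centerProb (by omega)]
    refine le_min ?_ ?_
    · rw [div_le_one hτ']; exact hτ1
    · gcongr; linarith
  have h1 := le_coinProb hn hτ hnl
  set η : ℝ := 7200 / ((2 ^ l) ^ 6 * τ) + 1 / (2 ^ l) ^ 5 with hη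
  have hη0 : 0 ≤ η := by positivity
  have h2 : (centerProb n τ : ℝ) - η ≤ min 1 (800 * Real.log n / τ - η) := by
    rw [coe_centerProb (by omega)]
    refine le_min ?_ ?_
    · linarith [min_le_left (1 : ℝ) (800 * Real.log n / τ)]
    · linarith [min_le_right (1 : ℝ) (800 * Real.log n / τ)]
  have h3 : η ≤ 7201 / (2 ^ l) ^ 4 * centerProb n τ := by
    calc η ≤ 7200 / ((2 ^ l) ^ 4 * τ) + 1 / ((2 ^ l) ^ 4 * τ) := by
          rw [hη]
          gcongr
          · norm_num
          · rw [pow_succ _ 4]; gcongr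
      _ = 7201 / (2 ^ l) ^ 4 * (1 / τ) := by field_simp; norm_num
      _ ≤ _ := by gcongr
  linarith

/-- With `q` for `coinProb n τ l`, either `q = 1`, or `(1 - q) ^ τ ≤ exp (-q τ)` with `q τ ≥ 800 log
n - 200 ≥ 2 log n`; the last step uses `log n ≥ 1 / 2`. -/
lemma one_sub_coinProb_pow_le (hn : 2 ≤ n) (hτ : 1 ≤ τ) (hnl : n ≤ 2 ^ l) (hτn : τ ≤ n) :
    (1 - coinProb n τ l) ^ τ ≤ 7201 / (n : ℝ) ^ 2 := by
  have hτ1 : (1 : ℝ) ≤ τ := by exact_mod_cast hτ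
  have hτ' : (0 : ℝ) < τ := by linarith
  have hlog := half_le_log hn
  have hn2 : (2 : ℝ) ≤ n := by exact_mod_cast hn
  have hnS : (n : ℝ) ≤ 2 ^ l := by exact_mod_cast hnl
  have h2S : (2 : ℝ) ≤ 2 ^ l := hn2.trans hnS
  have hτS : (τ : ℝ) ≤ 2 ^ l := by exact_mod_cast hτn.trans hnl
  have h1 := le_coinProb hn hτ hnl
  have hle : coinProb n τ l ≤ 1 := (coinProb_le (by omega) hτ).trans (by
    rw [coe_centerProb (by omega)]; exact min_le_left _ _)
  set η : ℝ := 7200 / ((2 ^ l) ^ 6 * τ) + 1 / (2 ^ l) ^ 5 with hη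
  rcases le_or_gt 1 (800 * Real.log n / τ - η) with hx | hx
  · rw [min_eq_left hx] at h1
    have : coinProb n τ l = 1 := le_antisymm hle h1
    rw [this, sub_self, zero_pow (by omega)]
    positivity
  rw [min_eq_right hx.le] at h1
  have hητ : η * τ ≤ 200 := by
    have h6 : (64 : ℝ) ≤ (2 ^ l) ^ 6 := by
      calc (64 : ℝ) = 2 ^ 6 := by norm_num
        _ ≤ _ := by gcongr
    have e1 : 7200 / (((2 : ℝ) ^ l) ^ 6 * τ) * τ = 7200 / (2 ^ l) ^ 6 := by field_simp
    have e2 : 1 / ((2 : ℝ) ^ l) ^ 5 * τ ≤ 1 := by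
      rw [div_mul_eq_mul_div, one_mul, div_le_one (by positivity)]
      exact hτS.trans (le_self_pow₀ (by linarith) (by norm_num))
    have e3 : 7200 / ((2 : ℝ) ^ l) ^ 6 ≤ 7200 / 64 := by gcongr
    rw [hη, add_mul, e1]
    linarith
  have h2 : 2 * Real.log n ≤ coinProb n τ l * τ := by
    calc 2 * Real.log n ≤ 800 * Real.log n - η * τ := by linarith
      _ = (800 * Real.log n / τ - η) * τ := by field_simp
      _ ≤ _ := by gcongr
  calc (1 - coinProb n τ l) ^ τ ≤ (Real.exp (-coinProb n τ l)) ^ τ := by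
        exact pow_le_pow_left₀ (by linarith)
          (by linarith [Real.add_one_le_exp (-coinProb n τ l)]) _
    _ = Real.exp (-(coinProb n τ l * τ)) := by rw [← Real.exp_nat_mul]; ring_nf
    _ ≤ Real.exp (-(2 * Real.log n)) := by gcongr
    _ = 1 / (n : ℝ) ^ 2 := by
        rw [Real.exp_neg, mul_comm, Real.exp_mul, Real.exp_log (by linarith)]
        norm_num
    _ ≤ _ := by gcongr; norm_num

end StarContraction

namespace StarContraction

/-! ### Comparison with the static procedure -/

variable {n w τ : ℕ} {upd : ℕ → Update n}

/-- A discrete form of `∫ x ^ k = x ^ (k + 1) / (k + 1)`: by Bernoulli's inequality, the step from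
`M` to `M + 1` raises the left side by at most `(k + 1) (M + 1) ^ k`. -/
lemma pow_le_mul_sum_pow (k M : ℕ) :
    (M : ℝ) ^ (k + 1) ≤ (k + 1) * ∑ m ∈ Finset.range (M + 1), (m : ℝ) ^ k := by
  induction M with
  | zero => simp; positivity
  | succ M ih =>
    rw [Finset.sum_range_succ, mul_add]
    have hx : (0 : ℝ) < M + 1 := by positivity
    have h := one_add_mul_le_pow (a := -(1 / ((M : ℝ) + 1))) (by
      have : 1 / ((M : ℝ) + 1) ≤ 1 := by
        rw [div_le_one hx]; have : (0 : ℝ) ≤ M := Nat.cast_nonneg _; linarith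
      linarith) (k + 1)
    have e : 1 + -(1 / ((M : ℝ) + 1)) = M / (M + 1) := by field_simp; ring
    rw [e, div_pow, le_div_iff₀ (by positivity)] at h
    have e2 : (1 + ((k + 1 : ℕ) : ℝ) * -(1 / ((M : ℝ) + 1))) * ((M : ℝ) + 1) ^ (k + 1) =
        ((M : ℝ) + 1) ^ (k + 1) - (k + 1) * ((M : ℝ) + 1) ^ k := by
      push_cast
      field_simp
      ring
    rw [e2] at h
    push_cast
    linarith

/-- The probability that the first of `k` independent uniform elements of `{0, …, M - 1}` is
strictly larger than the others. -/
lemma le_sum_strictMax {k M : ℕ} (hk : 1 ≤ k) (hM : 1 ≤ M) :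
    (1 - (k : ℝ) / M) * (1 / k) ≤ ∑ m ∈ Finset.range M, 1 / (M : ℝ) * ((m : ℝ) / M) ^ (k - 1) := by
  obtain ⟨k, rfl⟩ := Nat.exists_eq_add_of_le' hk
  obtain ⟨M, rfl⟩ := Nat.exists_eq_add_of_le' hM
  rw [Nat.add_sub_cancel]
  have hx : (0 : ℝ) < (M : ℝ) + 1 := by positivity
  have h1 := pow_le_mul_sum_pow k M
  have h := one_add_mul_le_pow (a := -(1 / ((M : ℝ) + 1))) (by
      have : 1 / ((M : ℝ) + 1) ≤ 1 := by
        rw [div_le_one hx]; have : (0 : ℝ) ≤ M := Nat.cast_nonneg _; linarith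
      linarith) (k + 1)
  have e : 1 + -(1 / ((M : ℝ) + 1)) = M / (M + 1) := by field_simp; ring
  rw [e, div_pow] at h
  have hsum : ∑ m ∈ Finset.range (M + 1), 1 / (((M + 1 : ℕ) : ℝ)) *
      ((m : ℝ) / ((M + 1 : ℕ) : ℝ)) ^ k =
      (∑ m ∈ Finset.range (M + 1), (m : ℝ) ^ k) / ((M : ℝ) + 1) ^ (k + 1) := by
    rw [Finset.sum_div]
    refine Finset.sum_congr rfl fun m _ => ?_
    push_cast
    rw [div_pow, pow_succ]
    field_simp
  rw [hsum]
  push_cast at h ⊢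
  calc (1 - ((k : ℝ) + 1) / (M + 1)) * (1 / (k + 1))
      = (1 + ((k : ℝ) + 1) * -(1 / (M + 1))) * (1 / (k + 1)) := by ring
    _ ≤ (M : ℝ) ^ (k + 1) / (M + 1) ^ (k + 1) * (1 / (k + 1)) := by gcongr
    _ ≤ ((k + 1) * ∑ m ∈ Finset.range (M + 1), (m : ℝ) ^ k) / (M + 1) ^ (k + 1) * (1 / (k + 1)) := by
        gcongr
    _ = _ := by field_simp

lemma mem_centerNbrs {G : SimpleGraph (Fin n)} {R : Fin n → Bool} {u r : Fin n} :
    r ∈ centerNbrs G R u ↔ G.Adj u r ∧ R r = true := by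
  simp [centerNbrs]

/-- The possible values of the choice of a vertex. -/
lemma choiceLaw_cases {G : SimpleGraph (Fin n)} {R : Fin n → Bool} {u : Fin n}
    (hdeg : τ ≤ deg G u) {x : Option (Fin n)} (hx : (choiceLaw G τ R u x).toReal ≠ 0) :
    (R u = true ∧ x = some u ∧ (choiceLaw G τ R u x).toReal = 1) ∨
    (R u = false ∧ centerNbrs G R u = ∅ ∧ x = none ∧ (choiceLaw G τ R u x).toReal = 1) ∨
    (R u = false ∧ ∃ r ∈ centerNbrs G R u, x = some r ∧
      (choiceLaw G τ R u x).toReal = 1 / (centerNbrs G R u).card) := by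
  classical
  by_cases hu : R u = true
  · simp only [choiceLaw, if_pos hu, PMF.pure_apply] at hx ⊢
    left
    by_cases h : x = some u
    · simp [hu, h]
    · simp [h] at hx
  · right
    have hu' : R u = false := by simpa using hu
    by_cases hne : (centerNbrs G R u).Nonempty
    · right
      refine ⟨hu', ?_⟩
      rw [choiceLaw, if_neg hu, dif_pos ⟨hdeg, hne⟩] at hx ⊢
      cases x with
      | none =>
        exfalso
        apply hx
        rw [PMF.map_apply]
        simp
      | some r =>
        have e : ((PMF.uniformOfFinset (centerNbrs G R u) hne).map some) (some r) =
            PMF.uniformOfFinset (centerNbrs G R u) hne r := by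
          rw [PMF.map_apply, tsum_eq_single r]
          · simp
          · intro b hb
            simp [Ne.symm hb]
        rw [e] at hx ⊢
        rw [PMF.uniformOfFinset_apply] at hx ⊢
        by_cases hr : r ∈ centerNbrs G R u
        · refine ⟨r, hr, rfl, ?_⟩
          simp [hr]
        · simp [hr] at hx
    · left
      rw [choiceLaw, if_neg hu, dif_neg (fun h => hne h.2)] at hx ⊢
      refine ⟨hu', Finset.not_nonempty_iff_eq_empty.1 hne, ?_⟩
      rw [PMF.pure_apply] at hx ⊢
      by_cases h : x = none
      · simp [h]
      · simp [h] at hx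

/-- The vertex map that the algorithm maintains. -/
noncomputable def centerMapAt (τ : ℕ) (upd : ℕ → Update n) (t : ℕ) (ω : Tape w) : CenterMap n :=
  fun v => decodeVertex n (centerAt τ upd ω t v)

/-- The coordinates of the tape that determine the centers. -/
def tapePos (upd : ℕ → Update n) (t : ℕ) : Fin n ⊕ (_ : Fin n) × Fin n → ℕ
  | .inl v => v
  | .inr x => prioPos upd t x.1 x.2

/-! ### Events that prescribe the centers, the choices and the winning priorities. -/

section box

variable {t : ℕ} {R : Fin n → Bool} {c : Fin n → Option (Fin n)}

/-- The set of words admitted at a coordinate, if the centers are `R` and the largest priority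
at `u`, which is that of `c u`, is `m u`. -/
def boxSet (n τ w : ℕ) (R : Fin n → Bool) (c : Fin n → Option (Fin n)) (m : Fin n → ℕ) :
    Fin n ⊕ (_ : Fin n) × Fin n → Set (Fin (2 ^ w))
  | .inl v => {x | coin n τ (Nat.clog 2 n) x = R v}
  | .inr x => {y | if c x.1 = some x.2 then (y : ℕ) % (2 ^ Nat.clog 2 n) ^ 5 = m x.1
      else (y : ℕ) % (2 ^ Nat.clog 2 n) ^ 5 < m x.1}

/-- The coordinates that matter if the centers are `R`. -/
noncomputable def boxIdx (G : SimpleGraph (Fin n)) (R : Fin n → Bool) :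
    Finset (Fin n ⊕ (_ : Fin n) × Fin n) :=
  Finset.univ.disjSum (Finset.univ.sigma fun u => if R u then ∅ else centerNbrs G R u)

/-- The event that the centers are `R` and the largest priorities are `m`, at the vertices `c`. -/
def box (τ : ℕ) (upd : ℕ → Update n) (t : ℕ) (R : Fin n → Bool) (c : Fin n → Option (Fin n))
    (m : Fin n → ℕ) : Set (Tape w) :=
  {ω | ∀ i ∈ boxIdx (graphAt upd t) R, ω (tapePos upd t i) ∈ boxSet n τ w R c m i}

lemma mem_boxIdx_inr {G : SimpleGraph (Fin n)} {u r : Fin n} :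
    Sum.inr ⟨u, r⟩ ∈ boxIdx G R ↔ R u = false ∧ r ∈ centerNbrs G R u := by
  rw [boxIdx, Finset.inr_mem_disjSum, Finset.mem_sigma]
  cases h : R u <;> simp

lemma tapePos_injOn (hn : 0 < n) (hupd : ValidSeq upd) (t : ℕ) (R : Fin n → Bool) :
    Set.InjOn (tapePos upd t) (boxIdx (graphAt upd t) R) := by
  rintro (v | ⟨u, r⟩) hx (v' | ⟨u', r'⟩) hy h
  · exact congrArg _ (Fin.ext h)
  · have := le_prioPos hupd (mem_centerNbrs.1 (mem_boxIdx_inr.1 hy).2).1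
    have := v.2
    simp only [tapePos] at h
    omega
  · have := le_prioPos hupd (mem_centerNbrs.1 (mem_boxIdx_inr.1 hx).2).1
    have := v'.2
    simp only [tapePos] at h
    omega
  · obtain ⟨h1, h2⟩ := prioPos_inj hn hupd (mem_centerNbrs.1 (mem_boxIdx_inr.1 hx).2).1
      (mem_centerNbrs.1 (mem_boxIdx_inr.1 hy).2).1 h
    subst h1 h2
    rfl

/-- A strictly larger priority outweighs the vertex number in the key: it contributes at least `n`
more, while the vertex parts lie between `1` and `n`. -/
lemma box_subset (hc : ∀ u, (R u = true ∧ c u = some u) ∨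
      (R u = false ∧ centerNbrs (graphAt upd t) R u = ∅ ∧ c u = none) ∨
      (R u = false ∧ ∃ r ∈ centerNbrs (graphAt upd t) R u, c u = some r)) (m : Fin n → ℕ) :
    (box τ upd t R c m : Set (Tape w)) ⊆
      {ω | coins n τ ω = R ∧ centerMapAt τ upd t ω = c} := by
  intro ω hω
  have hR : coins n τ ω = R := by
    funext v
    exact hω (.inl v) (by simp [boxIdx])
  refine ⟨hR, funext fun u => ?_⟩
  have hpr : ∀ r, R u = false → r ∈ centerNbrs (graphAt upd t) R u →
      if c u = some r then prioAt upd ω t u r % (2 ^ Nat.clog 2 n) ^ 5 = m u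
      else prioAt upd ω t u r % (2 ^ Nat.clog 2 n) ^ 5 < m u := fun r hu hr =>
    hω (.inr ⟨u, r⟩) (mem_boxIdx_inr.2 ⟨hu, hr⟩)
  rw [centerMapAt, centerAt, hR]
  rcases hc u with ⟨h1, h2⟩ | ⟨h1, h2, h3⟩ | ⟨h1, r, h2, h3⟩
  · rw [centerOf_center h1, decodeVertex_succ, h2]
  · rw [centerOf_eq_zero h1, decodeVertex_zero, h3]
    intro v hv
    by_contra hne
    have : v ∈ centerNbrs (graphAt upd t) R u := mem_centerNbrs.2 ⟨hv, by simpa using hne⟩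
    rw [h2] at this
    simp at this
  · obtain ⟨h4, h5⟩ := mem_centerNbrs.1 h2
    rw [centerOf_eq h1 h4 h5, decodeVertex_succ, h3]
    intro x hx
    rw [keyOf_pos h4 h5]
    by_cases hxx : (graphAt upd t).Adj u x ∧ R x = true
    · rw [keyOf_pos hxx.1 hxx.2]
      have g1 := hpr r h1 h2
      have g2 := hpr x h1 (mem_centerNbrs.2 hxx)
      rw [if_pos h3] at g1
      rw [h3, if_neg (by simpa using Ne.symm hx), ← g1] at g2
      have g3 := Nat.mul_le_mul_right n g2
      rw [Nat.succ_mul] at g3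
      have := x.2
      omega
    · rw [keyOf_neg hxx]
      omega

lemma wordLaw_coin_eq (hn : 2 ≤ n) (b : Bool) :
    (wordLaw (starAlg.bits n τ)).real {x | coin n τ (Nat.clog 2 n) x = b} =
      if b then coinProb n τ (Nat.clog 2 n) else 1 - coinProb n τ (Nat.clog 2 n) := by
  have h := wordLaw_coin (n := n) (τ := τ) (modulus_dvd hn τ)
  cases b
  · have : {x : Fin (2 ^ starAlg.bits n τ) | coin n τ (Nat.clog 2 n) x = false} =
        {x : Fin (2 ^ starAlg.bits n τ) | coin n τ (Nat.clog 2 n) x = true}ᶜ := by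
      ext x; simp
    rw [this, probReal_compl_eq_one_sub (Set.Finite.measurableSet (Set.toFinite _)), h]
    simp
  · rw [h]; simp

lemma tapeLaw_box_eq (hn : 2 ≤ n) (hupd : ValidSeq upd) {m : Fin n → ℕ}
    (hm : ∀ u, m u < (2 ^ Nat.clog 2 n) ^ 5) :
    (tapeLaw (starAlg.bits n τ)).real (box τ upd t R c m) =
      (∏ v, if R v then coinProb n τ (Nat.clog 2 n) else 1 - coinProb n τ (Nat.clog 2 n)) *
      ∏ u, ∏ r ∈ (if R u then ∅ else centerNbrs (graphAt upd t) R u),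
        if c u = some r then 1 / (((2 ^ Nat.clog 2 n) ^ 5 : ℕ) : ℝ)
        else (m u : ℝ) / (((2 ^ Nat.clog 2 n) ^ 5 : ℕ) : ℝ) := by
  rw [box, Measure.real, tapeLaw_box (tapePos_injOn (by omega) hupd t R), ENNReal.toReal_prod,
    boxIdx, Finset.prod_disjSum, Finset.prod_sigma]
  congr 1
  · exact Finset.prod_congr rfl fun v _ => wordLaw_coin_eq hn (R v)
  · refine Finset.prod_congr rfl fun u _ => Finset.prod_congr rfl fun r _ => ?_
    change (wordLaw (starAlg.bits n τ)).real {y | if c u = some r then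
      (y : ℕ) % (2 ^ Nat.clog 2 n) ^ 5 = m u else (y : ℕ) % (2 ^ Nat.clog 2 n) ^ 5 < m u} = _
    by_cases h : c u = some r
    · simp only [if_pos h]
      rw [wordLaw_mod (modulus_dvd hn τ) (fun y => y = m u), Finset.filter_eq',
        if_pos (Finset.mem_range.2 (hm u)), Finset.card_singleton, Nat.cast_one]
    · simp only [if_neg h]
      rw [wordLaw_mod (modulus_dvd hn τ) (fun y => y < m u)]
      have hf : (Finset.range ((2 ^ Nat.clog 2 n) ^ 5)).filter (fun y => y < m u) =
          Finset.range (m u) := by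
        ext y
        have := hm u
        simp only [Finset.mem_filter, Finset.mem_range]
        omega
      rw [hf, Finset.card_range]

/-- The event contains the disjoint union, over all vectors `m` of winning priorities, of product
boxes. Expanding the product over the vertices, each coin and each choice has at least `1 - ε` times
its static probability, and `(1 - ε) ^ (2 n) ≥ 1 - 2 n ε`. Ties are simply dropped, as only a lower
bound is needed. -/
lemma le_tapeLaw_coins_center (hn : 2 ≤ n) (hupd : ValidSeq upd) (hτ : 1 ≤ τ) (hτn : τ ≤ n)
    (hdeg : ∀ u, τ ≤ deg (graphAt upd t) u) :
    (1 - 2 * n * (7201 / (2 ^ Nat.clog 2 n) ^ 4)) *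
      ((∏ v, (centerCoin n τ (R v)).toReal) *
        ∏ u, (choiceLaw (graphAt upd t) τ R u (c u)).toReal) ≤
    (tapeLaw (starAlg.bits n τ)).real {ω | coins n τ ω = R ∧ centerMapAt τ upd t ω = c} := by
  classical
  set G := graphAt upd t
  set ε : ℝ := 7201 / (2 ^ Nat.clog 2 n) ^ 4 with hε
  have hε0 : 0 ≤ ε := by positivity
  have hprod0 : 0 ≤ (∏ v, (centerCoin n τ (R v)).toReal) *
      ∏ u, (choiceLaw G τ R u (c u)).toReal := by positivity
  by_cases hε1 : 1 - 2 * n * ε ≤ 0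
  · exact (mul_nonpos_of_nonpos_of_nonneg hε1 hprod0).trans measureReal_nonneg
  have hn2 : (2 : ℝ) ≤ n := by exact_mod_cast hn
  have hε1' : ε ≤ 1 := by nlinarith
  by_cases hz : ∃ u, (choiceLaw G τ R u (c u)).toReal = 0
  · obtain ⟨u, hu⟩ := hz
    have h0 : ∏ u, (choiceLaw G τ R u (c u)).toReal = 0 :=
      Finset.prod_eq_zero (Finset.mem_univ u) hu
    rw [h0, mul_zero, mul_zero]
    exact measureReal_nonneg
  push Not at hz
  have hcases := fun u => choiceLaw_cases (hdeg u) (hz u)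
  set M := (2 ^ Nat.clog 2 n) ^ 5 with hM
  have hM1 : 1 ≤ M := Nat.one_le_pow _ _ (by positivity)
  have hM0 : (0 : ℝ) < M := by exact_mod_cast hM1
  have hnS : n ≤ 2 ^ Nat.clog 2 n := Nat.le_pow_clog (by norm_num) n
  have hnS' : (n : ℝ) ≤ 2 ^ Nat.clog 2 n := by exact_mod_cast hnS
  -- Vertices that make no choice get the dummy value `0`, so that the boxes are not counted
  -- repeatedly.
  let I : Fin n → Finset ℕ := fun u =>
    if R u = false ∧ (centerNbrs G R u).Nonempty then Finset.range M else {0}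
  have hI : ∀ u, ∀ x ∈ I u, x < M := by
    intro u x hx
    simp only [I] at hx
    split_ifs at hx
    · exact Finset.mem_range.1 hx
    · rw [Finset.mem_singleton.1 hx]; omega
  let g : Fin n → ℕ → ℝ := fun u x => ∏ r ∈ (if R u then ∅ else centerNbrs G R u),
        if c u = some r then 1 / (M : ℝ) else (x : ℝ) / (M : ℝ)
  -- Summing over the winning priority gives the probability that the chosen neighbor wins strictly,
  -- which by `le_sum_strictMax` misses `1 / card` only by the relative error `card / M ≤ ε`.
  have hg : ∀ u, (1 - ε) * (choiceLaw G τ R u (c u)).toReal ≤ ∑ x ∈ I u, g u x := by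
    intro u
    rcases hcases u with ⟨h1, h2, h3⟩ | ⟨h1, h2, h3, h4⟩ | ⟨h1, r, h2, h3, h4⟩
    · simp only [I, g, h1, h3]
      simp
      exact hε0
    · simp only [I, g, h1, h2, h4]
      simp
      exact hε0
    · have hne : (centerNbrs G R u).Nonempty := ⟨r, h2⟩
      simp only [I, g, h1, h3, hne, and_self, if_true, Bool.false_eq_true, if_false]
      rw [← h3, h4]
      have hcard : 1 ≤ (centerNbrs G R u).card := Finset.card_pos.2 hne
      refine le_trans ?_ ((le_sum_strictMax hcard hM1).trans (le_of_eq ?_))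
      · have hle : ((centerNbrs G R u).card : ℝ) ≤ n := by
          have := Finset.card_le_univ (centerNbrs G R u)
          rw [Fintype.card_fin] at this
          exact_mod_cast this
        gcongr
        rw [hε, hM]
        push_cast
        rw [div_le_div_iff₀ (by positivity) (by positivity)]
        calc ((centerNbrs G R u).card : ℝ) * (2 ^ Nat.clog 2 n) ^ 4
            ≤ 2 ^ Nat.clog 2 n * (2 ^ Nat.clog 2 n) ^ 4 := by
              gcongr
              exact hle.trans hnS'
          _ = 1 * (2 ^ Nat.clog 2 n) ^ 5 := by ring
          _ ≤ 7201 * (2 ^ Nat.clog 2 n) ^ 5 := by gcongr; norm_num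
      · refine Finset.sum_congr rfl fun x _ => ?_
        rw [← Finset.mul_prod_erase _ _ h2, if_pos h3]
        congr 1
        rw [Finset.prod_congr rfl (g := fun _ => (x : ℝ) / M), Finset.prod_const,
          Finset.card_erase_of_mem h2]
        intro y hy
        rw [if_neg]
        rw [h3]
        exact fun h => Finset.ne_of_mem_erase hy (Option.some.inj h).symm
  have hq : ∀ v, (1 - ε) * (centerCoin n τ (R v)).toReal ≤
      if R v then coinProb n τ (Nat.clog 2 n) else 1 - coinProb n τ (Nat.clog 2 n) := by
    intro v
    have hp1 : (centerProb n τ : ℝ) ≤ 1 := by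
      rw [coe_centerProb (by omega)]; exact min_le_left _ _
    have hp2 := coinProb_le (l := Nat.clog 2 n) (n := n) (by omega) hτ
    cases R v
    · have e : (centerCoin n τ false).toReal = 1 - centerProb n τ := by
        rw [centerCoin, PMF.ofFintype_apply]
        simp only [Bool.false_eq_true, if_false]
        rw [ENNReal.toReal_sub_of_le (by exact_mod_cast hp1) (by simp)]
        simp
      rw [e]
      simp only [Bool.false_eq_true, if_false]
      nlinarith
    · have e : (centerCoin n τ true).toReal = centerProb n τ := by
        rw [centerCoin, PMF.ofFintype_apply]
        simp
      rw [e]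
      simpa using centerProb_mul_le hn hτ hnS hτn
  have hcc : ∀ u, (R u = true ∧ c u = some u) ∨ (R u = false ∧ centerNbrs G R u = ∅ ∧ c u = none) ∨
      (R u = false ∧ ∃ r ∈ centerNbrs G R u, c u = some r) := by
    intro u
    rcases hcases u with ⟨h1, h2, h3⟩ | ⟨h1, h2, h3, h4⟩ | ⟨h1, r, h2, h3, h4⟩
    · exact .inl ⟨h1, h2⟩
    · exact .inr (.inl ⟨h1, h2, h3⟩)
    · exact .inr (.inr ⟨h1, r, h2, h3⟩)
  have hdisj : (tapeLaw (starAlg.bits n τ)).real (⋃ m ∈ Fintype.piFinset I, box τ upd t R c m) =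
      ∑ m ∈ Fintype.piFinset I, (tapeLaw (starAlg.bits n τ)).real (box τ upd t R c m) := by
    refine measureReal_biUnion_finset ?_ (fun m _ => measurableSet_box _ _ _)
    intro m hm m' hm' hne
    rw [Function.onFun, Set.disjoint_left]
    intro ω h h'
    apply hne
    funext u
    have hmu := Fintype.mem_piFinset.1 (Finset.mem_coe.1 hm) u
    have hmu' := Fintype.mem_piFinset.1 (Finset.mem_coe.1 hm') u
    by_cases hact : R u = false ∧ (centerNbrs G R u).Nonempty
    · rcases hcc u with ⟨h1, -⟩ | ⟨-, h2, -⟩ | ⟨h1, r, h2, h3⟩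
      · simp [h1] at hact
      · simp [h2] at hact
      · have g1 := h (.inr ⟨u, r⟩) (mem_boxIdx_inr.2 ⟨h1, h2⟩)
        have g2 := h' (.inr ⟨u, r⟩) (mem_boxIdx_inr.2 ⟨h1, h2⟩)
        simp only [boxSet, Set.mem_ofPred_eq, if_pos h3] at g1 g2
        rw [← g1, g2]
    · simp only [I, if_neg hact, Finset.mem_singleton] at hmu hmu'
      rw [hmu, hmu']
  calc (1 - 2 * n * ε) * ((∏ v, (centerCoin n τ (R v)).toReal) *
        ∏ u, (choiceLaw G τ R u (c u)).toReal)
      ≤ (1 - ε) ^ (2 * n) * ((∏ v, (centerCoin n τ (R v)).toReal) *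
        ∏ u, (choiceLaw G τ R u (c u)).toReal) := by
        gcongr
        have := one_add_mul_le_pow (a := -ε) (by linarith) (2 * n)
        push_cast at this
        rw [← sub_eq_add_neg 1 ε] at this
        linarith
    _ = (∏ v, (1 - ε) * (centerCoin n τ (R v)).toReal) *
        ∏ u, (1 - ε) * (choiceLaw G τ R u (c u)).toReal := by
        rw [Finset.prod_mul_distrib, Finset.prod_mul_distrib, Finset.prod_const, Finset.card_univ,
          Fintype.card_fin, two_mul, pow_add]
        ring
    _ ≤ (∏ v, if R v then coinProb n τ (Nat.clog 2 n) else 1 - coinProb n τ (Nat.clog 2 n)) *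
        ∏ u, ∑ x ∈ I u, g u x := by
        have h1ε : 0 ≤ 1 - ε := by linarith
        have a1 := Finset.prod_le_prod (s := Finset.univ)
          (fun v _ => mul_nonneg h1ε ENNReal.toReal_nonneg) (fun v _ => hq v)
        have a2 := Finset.prod_le_prod (s := Finset.univ)
          (fun u _ => mul_nonneg h1ε ENNReal.toReal_nonneg) (fun u _ => hg u)
        exact mul_le_mul a1 a2
          (Finset.prod_nonneg fun u _ => mul_nonneg h1ε ENNReal.toReal_nonneg)
          ((Finset.prod_nonneg fun v _ => mul_nonneg h1ε ENNReal.toReal_nonneg).trans a1)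
    _ = ∑ m ∈ Fintype.piFinset I, (tapeLaw (starAlg.bits n τ)).real (box τ upd t R c m) := by
        rw [Finset.prod_univ_sum, Finset.mul_sum]
        refine Finset.sum_congr rfl fun m hm => ?_
        rw [tapeLaw_box_eq hn hupd fun u => hI u _ (Fintype.mem_piFinset.1 hm u)]
    _ ≤ _ := by
        rw [← hdisj]
        refine tapeLaw_mono (Set.iUnion₂_subset fun m _ => box_subset hcc m)

end box

end StarContraction

/-! ### From pointwise domination to the coupling. -/

namespace StarContraction

variable {n w τ : ℕ} {upd : ℕ → Update n}

instance (n : ℕ) : Finite (CenterMap n) := inferInstanceAs (Finite (Fin n → Option (Fin n)))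

instance (n : ℕ) : DiscreteMeasurableSpace (CenterMap n) := ⟨fun _ => trivial⟩

lemma starLaw_toReal (G : SimpleGraph (Fin n)) (τ : ℕ) (c : CenterMap n) :
    (starLaw G τ c).toReal = ∑ R : Fin n → Bool,
      (∏ v, (centerCoin n τ (R v)).toReal) * ∏ u, (choiceLaw G τ R u (c u)).toReal := by
  have h : starLaw G τ c = ∑ R : Fin n → Bool,
      (∏ v, centerCoin n τ (R v)) * ∏ u, choiceLaw G τ R u (c u) := by
    refine (PMF.bind_apply _ _ _).trans ?_
    rw [tsum_fintype]
    rfl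
  rw [h, ENNReal.toReal_sum]
  · refine Finset.sum_congr rfl fun R _ => ?_
    rw [ENNReal.toReal_mul, ENNReal.toReal_prod, ENNReal.toReal_prod]
  · intro R _
    exact ENNReal.mul_ne_top (ENNReal.prod_ne_top fun v _ => PMF.apply_ne_top _ _)
      (ENNReal.prod_ne_top fun v _ => PMF.apply_ne_top _ _)

lemma measurable_centerMapAt (hn : 0 < n) (hupd : ValidSeq upd) (t : ℕ) :
    Measurable (centerMapAt τ upd t : Tape w → CenterMap n) :=
  measurable_of_prefix (n + 2 * t) fun ω ω' h => by
    funext v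
    exact congrArg (decodeVertex n) (congrFun (centerAt_congr hn hupd h) v)

lemma le_tapeLaw_centerMapAt (hn : 2 ≤ n) (hupd : ValidSeq upd) (hτ : 1 ≤ τ) (hτn : τ ≤ n) {t : ℕ}
    (hdeg : ∀ u, τ ≤ deg (graphAt upd t) u) (c : CenterMap n) :
    (1 - 2 * n * (7201 / (2 ^ Nat.clog 2 n) ^ 4)) * (starLaw (graphAt upd t) τ c).toReal ≤
    (tapeLaw (starAlg.bits n τ)).real {ω | centerMapAt τ upd t ω = c} := by
  rw [starLaw_toReal, Finset.mul_sum]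
  calc _ ≤ ∑ R : Fin n → Bool, (tapeLaw (starAlg.bits n τ)).real
        {ω | coins n τ ω = R ∧ centerMapAt τ upd t ω = c} :=
        Finset.sum_le_sum fun R _ => le_tapeLaw_coins_center hn hupd hτ hτn hdeg
    _ = (tapeLaw (starAlg.bits n τ)).real (⋃ R ∈ (Finset.univ : Finset (Fin n → Bool)),
        {ω | coins n τ ω = R ∧ centerMapAt τ upd t ω = c}) := by
        refine (measureReal_biUnion_finset ?_ fun R _ => ?_).symm
        · intro R _ R' _ hne
          rw [Function.onFun, Set.disjoint_left]
          exact fun ω h h' => hne (h.1.symm.trans h'.1)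
        · refine measurableSet_of_prefix (n + 2 * t) fun ω ω' h => ?_
          have e : centerMapAt τ upd t ω = centerMapAt τ upd t ω' := by
            funext v
            exact congrArg (decodeVertex n) (congrFun (centerAt_congr (by omega) hupd h) v)
          rw [e, coins_congr fun i hi => h i (by omega)]
    _ ≤ _ := by
        refine tapeLaw_mono (Set.iUnion₂_subset fun R _ => ?_)
        exact fun ω h => h.2

/-- A random variable `f` whose law dominates `s • ν` can be coupled with `ν` so that both agree
with probability at least `s`. -/
theorem exists_coupling {Ω α : Type*} [MeasurableSpace Ω] [MeasurableSpace α] [Finite α]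
    [DiscreteMeasurableSpace α] (T : Measure Ω) [IsProbabilityMeasure T] (ν : Measure α)
    [IsProbabilityMeasure ν] {f : Ω → α} (hf : Measurable f) {s : ENNReal}
    (hs : ∀ c, s * ν {c} ≤ T (f ⁻¹' {c})) :
    ∃ π : Measure (Ω × α), π.map Prod.fst = T ∧ π.map Prod.snd = ν ∧
      s ≤ π {x | f x.1 = x.2} := by
  -- Rejection sampling: accepting the value `c` of `f` with probability `a c` leaves the measure `s
  -- • ν`.
  let a : α → ENNReal := fun c => s * ν {c} / T (f ⁻¹' {c})
  have ha1 : ∀ c, a c ≤ 1 := fun c => ENNReal.div_le_of_le_mul (by rw [one_mul]; exact hs c)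
  have ha : ∀ c, a c * T (f ⁻¹' {c}) = s * ν {c} := by
    intro c
    by_cases h0 : T (f ⁻¹' {c}) = 0
    · have := hs c
      rw [h0, nonpos_iff_eq_zero] at this
      rw [h0, mul_zero, this]
    · exact ENNReal.div_mul_cancel h0 (measure_ne_top _ _)
  have hg : Measurable (fun ω => a (f ω)) := (Measurable.of_discrete (f := a)).comp hf
  have hg' : Measurable (fun ω => 1 - a (f ω)) := measurable_const.sub hg
  set T₁ := T.withDensity fun ω => a (f ω) with hT₁
  set T₂ := T.withDensity fun ω => 1 - a (f ω) with hT₂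
  have hadd : T₁ + T₂ = T := by
    rw [hT₁, hT₂, ← withDensity_add_left hg]
    have : (fun ω => a (f ω)) + (fun ω => 1 - a (f ω)) = 1 := by
      funext ω
      exact add_tsub_cancel_of_le (ha1 _)
    rw [this, withDensity_one]
  have hmap : T₁.map f = s • ν := by
    refine Measure.ext_of_singleton fun c => ?_
    rw [Measure.map_apply hf (MeasurableSet.of_discrete), hT₁,
      withDensity_apply _ (hf MeasurableSet.of_discrete), Measure.smul_apply, smul_eq_mul, ← ha c]
    rw [setLIntegral_congr_fun (g := fun _ => a c) (hf MeasurableSet.of_discrete)]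
    · rw [setLIntegral_const]
    · intro ω hω
      have : f ω = c := hω
      simp only [this]
  have hmass : T₁ Set.univ = s := by
    have := Measure.map_apply (μ := T₁) hf MeasurableSet.univ
    rw [hmap] at this
    simpa using this.symm
  have hmass2 : s + T₂ Set.univ = 1 := by
    rw [← hmass, ← Measure.add_apply, hadd, measure_univ]
  have : SFinite T₂ := by rw [hT₂]; infer_instance
  have hpair : Measurable fun ω => (ω, f ω) := measurable_id.prodMk hf
  -- On the accepted part the second coordinate copies `f`; on the rejected part, of mass `1 - s`,
  -- it is drawn afresh from `ν`.
  refine ⟨T₁.map (fun ω => (ω, f ω)) + T₂.prod ν, ?_, ?_, ?_⟩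
  · rw [Measure.map_add _ _ measurable_fst, Measure.map_map measurable_fst hpair,
      Measure.map_fst_prod, measure_univ, one_smul]
    have : (Prod.fst ∘ fun ω => (ω, f ω)) = id := rfl
    rw [this, Measure.map_id, hadd]
  · rw [Measure.map_add _ _ measurable_snd, Measure.map_map measurable_snd hpair,
      Measure.map_snd_prod]
    have : (Prod.snd ∘ fun ω => (ω, f ω)) = f := rfl
    rw [this, hmap, ← add_smul, hmass2, one_smul]
  · calc s = T₁ ((fun ω => (ω, f ω)) ⁻¹' {x | f x.1 = x.2}) := by
          rw [← hmass]; congr 1; ext; simp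
      _ ≤ T₁.map (fun ω => (ω, f ω)) {x | f x.1 = x.2} :=
          Measure.le_map_apply hpair.aemeasurable _
      _ ≤ _ := by rw [Measure.add_apply]; exact le_self_add

/-! ### Vertices without center -/

lemma coins_of_centerAt_eq_zero {t : ℕ} {v : Fin n} {ω : Tape w}
    (h : centerAt τ upd ω t v = 0) (x : Fin n) (hx : (graphAt upd t).Adj v x) :
    coins n τ ω x = false := by
  cases hv : coins n τ ω v
  · rcases centerOf_other (G := graphAt upd t) (l := Nat.clog 2 n) (prio := prioAt upd ω t) hv with
      ⟨-, h2⟩ | ⟨r, h1, -⟩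
    · exact h2 x hx
    · rw [centerAt] at h; omega
  · rw [centerAt, centerOf_center hv] at h
    omega

/-- For a vertex without center the coins of its at least `τ` neighbors all fail; they stand in
distinct cells, so `one_sub_coinProb_pow_le` applies, followed by a union bound. -/
lemma tapeLaw_no_center_le (hn : 2 ≤ n) (hτ : 1 ≤ τ) (hτn : τ ≤ n) {t : ℕ}
    (hdeg : ∀ u, τ ≤ deg (graphAt upd t) u) :
    (tapeLaw (starAlg.bits n τ)).real {ω | ∃ v, centerAt τ upd ω t v = 0} ≤ 7201 / n := by
  classical
  have hn0 : (0 : ℝ) < n := by exact_mod_cast (by omega : 0 < n)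
  have hnS : n ≤ 2 ^ Nat.clog 2 n := Nat.le_pow_clog (by norm_num) n
  have hle : coinProb n τ (Nat.clog 2 n) ≤ 1 := (coinProb_le (by omega) hτ).trans (by
    rw [coe_centerProb (by omega)]; exact min_le_left _ _)
  have hv : ∀ v, (tapeLaw (starAlg.bits n τ)).real {ω | centerAt τ upd ω t v = 0} ≤
      7201 / (n : ℝ) ^ 2 := by
    intro v
    refine le_trans ?_ (one_sub_coinProb_pow_le hn hτ hnS hτn)
    calc _ ≤ (tapeLaw (starAlg.bits n τ)).real
          {ω | ∀ x ∈ Finset.univ.filter ((graphAt upd t).Adj v),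
            ω ((x : Fin n) : ℕ) ∈ {y : Fin (2 ^ starAlg.bits n τ) | coin n τ (Nat.clog 2 n) y = false}} :=
          tapeLaw_mono fun ω hω x hx => coins_of_centerAt_eq_zero hω x (Finset.mem_filter.1 hx).2
      _ = (1 - coinProb n τ (Nat.clog 2 n)) ^ deg (graphAt upd t) v := by
          rw [Measure.real, tapeLaw_box (pos := fun x : Fin n => (x : ℕ))
            (fun x _ y _ h => Fin.ext h) (fun _ => {y | coin n τ (Nat.clog 2 n) y = false}),
            Finset.prod_const, ENNReal.toReal_pow, ← deg_eq_card]
          congr 1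
          exact wordLaw_coin_eq hn false
      _ ≤ (1 - coinProb n τ (Nat.clog 2 n)) ^ τ := by
          have h0 := coinProb_nonneg (n := n) (τ := τ) (l := Nat.clog 2 n)
          exact pow_le_pow_of_le_one (by linarith) (by linarith) (hdeg v)
  have hU : {ω : Tape (starAlg.bits n τ) | ∃ v, centerAt τ upd ω t v = 0} =
      ⋃ v ∈ (Finset.univ : Finset (Fin n)), {ω | centerAt τ upd ω t v = 0} := by
    ext ω; simp
  rw [hU]
  calc _ ≤ ∑ v : Fin n, 7201 / (n : ℝ) ^ 2 :=
        (measureReal_biUnion_finset_le _ _).trans (Finset.sum_le_sum fun v _ => hv v)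
    _ = 7201 / n := by
        rw [Finset.sum_const, Finset.card_univ, Fintype.card_fin, nsmul_eq_mul]
        field_simp

/-! ### The star contraction -/

/-- `log x ≤ x - 1` at `x = √n` gives `log n ≤ 2 √n`. -/
lemma one_div_le_log (hn : 2 ≤ n) : 1 / (n : ℝ) ≤ 4 / Real.log n ^ 2 := by
  have hn0 : (0 : ℝ) < n := by exact_mod_cast (by omega : 0 < n)
  have hlog := half_le_log hn
  have h1 : Real.log n ≤ 2 * √n := by
    have h := Real.log_le_sub_one_of_pos (Real.sqrt_pos.2 hn0)
    rw [Real.log_sqrt hn0.le] at h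
    linarith
  rw [div_le_div_iff₀ hn0 (by positivity), one_mul]
  calc Real.log n ^ 2 ≤ (2 * √n) ^ 2 := by gcongr
    _ = 4 * (n : ℝ) := by rw [mul_pow, Real.sq_sqrt hn0.le]; norm_num

/-- As `log (4 n ^ 2) ≤ 4 log n` and `1 ≤ 2 log n`, the numerator is at most `22 * 6 log n = 132 log
n`. -/
lemma tapeLaw_busy_le_log (hn : 2 ≤ n) (hupd : ValidSeq upd) (t : ℕ) :
    (tapeLaw (starAlg.bits n τ)).real {ω | Busy τ upd t ω} ≤ 132 / Real.log n ^ 2 := by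
  have hn0 : (0 : ℝ) < n := by exact_mod_cast (by omega : 0 < n)
  have hlog := half_le_log hn
  have hlog0 : 0 < Real.log n := by linarith
  have h2 : Real.log 2 ≤ Real.log n := Real.log_le_log (by norm_num) (by exact_mod_cast hn)
  have h3 : Real.log ((4 * (n * n) : ℕ) : ℝ) ≤ 4 * Real.log n := by
    push_cast
    rw [Real.log_mul (by norm_num) (by positivity), Real.log_mul (by positivity) (by positivity),
      show (4 : ℝ) = 2 ^ 2 by norm_num, Real.log_pow]
    push_cast
    linarith
  have hl := log_le_clog hn
  refine (tapeLaw_busy_le hn hupd t).trans ?_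
  calc 22 * (1 + Real.log ((4 * (n * n) : ℕ) : ℝ)) / ((Nat.clog 2 n : ℝ) ^ 3 + 1)
      ≤ 22 * (6 * Real.log n) / (Real.log n ^ 3) := by
        gcongr
        · linarith
        · have : Real.log n ^ 3 ≤ (Nat.clog 2 n : ℝ) ^ 3 := by gcongr
          linarith
    _ = 132 / Real.log n ^ 2 := by field_simp; norm_num

theorem starAlg_star :
    ∃ C : ℝ, ∀ n τ : ℕ, 2 ≤ n → 1 ≤ τ → ∀ upd : ℕ → Update n, ValidSeq upd →
        ∀ t, τ ≤ minDeg (graphAt upd t) →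
          starAlg.StarWithProb τ upd t (1 - C / Real.log n ^ 2) := by
  -- `132` accounts for pending work. The other failures have probability at most `(14402 + 7201) /
  -- n`, from the coupling and from vertices without center, and `1 / n ≤ 4 / log ^ 2 n`.
  refine ⟨132 + 4 * 21603, fun n τ hn hτ upd hupd t hδ => ?_⟩
  classical
  have hn0 : 0 < n := by omega
  have hdeg : ∀ u, τ ≤ deg (graphAt upd t) u := fun u => hδ.trans (minDeg_le_deg _ u)
  have hτn : τ ≤ n := by
    refine (hdeg ⟨0, hn0⟩).trans ?_
    rw [deg_eq_card]
    exact (Finset.card_le_univ _).trans (by rw [Fintype.card_fin])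
  set ε : ℝ := 2 * n * (7201 / (2 ^ Nat.clog 2 n) ^ 4) with hε
  have hε0 : 0 ≤ ε := by positivity
  obtain ⟨π, h1, h2, h3⟩ := exists_coupling (tapeLaw (starAlg.bits n τ))
    (starLaw (graphAt upd t) τ).toMeasure (measurable_centerMapAt (τ := τ) hn0 hupd t)
    (s := ENNReal.ofReal (1 - ε)) (by
      intro c
      rw [PMF.toMeasure_apply_singleton _ _ MeasurableSet.of_discrete,
        ← ENNReal.ofReal_toReal (PMF.apply_ne_top (starLaw (graphAt upd t) τ) c),
        ← ENNReal.ofReal_mul' ENNReal.toReal_nonneg]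
      have h := le_tapeLaw_centerMapAt hn hupd hτ hτn hdeg c
      refine (ENNReal.ofReal_le_ofReal h).trans (le_of_eq ?_)
      rw [ofReal_measureReal]
      rfl)
  refine ⟨π, h1, h2, ?_⟩
  set Bad : Set (Tape (starAlg.bits n τ)) :=
    {ω | Busy τ upd t ω} ∪ {ω | ∃ v, centerAt τ upd ω t v = 0} with hBad
  have hBadm : MeasurableSet Bad := by
    refine (measurableSet_busy hn0 hupd t).union ?_
    refine measurableSet_of_prefix (n + 2 * t) fun ω ω' h => ?_
    rw [centerAt_congr hn0 hupd h]
  have hsub : {x : Tape (starAlg.bits n τ) × CenterMap n | centerMapAt τ upd t x.1 = x.2} \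
      (Prod.fst ⁻¹' Bad) ⊆ {x | (starAlg.outputAt τ upd x.1 t).center = x.2 ∧
      (starAlg.outputAt τ upd x.1 t).image = x.2 ∧
      (starAlg.outputAt τ upd x.1 t).IsComplete (graphAt upd t)} := by
    rintro ⟨ω, c⟩ ⟨hx, hb⟩
    simp only [hBad, Set.mem_preimage, Set.mem_union, Set.mem_ofPred_eq, not_or, not_exists]
      at hx hb
    obtain ⟨d, hd, hp⟩ := exists_runAt_of_not_busy hn hupd hb.1
    obtain ⟨g1, g2⟩ := hd.isComplete hp hb.2
    have g3 : (starAlg.outputAt τ upd ω t).center = c := by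
      rw [← hx]
      funext v
      exact hd.center v
    exact ⟨g3, g1.trans g3, g2⟩
  have hbad : (tapeLaw (starAlg.bits n τ)).real Bad ≤ 132 / Real.log n ^ 2 + 7201 / n :=
    (measureReal_union_le _ _).trans
      (add_le_add (tapeLaw_busy_le_log hn hupd t) (tapeLaw_no_center_le hn hτ hτn hdeg))
  have hn' : (0 : ℝ) < n := by exact_mod_cast hn0
  have hn1 : (1 : ℝ) ≤ n := by exact_mod_cast (by omega : 1 ≤ n)
  have hεn : ε ≤ 14402 / n := by
    have hnS : (n : ℝ) ≤ 2 ^ Nat.clog 2 n := by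
      exact_mod_cast Nat.le_pow_clog (by norm_num) n
    have : (n : ℝ) ^ 2 ≤ (2 ^ Nat.clog 2 n) ^ 4 := by
      calc (n : ℝ) ^ 2 ≤ n ^ 4 := pow_le_pow_right₀ hn1 (by norm_num)
        _ ≤ _ := by gcongr
    calc ε ≤ 2 * n * (7201 / (n : ℝ) ^ 2) := by rw [hε]; gcongr
      _ = 14402 / n := by field_simp; norm_num
  have hnlog := one_div_le_log hn
  calc ENNReal.ofReal (1 - (132 + 4 * 21603) / Real.log n ^ 2)
      ≤ ENNReal.ofReal ((1 - ε) - (tapeLaw (starAlg.bits n τ)).real Bad) := by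
        refine ENNReal.ofReal_le_ofReal ?_
        have e1 : (132 + 4 * 21603) / Real.log n ^ 2 =
            132 / Real.log n ^ 2 + 21603 * (4 / Real.log n ^ 2) := by ring
        have e2 : 14402 / (n : ℝ) + 7201 / n = 21603 * (1 / n) := by ring
        rw [e1]
        linarith
    _ = ENNReal.ofReal (1 - ε) - tapeLaw (starAlg.bits n τ) Bad := by
        rw [ENNReal.ofReal_sub _ measureReal_nonneg, ofReal_measureReal]
    _ ≤ π {x | centerMapAt τ upd t x.1 = x.2} - π (Prod.fst ⁻¹' Bad) := by
        refine tsub_le_tsub h3 (le_of_eq ?_)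
        rw [← h1, Measure.map_apply measurable_fst hBadm]
    _ ≤ _ := le_measure_sdiff
    _ ≤ _ := measure_mono hsub

end StarContraction

theorem mainTheorem4 :
    ∃ A : DynAlg,
      -- guarantees on every outcome of the random words
      (∃ (C : ℝ) (k : ℕ), ∀ n τ : ℕ, 2 ≤ n → 1 ≤ τ → ∀ upd : ℕ → Update n, ValidSeq upd →
        ∀ ω : Tape (A.bits n τ),
          -- preprocessing time
          (A.initTime τ upd ω : ℝ) ≤ C * n * Real.log n ^ k ∧
          -- worst-case update time
          (∀ t, (A.updateTime τ upd ω t : ℝ) ≤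
            C * (n / max 1 (minDeg (graphAt upd (t + 1)) : ℝ)) * Real.log n ^ k) ∧
          -- amortized update time
          (∀ T, (∑ t ∈ Finset.range T, (A.updateTime τ upd ω t : ℝ)) ≤
            T * (C * Real.log n ^ k)) ∧
          -- the output is a possibly incomplete contraction
          (∀ t, IsCenterAssignment (graphAt upd t) (A.outputAt τ upd ω t).center ∧
            (A.outputAt τ upd ω t).IsContraction (graphAt upd t))) ∧
      -- completeness and star contraction with probability `1 - O(1 / log² n)`
      (∃ C : ℝ, ∀ n τ : ℕ, 2 ≤ n → 1 ≤ τ → ∀ upd : ℕ → Update n, ValidSeq upd →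
        ∀ t, τ ≤ minDeg (graphAt upd t) →
          A.StarWithProb τ upd t (1 - C / Real.log n ^ 2)) ∧
      -- no center changes during `O(δ / log³ n)` updates, except with probability `O(1 / log² n)`
      (∀ c : ℝ, ∃ C : ℝ, ∀ n τ : ℕ, 2 ≤ n → 1 ≤ τ → ∀ upd : ℕ → Update n, ValidSeq upd →
        ∀ t N : ℕ, Real.log n ^ 4 < (minDeg (graphAt upd t) : ℝ) →
          (N : ℝ) ≤ c * minDeg (graphAt upd t) / Real.log n ^ 3 →
          tapeLaw (A.bits n τ)
            {ω | ∃ s, t ≤ s ∧ s < t + N ∧ ∃ v,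
              (A.outputAt τ upd ω (s + 1)).center v ≠ (A.outputAt τ upd ω s).center v} ≤
            ENNReal.ofReal (C / Real.log n ^ 2)) := by
  exact ⟨starAlg, starAlg_deterministic, starAlg_star, starAlg_stable⟩
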